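/- Let $n\in\mathbb N$, let $\mathbb D^n\subset\mathbb C^n$ be the open unit polydisc, and let $0<\alpha<1$. Let $C^\alpha(\mathbb D^n)$ be the space of Hölder-$\alpha$ functions $f:\mathbb D^n\to\mathbb C$ with norm $\|f\|_{C^\alpha}=\sup_{z}|f(z)|+\sup_{z\ne w}|f(z)-f(w)|/|z-w|^\alpha$, and let $Z^\alpha_{(0,1)}(\mathbb D^n)$ be the space of $(0,1)$-forms $g=\sum_{j=1}^n g_j\,d\bar z_j$ with $g_j\in C^\alpha(\mathbb D^n)$ that are $\bar\partial$-closed in the sense of distributions, with norm $\|g\|_{C^\alpha}=\sum_j\|g_j\|_{C^\alpha}$. For a proper subset $J\subsetneq\{1,\dots,n\}$ with complement $K$, and $z\in\mathbb D^n$, let $$\gamma_J(z)=\{\zeta\in\mathbb D^n:\ \zeta_j=z_j\ (j\in J),\ |\zeta_k|=r\ (k\in K)\ \text{for some } r \text{ with } r\le|z_j|\text{ for all }j\in J\},$$ parametrized by $\zeta_k=re^{i\theta_k}$ $(k\in K)$ with parameters $(r,(\theta_k)_{k\in K})$, where $0<\theta_k<2\pi$ and $0<r<1$, $r\le |z_j|$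 for all $j\in J$. Writing $K=\{k_1<\dots<k_m\}$, orient $\gamma_J(z)$ by $dr\wedge d\theta_{k_1}\wedge\dots\wedge d\theta_{k_m}$. Henkin's (unweighted) operator is $$H[g](z)=-\sum_{J\subsetneq\{1,\dots,n\}}\int_{\gamma_J(z)}g(\zeta)\wedge\bigwedge_{s=1}^{m}\frac{1}{2\pi i}\frac{d\zeta_{k_s}}{\zeta_{k_s}-z_{k_s}}.$$ Then for every $g\in Z^\alpha_{(0,1)}(\mathbb D^n)$ and every $z\in\mathbb D^n$ all these integrals converge absolutely; $H[g]\in C^\alpha(\mathbb D^n)$ and $\bar\partial H[g]=g$ on $\mathbb D^n$ in the sense of distributions; and $H:Z^\alpha_{(0,1)}(\mathbb D^n)\to C^\alpha(\mathbb D^n)$ is a bounded linear operator, i.e. it is linear and there is a constant $C$ depending only on $n$ and $\alpha$ with $\|H[g]\|_{C^\alpha}\le C\|g\|_{C^\alpha}$ for all $g\in Z^\alpha_{(0,1)}(\mathbb D^n)$. -/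

import Mathlib

open MeasureTheory Set
open scoped NNReal Distributions

noncomputable section

/-- The open unit polydisc `𝔻ⁿ` in `ℂⁿ`. -/
def polydisc (n : ℕ) : TopologicalSpace.Opens (Fin n → ℂ) where
  carrier := {z | ∀ i, ‖z i‖ < 1}
  is_open' := by
    have h : {z : Fin n → ℂ | ∀ i, ‖z i‖ < 1} = ⋂ i, {z | ‖z i‖ < 1} := by ext; simp
    rw [h]
    exact isOpen_iInter_of_finite fun i => isOpen_lt (by fun_prop) continuous_const

/-- Extension by zero to `ℂⁿ` of a function on the polydisc. All integrals
below run over points of the polydisc, so the values outside play no role. -/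
def zeroExt {n : ℕ} (f : polydisc n → ℂ) (z : Fin n → ℂ) : ℂ :=
  open Classical in if h : z ∈ polydisc n then f ⟨z, h⟩ else 0

/-- The Hölder space `C^α(𝔻ⁿ)`. Distances are measured in the maximum norm of `ℂⁿ`, which is
equivalent to the Euclidean one. Membership implies boundedness since `𝔻ⁿ` is bounded. -/
def holderSpace (n : ℕ) (α : ℝ≥0) : Submodule ℂ (polydisc n → ℂ) where
  carrier := {f | MemHolder α f}
  add_mem' hf hg := hf.add hg
  zero_mem' := memHolder_zero
  smul_mem' _ _ hf := hf.smul

/-- The norm of `C^α(𝔻ⁿ)`: supremum norm plus the best Hölder constant. -/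
def holderNorm {n : ℕ} (α : ℝ≥0) (f : polydisc n → ℂ) : ℝ :=
  (⨆ z, ‖f z‖) + nnHolderNorm α f

/-- The `C^α` norm of the `(0,1)`-form `∑ j, g j dz̄_j`. -/
def formHolderNorm {n : ℕ} (α : ℝ≥0) (g : Fin n → polydisc n → ℂ) : ℝ :=
  ∑ j, holderNorm α (g j)

/-- The Wirtinger derivative `∂φ/∂z̄_j = (∂φ/∂x_j + i ∂φ/∂y_j) / 2`. -/
def wirtingerBar {n : ℕ} (j : Fin n) (φ : (Fin n → ℂ) → ℂ) (z : Fin n → ℂ) : ℂ :=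
  (fderiv ℝ φ z (Pi.single j 1) + Complex.I * fderiv ℝ φ z (Pi.single j Complex.I)) / 2

/-- `∂̄ u = g` on `𝔻ⁿ` in the sense of distributions, i.e. `∂u/∂z̄_j = g j` for all `j`. -/
def IsDbarSolution {n : ℕ} (u : polydisc n → ℂ) (g : Fin n → polydisc n → ℂ) : Prop :=
  ∀ (j : Fin n) (φ : 𝓓(polydisc n, ℂ)),
    ∫ z in (polydisc n : Set (Fin n → ℂ)), zeroExt u z * wirtingerBar j φ z =
      -∫ z in (polydisc n : Set (Fin n → ℂ)), zeroExt (g j) z * φ z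

/-- The `(0,1)`-form `∑ j, g j dz̄_j` is `∂̄`-closed in the sense of distributions, i.e.
`∂(g k)/∂z̄_j = ∂(g j)/∂z̄_k` for all `j`, `k`. -/
def IsDbarClosed {n : ℕ} (g : Fin n → polydisc n → ℂ) : Prop :=
  ∀ (j k : Fin n) (φ : 𝓓(polydisc n, ℂ)),
    ∫ z in (polydisc n : Set (Fin n → ℂ)), zeroExt (g k) z * wirtingerBar j φ z =
      ∫ z in (polydisc n : Set (Fin n → ℂ)), zeroExt (g j) z * wirtingerBar k φ z

theorem zeroExt_add {n : ℕ} (f g : polydisc n → ℂ) (z : Fin n → ℂ) :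
    zeroExt (f + g) z = zeroExt f z + zeroExt g z := by
  unfold zeroExt; split_ifs <;> simp

theorem zeroExt_smul {n : ℕ} (c : ℂ) (f : polydisc n → ℂ) (z : Fin n → ℂ) :
    zeroExt (c • f) z = c * zeroExt f z := by
  unfold zeroExt; split_ifs <;> simp

theorem integrable_zeroExt_mul_wirtingerBar {n : ℕ} {f : polydisc n → ℂ} (hf : Continuous f)
    (j : Fin n) (φ : 𝓓(polydisc n, ℂ)) :
    IntegrableOn (fun z => zeroExt f z * wirtingerBar j φ z) (polydisc n : Set (Fin n → ℂ)) := by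
  have hfd : Continuous (fderiv ℝ φ) := φ.contDiff.continuous_fderiv (by simp)
  have hc : ContinuousOn (zeroExt f) (polydisc n : Set (Fin n → ℂ)) := by
    rw [continuousOn_iff_continuous_domRestrict]
    refine hf.congr fun z => ?_
    have hz : (z : Fin n → ℂ) ∈ polydisc n := z.2
    simp [zeroExt, hz]
  have hK : IntegrableOn (fun z => zeroExt f z * wirtingerBar j φ z) (tsupport φ) := by
    apply ContinuousOn.integrableOn_compact φ.hasCompactSupport
    apply (hc.mono φ.tsupport_subset).mul
    unfold wirtingerBar
    fun_prop
  refine ((integrableOn_iff_integrable_of_support_subset ?_).1 hK).integrableOn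
  intro z hz
  by_contra hn
  have h0 : fderiv ℝ φ z = 0 := by
    by_contra h
    exact hn (support_fderiv_subset ℝ h)
  exact hz (by simp [wirtingerBar, h0])

/-- `Z^α_{(0,1)}(𝔻ⁿ)`: the space of `∂̄`-closed `(0,1)`-forms on `𝔻ⁿ` with coefficients in
`C^α(𝔻ⁿ)`. A form `∑ j, g j dz̄_j` is given by its coefficients. -/
def closedForms (n : ℕ) (α : ℝ≥0) (hα : 0 < α) : Submodule ℂ (Fin n → polydisc n → ℂ) where
  carrier := {g | (∀ j, g j ∈ holderSpace n α) ∧ IsDbarClosed g}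
  add_mem' := by
    rintro g h ⟨hg, hg'⟩ ⟨hh, hh'⟩
    refine ⟨fun j => (holderSpace n α).add_mem (hg j) (hh j), fun j k φ => ?_⟩
    have cont : ∀ {f : polydisc n → ℂ}, f ∈ holderSpace n α → Continuous f :=
      fun hf => hf.holderWith.continuous hα
    simp only [Pi.add_apply, zeroExt_add, add_mul]
    rw [integral_add (integrable_zeroExt_mul_wirtingerBar (cont (hg k)) j φ)
        (integrable_zeroExt_mul_wirtingerBar (cont (hh k)) j φ),
      integral_add (integrable_zeroExt_mul_wirtingerBar (cont (hg j)) k φ)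
        (integrable_zeroExt_mul_wirtingerBar (cont (hh j)) k φ), hg' j k φ, hh' j k φ]
  zero_mem' := ⟨fun _ => (holderSpace n α).zero_mem, fun j k φ => by
    simp [zeroExt]⟩
  smul_mem' := by
    rintro c g ⟨hg, hg'⟩
    refine ⟨fun j => (holderSpace n α).smul_mem c (hg j), fun j k φ => ?_⟩
    simp only [Pi.smul_apply, zeroExt_smul, mul_assoc, integral_const_mul]
    rw [hg' j k φ]

/-! ### Henkin's operator

For a proper subset `J` of the index set, with complement `K`, the chain `γ_J(z)` consists of the
`ζ ∈ 𝔻ⁿ` with `ζ_j = z_j` for `j ∈ J` and `|ζ_k| = r` for all `k ∈ K`, where `r ≤ |z_j|` for all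
`j ∈ J`. It is parametrized by `(r, (θ_k)_{k ∈ K})` through `ζ_k = r exp(i θ_k)` and is oriented
by `(∂_r, (∂_{θ_k})_{k ∈ K})`. The integrand is the form `g ∧ ⋀_{k ∈ K} dζ_k / (2πi (ζ_k - z_k))`,
whose value on the frame is the determinant of the matrix of values of its one-form factors on the
frame vectors; as rows and columns are both indexed by `K` and one extra index, no ordering of
`K` has to be chosen. -/

/-- The parameter domain of `γ_J(z)`. -/
def henkinRegion {n : ℕ} (J : Finset (Fin n)) (z : Fin n → ℂ) :
    Set (ℝ × ({k // k ∉ J} → ℝ)) :=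
  {p | (0 < p.1 ∧ p.1 < 1 ∧ ∀ j ∈ J, p.1 ≤ ‖z j‖) ∧ ∀ k, 0 < p.2 k ∧ p.2 k < 2 * Real.pi}

/-- The point `ζ` of `γ_J(z)` with parameters `p = (r, θ)`. -/
def henkinPoint {n : ℕ} (J : Finset (Fin n)) (z : Fin n → ℂ)
    (p : ℝ × ({k // k ∉ J} → ℝ)) : Fin n → ℂ :=
  fun i => if h : i ∉ J then p.1 * Complex.exp (p.2 ⟨i, h⟩ * Complex.I) else z i

/-- The frame of coordinate vectors of the parametrization at `p = (r, θ)`: `none` stands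
for `∂ζ/∂r` and `some k` for `∂ζ/∂θ_k`. -/
def henkinFrame {n : ℕ} (J : Finset (Fin n)) (p : ℝ × ({k // k ∉ J} → ℝ)) :
    Option {k // k ∉ J} → Fin n → ℂ
  | none => fun i => if h : i ∉ J then Complex.exp (p.2 ⟨i, h⟩ * Complex.I) else 0
  | some k => Pi.single k.1 (p.1 * Complex.I * Complex.exp (p.2 k * Complex.I))

/-- The one-form factors of `g ∧ ⋀_{k ∈ K} dζ_k / (2πi (ζ_k - z_k))` at the point `ζ`, applied to
a tangent vector `v`: `none` stands for `g = ∑ j, g j dζ̄_j` and `some k` for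
`dζ_k / (2πi (ζ_k - z_k))`. -/
def henkinFactor {n : ℕ} (g : Fin n → polydisc n → ℂ) (J : Finset (Fin n)) (z ζ v : Fin n → ℂ) :
    Option {k // k ∉ J} → ℂ
  | none => ∑ j, zeroExt (g j) ζ * (starRingEnd ℂ) (v j)
  | some k => v k.1 / (2 * Real.pi * Complex.I * (ζ k.1 - z k.1))

/-- The pullback of `g ∧ ⋀_{k ∈ K} dζ_k / (2πi (ζ_k - z_k))` to the parameter domain of `γ_J(z)`,
as a density with respect to `dr ∏ dθ_k`. -/
def henkinIntegrand {n : ℕ} (g : Fin n → polydisc n → ℂ) (J : Finset (Fin n)) (z : Fin n → ℂ)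
    (p : ℝ × ({k // k ∉ J} → ℝ)) : ℂ :=
  (Matrix.of fun a b : Option {k // k ∉ J} =>
    henkinFactor g J z (henkinPoint J z p) (henkinFrame J p b) a).det

/-- Henkin's (unweighted) integral operator. At points `z` whose coordinates have
pairwise distinct moduli, exactly one ordering `(j_1, …, j_r)` of each subset `J` satisfies
`|z_{j_1}| ≥ … ≥ |z_{j_r}|`, so that the sum over subsets is the sum over ordered tuples. -/
def henkin {n : ℕ} (g : Fin n → polydisc n → ℂ) (z : polydisc n) : ℂ :=
  -∑ J : Finset (Fin n) with J ≠ Finset.univ,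
    ∫ p in henkinRegion J (z : Fin n → ℂ), henkinIntegrand g J z p

end

open scoped Real

noncomputable section

/-! All chains are treated at once. Every coordinate gets the angle measure δ₀ + dθ, where the atom
means that ζ_j is frozen at z_j; multiplying out the product measure gives one stratum for each set
J of frozen coordinates. Let the weight w_j be the cut-off r ≤ |z_j| at the atom and r
e^{iθ}/(2π(ζ_j - z_j)) elsewhere. Then H[g](z) is minus a single integral of ∏_j w_j · ∑_k ρ_k
g_k(ζ) (`henkin_eq_integral`); the factor ρ_k = 2e^{-iθ_k}, zero at the atom, comes out of the
determinant of the integrand.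

Bounds. The angular integral of |w_j| is O(|r - |z_j||^{-ε}) for every small ε > 0. The product of
these over j, even with an extra factor |r - ρ|^{-α}, is integrable in r uniformly in all singular
points, since α + nε < 1 for a suitable ε (`exists_kernel_bound`). Moving one coordinate by δ
changes its weight by at most |δ|^α times such a singular factor times weights
(`norm_weight_sub_le`). This yields both the supremum and the Hölder bound.

The equation. Freeze all variables but the l-th, call it a, and pair with ∂ψ/∂ā. If the coefficients
are products ∏_j e_j(ζ_j), the angular integral of the k-th component factors into one-variable
functions: β for j = k and τ for j ≠ k. Three facts carry the argument. In r, τ is a primitive of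
β(∂̄e) starting from e(z) (`tau_eq_add_integral_beta`). As a distribution in z, ∂̄τ is ∂̄e cut off
to r ≤ |z|, because the jumps of the frozen term and of the Cauchy integral cancel
(`integral_tau_mul_dbar`). Finally ∂̄β is -e times arc length on |z| = r (`integral_beta_mul_dbar`).
So the component k = l gives the area integral of e_l ψ ∏_{j≠l} τ_j at radius |a|, and the product
rule in r turns it into ∫ ψ g_l plus slice integrals of ∂̄_k g_l over r ≤ |a|. The components k ≠ l
give minus the same slice integrals of ∂̄_l g_k. Closedness makes them cancel
(`sum_integral_pair_mollify`).

A general closed form is mollified by a product bump, which writes it as a superposition of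
translated products, so linearity applies. The mollified form is closed only away from the boundary,
but the slice integrals see only r ≤ |a| with a in the support of ψ and hence stay in a smaller
polydisc. Dominated convergence removes the mollification, and Fubini passes from slices to test
functions of n variables. -/

namespace Henkin

/-! ### Parametrization of all chains by one product measure -/

/-- The measure `δ₀ + dθ|_{(0, 2π)}`. The atom at `0` encodes that a coordinate of `ζ` is
frozen at the corresponding coordinate of `z`. -/
def angleMeasure : Measure ℝ := Measure.dirac 0 + volume.restrict (Ioo 0 (2 * π))

instance : IsFiniteMeasure angleMeasure := by unfold angleMeasure; infer_instance

/-- A coordinate of the point of the chain with radius `r` and angle `θ`. -/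
def node (r : ℝ) (z : ℂ) (θ : ℝ) : ℂ :=
  if θ = 0 then z else r * Complex.exp (θ * Complex.I)

/-- The Cauchy weight of a coordinate. -/
def weight (r : ℝ) (z : ℂ) (θ : ℝ) : ℂ :=
  if θ = 0 then (if r ≤ ‖z‖ then 1 else 0)
  else r * Complex.exp (θ * Complex.I) / (2 * π * (r * Complex.exp (θ * Complex.I) - z))

/-- The factor contributed by the conjugate of the radial derivative. -/
def radial (θ : ℝ) : ℂ := if θ = 0 then 0 else 2 * Complex.exp (-(θ * Complex.I))

theorem measurable_node {X : Type*} [MeasurableSpace X] {r : X → ℝ} {z : X → ℂ} {θ : X → ℝ}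
    (hr : Measurable r) (hz : Measurable z) (hθ : Measurable θ) :
    Measurable fun x => node (r x) (z x) (θ x) := by
  unfold node
  exact Measurable.ite (hθ (measurableSet_singleton 0)) hz (by fun_prop)

theorem measurable_weight {X : Type*} [MeasurableSpace X] {r : X → ℝ} {z : X → ℂ} {θ : X → ℝ}
    (hr : Measurable r) (hz : Measurable z) (hθ : Measurable θ) :
    Measurable fun x => weight (r x) (z x) (θ x) := by
  unfold weight
  refine Measurable.ite (hθ (measurableSet_singleton 0)) ?_ (by fun_prop)
  exact Measurable.ite (measurableSet_le hr hz.norm) measurable_const measurable_const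

theorem measurable_radial : Measurable radial := by
  unfold radial
  exact Measurable.ite (measurableSet_singleton 0) measurable_const (by fun_prop)

theorem norm_radial_le (θ : ℝ) : ‖radial θ‖ ≤ 2 := by
  unfold radial
  split_ifs
  · simp
  · have : ‖Complex.exp (-(θ * Complex.I))‖ = 1 := by
      rw [← neg_mul, ← Complex.ofReal_neg, Complex.norm_exp_ofReal_mul_I]
    simp [this]

theorem norm_circle_point {r : ℝ} (hr : 0 ≤ r) (θ : ℝ) :
    ‖(r : ℂ) * Complex.exp (θ * Complex.I)‖ = r := by
  rw [norm_mul, Complex.norm_exp_ofReal_mul_I, mul_one, Complex.norm_real, Real.norm_of_nonneg hr]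

theorem norm_node_le {r : ℝ} (hr : 0 ≤ r) (z : ℂ) (θ : ℝ) : ‖node r z θ‖ ≤ max r ‖z‖ := by
  unfold node
  split_ifs
  · exact le_max_right _ _
  · rw [norm_circle_point hr]; exact le_max_left _ _

theorem abs_sub_le_norm_circle_sub {r : ℝ} (hr : 0 ≤ r) (z : ℂ) (θ : ℝ) :
    |r - ‖z‖| ≤ ‖(r : ℂ) * Complex.exp (θ * Complex.I) - z‖ := by
  have := abs_norm_sub_norm_le ((r : ℂ) * Complex.exp (θ * Complex.I)) z
  rwa [norm_circle_point hr] at this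

theorem norm_weight_of_ne {r : ℝ} (hr : 0 ≤ r) (z : ℂ) {θ : ℝ} (hθ : θ ≠ 0) :
    ‖weight r z θ‖ = r / (2 * π * ‖(r : ℂ) * Complex.exp (θ * Complex.I) - z‖) := by
  rw [weight, if_neg hθ, norm_div, norm_circle_point hr]
  simp [abs_of_pos Real.pi_pos]

/-- A crude bound for fixed r ≠ |z|, good only for integrability in θ. The estimate that survives
integration in r is `exists_integral_norm_weight_le`. -/
theorem norm_weight_le {r : ℝ} (hr : 0 ≤ r) {z : ℂ} (hz : r ≠ ‖z‖) (θ : ℝ) :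
    ‖weight r z θ‖ ≤ 1 + r / |r - ‖z‖| := by
  have h0 : 0 < |r - ‖z‖| := abs_pos.2 (sub_ne_zero.2 hz)
  have h1 : 0 ≤ r / |r - ‖z‖| := by positivity
  by_cases hθ : θ = 0
  · rw [weight, if_pos hθ]
    split_ifs <;> simp <;> linarith
  · rw [norm_weight_of_ne hr z hθ]
    have h2 := abs_sub_le_norm_circle_sub hr z θ
    have h3 : r / (2 * π * ‖(r : ℂ) * Complex.exp (θ * Complex.I) - z‖) ≤ r / |r - ‖z‖| := by
      apply div_le_div_of_nonneg_left hr h0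
      nlinarith [Real.pi_gt_three]
    linarith

theorem integral_angleMeasure {E : Type*} [NormedAddCommGroup E] [NormedSpace ℝ E] [CompleteSpace E]
    {f : ℝ → E} (hf : IntegrableOn f (Ioo 0 (2 * π))) :
    ∫ θ, f θ ∂angleMeasure = f 0 + ∫ θ in Ioo 0 (2 * π), f θ := by
  rw [angleMeasure, integral_add_measure _ hf, integral_dirac]
  exact integrable_dirac (by simp)

theorem integrableOn_of_integrable_angleMeasure {E : Type*} [NormedAddCommGroup E]
    {f : ℝ → E} (hf : Integrable f angleMeasure) : IntegrableOn f (Ioo 0 (2 * π)) :=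
  hf.mono_measure (Measure.le_add_left le_rfl)

theorem integrable_weight {r : ℝ} (hr : 0 ≤ r) {z : ℂ} (hz : r ≠ ‖z‖) :
    Integrable (weight r z) angleMeasure :=
  Integrable.of_bound
    (measurable_weight measurable_const measurable_const measurable_id).aestronglyMeasurable
    _ (ae_of_all _ (norm_weight_le hr hz))

/-! ### Integrals of powers -/

theorem integrableOn_abs_rpow {s : ℝ} (hs : -1 < s) (K : ℝ) :
    IntegrableOn (fun x : ℝ => |x| ^ s) (Ioo (-K) K) := by
  rcases le_or_gt K 0 with hK | hK
  · rw [Ioo_eq_empty (by linarith)]; exact integrableOn_empty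
  have h1 : IntervalIntegrable (fun x : ℝ => |x| ^ s) volume 0 K := by
    have := intervalIntegral.intervalIntegrable_rpow' (a := 0) (b := K) hs
    refine this.congr ?_
    rw [uIoc_of_le hK.le]
    intro x hx
    simp only [abs_of_pos hx.1]
  have h2 : IntervalIntegrable (fun x : ℝ => |x| ^ s) volume (-K) 0 := by
    have := (IntervalIntegrable.iff_comp_neg (by simp)).1 h1.symm
    simpa using this
  have h3 := h2.trans h1
  exact (intervalIntegrable_iff_integrableOn_Ioo_of_le (by linarith)).1 h3

theorem integrableOn_abs_sub_rpow {s : ℝ} (hs : -1 < s) {a b c K : ℝ} (h1 : -K ≤ b - a)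
    (h2 : c - a ≤ K) : IntegrableOn (fun x : ℝ => |x - a| ^ s) (Ioo b c) := by
  have h := integrableOn_abs_rpow hs K
  have hp : MeasurePreserving (fun x : ℝ => x - a) volume volume := measurePreserving_sub_right _ a
  have he : MeasurableEmbedding (fun x : ℝ => x - a) := measurableEmbedding_subRight a
  have := (hp.integrableOn_comp_preimage he).2 h
  refine this.mono_set ?_
  intro x hx
  simp only [mem_preimage, mem_Ioo] at hx ⊢
  constructor <;> linarith

/-- Translation moves the singular point to 0 and the interval into a fixed one, so the bound
depends on K and s alone. All uniform constants below originate here. -/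
theorem setIntegral_abs_sub_rpow_le {s : ℝ} (hs : -1 < s) {a b c K : ℝ} (h1 : -K ≤ b - a)
    (h2 : c - a ≤ K) :
    ∫ x in Ioo b c, |x - a| ^ s ≤ ∫ x in Ioo (-K) K, |x| ^ s := by
  have h := integrableOn_abs_rpow hs K
  have hp : MeasurePreserving (fun x : ℝ => x - a) volume volume := measurePreserving_sub_right _ a
  have he : MeasurableEmbedding (fun x : ℝ => x - a) := measurableEmbedding_subRight a
  rw [← hp.setIntegral_preimage_emb he (fun x => |x| ^ s)]
  refine setIntegral_mono_set ((hp.integrableOn_comp_preimage he).2 h)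
    (ae_of_all _ fun x => by positivity) (LE.le.eventuallyLE ?_)
  intro x hx
  simp only [mem_preimage, mem_Ioo] at hx ⊢
  constructor <;> linarith

/-! ### The integral of the Cauchy weight over the angle -/

/-- Rotate z to the positive axis and let t be the angular difference. The chord from r to r e^{it}
has length 2r|sin(t/2)| ≥ 2r|t|/π. It is at most twice the distance d from r e^{it} to |z|, since |r
- |z|| ≤ d as well. -/
theorem mul_abs_le_norm_circle_sub {r : ℝ} (hr : 0 ≤ r) (z : ℂ) {θ : ℝ}
    (ht : |θ - z.arg| ≤ π) :
    r * |θ - z.arg| / π ≤ ‖(r : ℂ) * Complex.exp (θ * Complex.I) - z‖ := by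
  set t := θ - z.arg with htdef
  have h1 : ‖(r : ℂ) * Complex.exp (θ * Complex.I) - z‖ =
      ‖(r : ℂ) * Complex.exp (t * Complex.I) - ‖z‖‖ := by
    conv_lhs => rw [← Complex.norm_mul_exp_arg_mul_I z]
    have : (r : ℂ) * Complex.exp (θ * Complex.I) - ‖z‖ * Complex.exp (z.arg * Complex.I) =
        (r * Complex.exp (t * Complex.I) - ‖z‖) * Complex.exp (z.arg * Complex.I) := by
      rw [sub_mul, mul_assoc, ← Complex.exp_add, htdef]
      congr 3
      push_cast; ring_nf
    rw [this, norm_mul, Complex.norm_exp_ofReal_mul_I, mul_one]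
  rw [h1]
  have h2 : |r - ‖z‖| ≤ ‖(r : ℂ) * Complex.exp (t * Complex.I) - ‖z‖‖ := by
    have := abs_sub_le_norm_circle_sub hr (‖z‖ : ℂ) t
    simpa using this
  have h3 : ‖(r : ℂ) * Complex.exp (t * Complex.I) - r‖ ≤
      2 * ‖(r : ℂ) * Complex.exp (t * Complex.I) - ‖z‖‖ := by
    have h4 : (r : ℂ) * Complex.exp (t * Complex.I) - r =
        (r * Complex.exp (t * Complex.I) - ‖z‖) - ((r - ‖z‖ : ℝ) : ℂ) := by push_cast; ring
    rw [h4]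
    refine (norm_sub_le _ _).trans ?_
    rw [Complex.norm_real, Real.norm_eq_abs]
    linarith
  have h5 : ‖(r : ℂ) * Complex.exp (t * Complex.I) - r‖ = r * (2 * |Real.sin (t / 2)|) := by
    have : (r : ℂ) * Complex.exp (t * Complex.I) - r = r * (Complex.exp (Complex.I * t) - 1) := by
      rw [mul_comm Complex.I]; ring
    rw [this, norm_mul, Complex.norm_exp_I_mul_ofReal_sub_one, Complex.norm_real,
      Real.norm_of_nonneg hr]
    simp
  have h6 : 2 / π * |t / 2| ≤ |Real.sin (t / 2)| := by
    apply Real.mul_abs_le_abs_sin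
    rw [abs_div, abs_of_pos (two_pos : (0:ℝ) < 2)]
    linarith
  rw [abs_div, abs_of_pos (two_pos : (0:ℝ) < 2)] at h6
  have h7 : r * (2 * (2 / π * (|t| / 2))) ≤ r * (2 * |Real.sin (t / 2)|) := by gcongr
  have h8 : r * (2 * (2 / π * (|t| / 2))) = 2 * (r * |t| / π) := by ring
  linarith

/-- Interpolation: with d the distance from the circle point to z, write 1/d = d^{-ε} d^{ε-1}, then
use d ≥ |r - |z|| in the first factor and d ≥ r|x|/π in the second. The numerator r of the weight
absorbs r^{ε-1}, so nothing blows up as r → 0. The angular distance x is left free because it is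
measured either to arg z or to arg z + 2π. -/
theorem norm_weight_le_of_abs_le {ε : ℝ} (hε0 : 0 < ε) (hε1 : ε < 1) {r : ℝ} (hr0 : 0 < r)
    (hr1 : r < 1) {z : ℂ} (hz : r ≠ ‖z‖) {θ x : ℝ} (hθ : θ ≠ 0) (hx0 : 0 < |x|)
    (hx : r * |x| / π ≤ ‖(r : ℂ) * Complex.exp (θ * Complex.I) - z‖) :
    ‖weight r z θ‖ ≤ |r - ‖z‖| ^ (-ε) * |x| ^ (ε - 1) := by
  rw [norm_weight_of_ne hr0.le z hθ]
  set d := ‖(r : ℂ) * Complex.exp (θ * Complex.I) - z‖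
  have hd1 : |r - ‖z‖| ≤ d := abs_sub_le_norm_circle_sub hr0.le z θ
  have h0 : 0 < |r - ‖z‖| := abs_pos.2 (sub_ne_zero.2 hz)
  have hd : 0 < d := h0.trans_le hd1
  have hpi := Real.pi_gt_three
  have e1 : d⁻¹ = d ^ (-ε) * d ^ (ε - 1) := by
    rw [← Real.rpow_add hd, show -ε + (ε - 1) = -1 by ring, Real.rpow_neg_one]
  have e2 : d ^ (-ε) ≤ |r - ‖z‖| ^ (-ε) := Real.rpow_le_rpow_of_nonpos h0 hd1 (by linarith)
  have e3 : d ^ (ε - 1) ≤ (r * |x| / π) ^ (ε - 1) :=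
    Real.rpow_le_rpow_of_nonpos (by positivity) hx (by linarith)
  have e4 : (r * |x| / π) ^ (ε - 1) = r ^ (ε - 1) * |x| ^ (ε - 1) * π ^ (1 - ε) := by
    rw [Real.div_rpow (by positivity) (by positivity), Real.mul_rpow (by positivity) (by positivity),
      div_eq_mul_inv, ← Real.rpow_neg Real.pi_pos.le, neg_sub]
  have e5 : π ^ (1 - ε) ≤ π := by
    conv_rhs => rw [← Real.rpow_one π]
    exact Real.rpow_le_rpow_of_exponent_le (by linarith) (by linarith)
  have e6 : r * r ^ (ε - 1) ≤ 1 := by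
    have : r * r ^ (ε - 1) = r ^ ε := by
      conv_lhs => enter [1]; rw [← Real.rpow_one r]
      rw [← Real.rpow_add hr0]; ring_nf
    rw [this]
    exact Real.rpow_le_one hr0.le hr1.le hε0.le
  have e7 : r / (2 * π * d) = (2 * π)⁻¹ * (r * (d ^ (-ε) * d ^ (ε - 1))) := by
    rw [← e1]; field_simp
  rw [e7]
  have h8 : r * (d ^ (-ε) * d ^ (ε - 1)) ≤
      r * (|r - ‖z‖| ^ (-ε) * (r ^ (ε - 1) * |x| ^ (ε - 1) * π)) := by
    gcongr
    calc _ ≤ _ := e3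
      _ = _ := e4
      _ ≤ _ := by gcongr
  have h9 : r * (|r - ‖z‖| ^ (-ε) * (r ^ (ε - 1) * |x| ^ (ε - 1) * π)) ≤
      π * (|r - ‖z‖| ^ (-ε) * |x| ^ (ε - 1)) := by
    have : r * (|r - ‖z‖| ^ (-ε) * (r ^ (ε - 1) * |x| ^ (ε - 1) * π)) =
      (r * r ^ (ε - 1)) * (π * (|r - ‖z‖| ^ (-ε) * |x| ^ (ε - 1))) := by ring
    rw [this]
    exact mul_le_of_le_one_left (by positivity) e6
  have h10 : 0 ≤ |r - ‖z‖| ^ (-ε) * |x| ^ (ε - 1) := by positivity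
  calc (2 * π)⁻¹ * (r * (d ^ (-ε) * d ^ (ε - 1)))
      ≤ (2 * π)⁻¹ * (π * (|r - ‖z‖| ^ (-ε) * |x| ^ (ε - 1))) := by
        exact mul_le_mul_of_nonneg_left (h8.trans h9) (by positivity)
    _ = (|r - ‖z‖| ^ (-ε) * |x| ^ (ε - 1)) / 2 := by field_simp
    _ ≤ _ := by linarith

/-- Angles run over (0, 2π) but arguments over (-π, π], so the direction of z nearest to θ is arg z
or arg z + 2π. Both singularities are kept. -/
theorem norm_weight_le_sum {ε : ℝ} (hε0 : 0 < ε) (hε1 : ε < 1) {r : ℝ} (hr0 : 0 < r)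
    (hr1 : r < 1) {z : ℂ} (hz : r ≠ ‖z‖) {θ : ℝ} (hθ : θ ∈ Ioo 0 (2 * π)) (h1 : θ ≠ z.arg)
    (h2 : θ ≠ z.arg + 2 * π) :
    ‖weight r z θ‖ ≤
      |r - ‖z‖| ^ (-ε) * (|θ - z.arg| ^ (ε - 1) + |θ - (z.arg + 2 * π)| ^ (ε - 1)) := by
  have hp : 0 ≤ |r - ‖z‖| ^ (-ε) := by positivity
  have hp1 : 0 ≤ |θ - z.arg| ^ (ε - 1) := by positivity
  have hp2 : 0 ≤ |θ - (z.arg + 2 * π)| ^ (ε - 1) := by positivity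
  have ha := Complex.neg_pi_lt_arg z
  have ha' := Complex.arg_le_pi z
  by_cases ht : θ - z.arg ≤ π
  · have := norm_weight_le_of_abs_le hε0 hε1 hr0 hr1 hz hθ.1.ne' (abs_pos.2 (sub_ne_zero.2 h1))
      (mul_abs_le_norm_circle_sub hr0.le z (abs_le.2 ⟨by linarith [hθ.1], ht⟩))
    refine this.trans ?_
    gcongr
    linarith
  · push Not at ht
    have hx := mul_abs_le_norm_circle_sub hr0.le z (θ := θ - 2 * π)
      (abs_le.2 ⟨by linarith [hθ.1], by linarith [hθ.2]⟩)
    have e1 : Complex.exp ((θ - 2 * π : ℝ) * Complex.I) = Complex.exp (θ * Complex.I) := by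
      push_cast
      rw [sub_mul, Complex.exp_sub, Complex.exp_two_pi_mul_I, div_one]
    rw [e1, show θ - 2 * π - z.arg = θ - (z.arg + 2 * π) by ring] at hx
    have := norm_weight_le_of_abs_le hε0 hε1 hr0 hr1 hz hθ.1.ne' (abs_pos.2 (sub_ne_zero.2 h2)) hx
    refine this.trans ?_
    gcongr
    linarith

theorem one_le_abs_rpow_neg {a ε : ℝ} (ha : a ≠ 0) (h1 : |a| ≤ 1) (hε : 0 ≤ ε) :
    1 ≤ |a| ^ (-ε) :=
  Real.one_le_rpow_of_pos_of_le_one_of_nonpos (abs_pos.2 ha) h1 (by linarith)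

theorem exists_integral_norm_weight_le {ε : ℝ} (hε0 : 0 < ε) (hε1 : ε < 1) :
    ∃ C : ℝ, 0 ≤ C ∧ ∀ (r : ℝ) (z : ℂ), r ∈ Ioo (0 : ℝ) 1 → ‖z‖ < 1 → r ≠ ‖z‖ →
      ∫ θ, ‖weight r z θ‖ ∂angleMeasure ≤ C * |r - ‖z‖| ^ (-ε) := by
  -- For θ in (0, 2π), both θ - arg z and θ - (arg z + 2π) lie in (-3π, 3π).
  set A := ∫ x in Ioo (-(3 * π)) (3 * π), |x| ^ (ε - 1) with hA
  have hA0 : 0 ≤ A := integral_nonneg fun x => by positivity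
  refine ⟨1 + (A + A), by positivity, fun r z hr hz hrz => ?_⟩
  have hpi := Real.pi_pos
  have ha := Complex.neg_pi_lt_arg z
  have ha' := Complex.arg_le_pi z
  have hI := integrableOn_of_integrable_angleMeasure (integrable_weight hr.1.le hrz).norm
  rw [integral_angleMeasure hI]
  have hs : -1 < ε - 1 := by linarith
  have i1 : IntegrableOn (fun θ : ℝ => |θ - z.arg| ^ (ε - 1)) (Ioo 0 (2 * π)) :=
    integrableOn_abs_sub_rpow hs (K := 3 * π) (by linarith) (by linarith)
  have i2 : IntegrableOn (fun θ : ℝ => |θ - (z.arg + 2 * π)| ^ (ε - 1)) (Ioo 0 (2 * π)) :=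
    integrableOn_abs_sub_rpow hs (K := 3 * π) (by linarith) (by linarith)
  have b1 := setIntegral_abs_sub_rpow_le hs (a := z.arg) (b := 0) (c := 2 * π) (K := 3 * π)
    (by linarith) (by linarith)
  have b2 := setIntegral_abs_sub_rpow_le hs (a := z.arg + 2 * π) (b := 0) (c := 2 * π)
    (K := 3 * π) (by linarith) (by linarith)
  have hp : 0 ≤ |r - ‖z‖| ^ (-ε) := by positivity
  have key : ∫ θ in Ioo 0 (2 * π), ‖weight r z θ‖ ≤ ∫ θ in Ioo 0 (2 * π),
      |r - ‖z‖| ^ (-ε) * (|θ - z.arg| ^ (ε - 1) + |θ - (z.arg + 2 * π)| ^ (ε - 1)) := by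
    refine integral_mono_ae hI ((i1.add i2).const_mul _) ?_
    filter_upwards [ae_restrict_mem measurableSet_Ioo,
      ae_restrict_of_ae (Measure.ae_ne volume z.arg),
      ae_restrict_of_ae (Measure.ae_ne volume (z.arg + 2 * π))] with θ h1 h2 h3
    exact norm_weight_le_sum hε0 hε1 hr.1 hr.2 hrz h1 h2 h3
  rw [integral_const_mul, integral_add i1 i2] at key
  -- The atom contributes at most 1, which the singular factor dominates because |r - |z|| ≤ 1.
  have h0 : ‖weight r z 0‖ ≤ |r - ‖z‖| ^ (-ε) := by
    have : ‖weight r z 0‖ ≤ 1 := by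
      rw [weight, if_pos rfl]; split_ifs <;> simp
    refine this.trans (one_le_abs_rpow_neg (sub_ne_zero.2 hrz) ?_ hε0.le)
    rw [abs_le]; constructor <;> linarith [hr.1, hr.2, norm_nonneg z]
  calc _ ≤ |r - ‖z‖| ^ (-ε) + |r - ‖z‖| ^ (-ε) * (A + A) := by
        refine add_le_add h0 (key.trans ?_)
        gcongr
    _ = _ := by ring

/-! ### Uniform bounds for the kernel -/

/-- The parameter measure of all chains together. -/
def chainMeasure (n : ℕ) : Measure (ℝ × (Fin n → ℝ)) :=
  (volume.restrict (Ioo (0 : ℝ) 1)).prod (Measure.pi fun _ => angleMeasure)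

instance (n : ℕ) : IsFiniteMeasure (chainMeasure n) := by unfold chainMeasure; infer_instance

/-- The product of the Cauchy weights. -/
def kernel {n : ℕ} (z : Fin n → ℂ) (p : ℝ × (Fin n → ℝ)) : ℂ :=
  ∏ j, weight p.1 (z j) (p.2 j)

theorem measurable_kernel {n : ℕ} {X : Type*} [MeasurableSpace X] {z : X → Fin n → ℂ}
    {p : X → ℝ × (Fin n → ℝ)} (hz : Measurable z) (hp : Measurable p) :
    Measurable fun x => kernel (z x) (p x) := by
  unfold kernel
  refine Finset.measurable_fun_prod _ fun j _ => measurable_weight ?_ ?_ ?_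
  · exact hp.fst
  · exact (measurable_pi_apply j).comp hz
  · exact (measurable_pi_apply j).comp hp.snd

theorem ae_ne_norm {n : ℕ} (z : Fin n → ℂ) :
    ∀ᵐ r ∂(volume.restrict (Ioo (0 : ℝ) 1)), ∀ j, r ≠ ‖z j‖ := by
  rw [ae_all_iff]
  exact fun j => ae_restrict_of_ae (Measure.ae_ne volume _)

theorem integrable_kernel_slice {n : ℕ} {z : Fin n → ℂ} {r : ℝ} (hr : 0 ≤ r)
    (hz : ∀ j, r ≠ ‖z j‖) :
    Integrable (fun θ => kernel z (r, θ)) (Measure.pi fun _ : Fin n => angleMeasure) :=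
  Integrable.fintype_prod (fun j => integrable_weight hr (hz j))

theorem integral_norm_kernel_slice {n : ℕ} (z : Fin n → ℂ) (r : ℝ) :
    ∫ θ, ‖kernel z (r, θ)‖ ∂(Measure.pi fun _ : Fin n => angleMeasure) =
      ∏ j, ∫ θ, ‖weight r (z j) θ‖ ∂angleMeasure := by
  simp only [kernel, norm_prod]
  exact integral_fintype_prod_eq_prod (fun j θ => ‖weight r (z j) θ‖)

/-- Replacing every base by the smallest one, m, bounds the product by m to the sum of the
exponents. Which base is smallest varies, so the powers of all of them are added. This separates
singularities that may collide. -/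
theorem rpow_mul_prod_le_sum {ι : Type*} (s : Finset ι) {α ε : ℝ} (hα : 0 ≤ α) (hε : 0 ≤ ε)
    (a : ℝ) (b : ι → ℝ) (ha0 : 0 < a) (hb0 : ∀ i ∈ s, 0 < b i) :
    a ^ (-α) * ∏ i ∈ s, b i ^ (-ε) ≤
      a ^ (-(α + s.card * ε)) + ∑ i ∈ s, b i ^ (-(α + s.card * ε)) := by
  classical
  set σ := α + s.card * ε
  have main : ∀ m : ℝ, 0 < m → m ≤ a → (∀ i ∈ s, m ≤ b i) →
      a ^ (-α) * ∏ i ∈ s, b i ^ (-ε) ≤ m ^ (-σ) := by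
    intro m hm hma hmb
    have h1 : a ^ (-α) ≤ m ^ (-α) := Real.rpow_le_rpow_of_nonpos hm hma (by linarith)
    have h2 : ∏ i ∈ s, b i ^ (-ε) ≤ ∏ i ∈ s, m ^ (-ε) :=
      Finset.prod_le_prod (fun i hi => (Real.rpow_pos_of_pos (hb0 i hi) _).le)
        (fun i hi => Real.rpow_le_rpow_of_nonpos hm (hmb i hi) (by linarith))
    have h3 : m ^ (-σ) = m ^ (-α) * ∏ i ∈ s, m ^ (-ε) := by
      rw [Finset.prod_const, ← Real.rpow_natCast, ← Real.rpow_mul hm.le, ← Real.rpow_add hm]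
      congr 1; ring
    rw [h3]
    exact mul_le_mul h1 h2 (Finset.prod_nonneg fun i hi => (Real.rpow_pos_of_pos (hb0 i hi) _).le)
      (by positivity)
  have hsum : ∀ i ∈ s, 0 ≤ b i ^ (-σ) := fun i hi => (Real.rpow_pos_of_pos (hb0 i hi) _).le
  have ha : 0 ≤ a ^ (-σ) := by positivity
  by_cases h : ∀ i ∈ s, a ≤ b i
  · have := main a ha0 le_rfl h
    linarith [Finset.sum_nonneg hsum]
  · push Not at h
    obtain ⟨k, hk, hka⟩ := h
    obtain ⟨i, hi, hmin⟩ := s.exists_min_image b ⟨k, hk⟩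
    have := main (b i) (hb0 i hi) ((hmin k hk).trans hka.le) hmin
    have h2 := Finset.single_le_sum hsum hi
    linarith

/-- The angles are integrated first, at the cost of |r - |z_j||^{-ε} per coordinate; the remaining
singularities in r have total order below 1. The case α = 0 gives the supremum bound, while α > 0
pays for a Hölder difference in one coordinate. -/
theorem exists_kernel_bound (n : ℕ) {α : ℝ} (hα0 : 0 ≤ α) (hα1 : α < 1) :
    ∃ C : ℝ, 0 ≤ C ∧ ∀ (z : Fin n → ℂ) (ρ : ℝ), (∀ j, ‖z j‖ < 1) → ρ ∈ Icc (0 : ℝ) 1 →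
      Integrable (fun p => |p.1 - ρ| ^ (-α) * ‖kernel z p‖) (chainMeasure n) ∧
      ∫ p, |p.1 - ρ| ^ (-α) * ‖kernel z p‖ ∂(chainMeasure n) ≤ C := by
  -- This makes α + nε < 1. The denominator n + 2, rather than n + 1, keeps ε < 1 also when n = 0
  -- and α = 0.
  set ε := (1 - α) / (n + 2) with hεdef
  have hn : (0 : ℝ) < n + 2 := by positivity
  have hε0 : 0 < ε := div_pos (by linarith) hn
  have hεn : ε * (n + 2) = 1 - α := by rw [hεdef]; field_simp
  have hε1 : α + n * ε < 1 := by nlinarith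
  have hε1' : ε < 1 := by nlinarith [mul_nonneg hε0.le (Nat.cast_nonneg (α := ℝ) n)]
  set σ := α + n * ε with hσ
  obtain ⟨C, hC0, hC⟩ := exists_integral_norm_weight_le hε0 hε1'
  set A := ∫ x in Ioo (-1 : ℝ) 1, |x| ^ (-σ)
  have hA0 : 0 ≤ A := integral_nonneg fun x => by positivity
  refine ⟨C ^ n * ((n + 1) * A), by positivity, fun z ρ hz hρ => ?_⟩
  have hs : -1 < -σ := by linarith
  have iρ : IntegrableOn (fun r : ℝ => |r - ρ| ^ (-σ)) (Ioo 0 1) :=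
    integrableOn_abs_sub_rpow hs (K := 1) (by linarith [hρ.2]) (by linarith [hρ.1])
  have iz : ∀ j, IntegrableOn (fun r : ℝ => |r - ‖z j‖| ^ (-σ)) (Ioo 0 1) := fun j =>
    integrableOn_abs_sub_rpow hs (K := 1) (by linarith [hz j]) (by linarith [norm_nonneg (z j)])
  have bρ : ∫ r in Ioo (0 : ℝ) 1, |r - ρ| ^ (-σ) ≤ A :=
    setIntegral_abs_sub_rpow_le hs (by linarith [hρ.2]) (by linarith [hρ.1])
  have bz : ∀ j, ∫ r in Ioo (0 : ℝ) 1, |r - ‖z j‖| ^ (-σ) ≤ A := fun j =>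
    setIntegral_abs_sub_rpow_le hs (by linarith [hz j]) (by linarith [norm_nonneg (z j)])
  set D : ℝ → ℝ := fun r => C ^ n * (|r - ρ| ^ (-σ) + ∑ j, |r - ‖z j‖| ^ (-σ)) with hD
  have iD : IntegrableOn D (Ioo 0 1) :=
    (iρ.add (integrable_finsetSum _ fun j _ => iz j)).const_mul _
  have bD : ∫ r in Ioo (0 : ℝ) 1, D r ≤ C ^ n * ((n + 1) * A) := by
    rw [hD, integral_const_mul, integral_add iρ (integrable_finsetSum _ fun j _ => iz j),
      integral_finsetSum _ fun j _ => iz j]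
    have : ∑ j, ∫ r in Ioo (0 : ℝ) 1, |r - ‖z j‖| ^ (-σ) ≤ n * A := by
      refine (Finset.sum_le_sum fun j _ => bz j).trans_eq ?_
      simp
    gcongr
    linarith
  have hmeas : AEStronglyMeasurable (fun p => |p.1 - ρ| ^ (-α) * ‖kernel z p‖)
      (chainMeasure n) := by
    have h1 : Measurable fun p : ℝ × (Fin n → ℝ) => kernel z p :=
      measurable_kernel measurable_const measurable_id
    exact Measurable.aestronglyMeasurable (by fun_prop)
  have hle : ∀ᵐ r ∂(volume.restrict (Ioo (0 : ℝ) 1)),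
      Integrable (fun θ => |r - ρ| ^ (-α) * ‖kernel z (r, θ)‖)
        (Measure.pi fun _ : Fin n => angleMeasure) ∧
      ∫ θ, |r - ρ| ^ (-α) * ‖kernel z (r, θ)‖ ∂(Measure.pi fun _ : Fin n => angleMeasure)
        ≤ D r := by
    filter_upwards [ae_ne_norm z, ae_restrict_mem measurableSet_Ioo,
      ae_restrict_of_ae (Measure.ae_ne volume ρ)] with r h1 h2 h3
    refine ⟨(integrable_kernel_slice h2.1.le h1).norm.const_mul _, ?_⟩
    rw [integral_const_mul, integral_norm_kernel_slice]
    have e1 : ∏ j, ∫ θ, ‖weight r (z j) θ‖ ∂angleMeasure ≤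
        ∏ j, (C * |r - ‖z j‖| ^ (-ε)) :=
      Finset.prod_le_prod (fun j _ => integral_nonneg fun _ => norm_nonneg _)
        (fun j _ => hC r (z j) h2 (hz j) (h1 j))
    have e2 := rpow_mul_prod_le_sum Finset.univ hα0 hε0.le |r - ρ| (fun j => |r - ‖z j‖|)
      (abs_pos.2 (sub_ne_zero.2 h3))
      (fun j _ => abs_pos.2 (sub_ne_zero.2 (h1 j)))
    rw [Finset.card_univ, Fintype.card_fin] at e2
    calc |r - ρ| ^ (-α) * ∏ j, ∫ θ, ‖weight r (z j) θ‖ ∂angleMeasure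
        ≤ |r - ρ| ^ (-α) * ∏ j, (C * |r - ‖z j‖| ^ (-ε)) := by gcongr
      _ = C ^ n * (|r - ρ| ^ (-α) * ∏ j, |r - ‖z j‖| ^ (-ε)) := by
        rw [Finset.prod_mul_distrib, Finset.prod_const, Finset.card_univ, Fintype.card_fin]
        ring
      _ ≤ D r := by
        exact mul_le_mul_of_nonneg_left e2 (by positivity)
  have hnn : ∀ r : ℝ, ∀ θ, ‖|r - ρ| ^ (-α) * ‖kernel z (r, θ)‖‖ =
      |r - ρ| ^ (-α) * ‖kernel z (r, θ)‖ := fun r θ =>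
    Real.norm_of_nonneg (by positivity)
  have hint : Integrable (fun p => |p.1 - ρ| ^ (-α) * ‖kernel z p‖) (chainMeasure n) := by
    unfold chainMeasure at hmeas ⊢
    rw [integrable_prod_iff hmeas]
    refine ⟨hle.mono fun r h => h.1, ?_⟩
    simp only [hnn]
    refine Integrable.mono' iD ?_ ?_
    · have := hmeas.norm.integral_prod_right'
      simpa only [hnn] using this
    · filter_upwards [hle] with r h
      rw [Real.norm_of_nonneg (integral_nonneg fun θ => by positivity)]
      exact h.2
  refine ⟨hint, ?_⟩
  unfold chainMeasure at hint ⊢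
  rw [integral_prod _ hint]
  exact (integral_mono_ae hint.integral_prod_left iD (hle.mono fun r h => h.2)).trans bD

/-! ### Henkin's operator as one integral -/

/-- The extension by zero of a family of angles indexed by the complement of `J`. -/
def extendAngle {n : ℕ} (J : Finset (Fin n)) (θ : {k // k ∉ J} → ℝ) (i : Fin n) : ℝ :=
  if h : i ∉ J then θ ⟨i, h⟩ else 0

theorem measurable_extendAngle {n : ℕ} (J : Finset (Fin n)) : Measurable (extendAngle J) := by
  refine measurable_pi_lambda _ fun i => ?_
  unfold extendAngle
  by_cases h : i ∉ J
  · simp only [h, not_false_eq_true, dite_true]; exact measurable_pi_apply _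
  · simp only [h, dite_false]; exact measurable_const

/-- Multiply out the product of the sums δ₀ + dθ, with J the set of indices that take the atom. On
boxes this is `Finset.prod_add`; a box whose i-th side misses 0 for some i in J gets nothing from
the J-th term. -/
theorem pi_angleMeasure (n : ℕ) :
    Measure.pi (fun _ : Fin n => angleMeasure) = ∑ J : Finset (Fin n),
      (Measure.pi fun _ : {k // k ∉ J} => volume.restrict (Ioo 0 (2 * π))).map (extendAngle J) := by
  classical
  refine Measure.pi_eq fun s hs => ?_
  rw [Measure.finsetSum_apply]
  simp only [angleMeasure, Measure.add_apply]
  rw [Finset.prod_add, Finset.powerset_univ]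
  refine Finset.sum_congr rfl fun J _ => ?_
  rw [Measure.map_apply (measurable_extendAngle J) (MeasurableSet.univ_pi hs)]
  by_cases h : ∀ i ∈ J, (0 : ℝ) ∈ s i
  · have h1 : extendAngle J ⁻¹' univ.pi s = univ.pi fun k : {k // k ∉ J} => s k := by
      ext θ
      simp only [mem_preimage, mem_univ_pi]
      constructor
      · intro H k
        have := H k
        simpa [extendAngle, k.2] using this
      · intro H i
        by_cases hi : i ∈ J
        · simpa [extendAngle, hi] using h i hi
        · simpa [extendAngle, hi] using H ⟨i, hi⟩
    have h2 : ∏ i ∈ J, (Measure.dirac (0 : ℝ)) (s i) = 1 :=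
      Finset.prod_eq_one fun i hi => by
        rw [Measure.dirac_apply' _ (hs i)]; simp [h i hi]
    rw [h1, h2, one_mul, Measure.pi_pi]
    rw [← Finset.prod_subtype (Finset.univ \ J) (by simp)
      (fun i => (volume.restrict (Ioo 0 (2 * π))) (s i))]
  · push Not at h
    obtain ⟨i, hi, h0⟩ := h
    have h1 : extendAngle J ⁻¹' univ.pi s = ∅ := by
      ext θ
      simp only [mem_preimage, mem_univ_pi, mem_empty_iff_false, iff_false]
      intro H
      have := H i
      simp [extendAngle, hi, h0] at this
    have h2 : ∏ i ∈ J, (Measure.dirac (0 : ℝ)) (s i) = 0 :=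
      Finset.prod_eq_zero hi (by rw [Measure.dirac_apply' _ (hs i)]; simp [h0])
    rw [h1, h2, measure_empty, zero_mul]

theorem chainMeasure_eq_sum (n : ℕ) :
    chainMeasure n = ∑ J : Finset (Fin n), ((volume.restrict (Ioo (0 : ℝ) 1)).prod
      (Measure.pi fun _ : {k // k ∉ J} => volume.restrict (Ioo 0 (2 * π)))).map
        (Prod.map id (extendAngle J)) := by
  unfold chainMeasure
  rw [pi_angleMeasure, ← Measure.sum_fintype, Measure.prod_sum_right, Measure.sum_fintype]
  refine Finset.sum_congr rfl fun J _ => ?_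
  rw [← Measure.map_prod_map _ _ measurable_id (measurable_extendAngle J), Measure.map_id]

/-- The point of the chain with parameters `p`. -/
def chainPoint {n : ℕ} (z : Fin n → ℂ) (p : ℝ × (Fin n → ℝ)) : Fin n → ℂ :=
  fun j => node p.1 (z j) (p.2 j)

theorem measurable_chainPoint {n : ℕ} {X : Type*} [MeasurableSpace X] {z : X → Fin n → ℂ}
    {p : X → ℝ × (Fin n → ℝ)} (hz : Measurable z) (hp : Measurable p) :
    Measurable fun x => chainPoint (z x) (p x) := by
  refine measurable_pi_lambda _ fun j => measurable_node hp.fst ?_ ?_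
  · exact (measurable_pi_apply j).comp hz
  · exact (measurable_pi_apply j).comp hp.snd

/-- The density of Henkin's operator with respect to `chainMeasure`. -/
def density {n : ℕ} (g : Fin n → (Fin n → ℂ) → ℂ) (z : Fin n → ℂ) (p : ℝ × (Fin n → ℝ)) : ℂ :=
  kernel z p * ∑ k, radial (p.2 k) * g k (chainPoint z p)

/-- The determinant of an arrow matrix whose border column is a multiple of the sum of the
diagonal ones. -/
theorem det_arrow {K : Type*} [Fintype K] [DecidableEq K] (a c : ℂ) (hc : c ≠ 0) (b d : K → ℂ)
    (M : Matrix (Option K) (Option K) ℂ) (h00 : M none none = a) (h01 : ∀ k, M none (some k) = b k)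
    (h10 : ∀ k, M (some k) none = d k)
    (h11 : ∀ j k, M (some j) (some k) = if j = k then c * d k else 0) :
    M.det = (∏ k, (c * d k)) * (a - ∑ k, b k / c) := by
  -- Up to reindexing, the matrix factors as N U. Multiplication by U adds c⁻¹ times the sum of the
  -- diagonal columns to the border column; without that multiple, N is block triangular.
  set N : Matrix (Unit ⊕ K) (Unit ⊕ K) ℂ :=
    Matrix.fromBlocks (Matrix.of fun _ _ => a - ∑ k, b k / c) (Matrix.of fun _ k => b k) 0
      (Matrix.diagonal fun k => c * d k) with hN
  set U : Matrix (Unit ⊕ K) (Unit ⊕ K) ℂ :=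
    Matrix.fromBlocks 1 0 (Matrix.of fun _ _ => c⁻¹) 1 with hU
  have e : M.det = (N * U).det := by
    rw [← Matrix.det_submatrix_equiv_self ((Equiv.optionEquivSumPUnit K).trans
      (Equiv.sumComm _ _)).symm M]
    congr 1
    rw [hN, hU, Matrix.fromBlocks_multiply]
    ext i j
    rcases i with i | i <;> rcases j with j | j
    · simp [h00, Matrix.mul_apply, div_eq_mul_inv]
    · simp [h01]
    · simp [h10, Matrix.mul_apply, Matrix.diagonal_apply]
      field_simp
    · simp [h11, Matrix.diagonal_apply]
      split_ifs with h <;> simp [h]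
  rw [e, Matrix.det_mul, hN, hU, Matrix.det_fromBlocks_zero₂₁, Matrix.det_fromBlocks_zero₁₂]
  simp [mul_comm]

theorem chainPoint_extendAngle {n : ℕ} (J : Finset (Fin n)) (z : Fin n → ℂ)
    {p : ℝ × ({k // k ∉ J} → ℝ)} (hp : ∀ k, p.2 k ≠ 0) :
    chainPoint z (Prod.map id (extendAngle J) p) = henkinPoint J z p := by
  funext i
  by_cases hi : i ∈ J
  · simp [chainPoint, henkinPoint, node, extendAngle, hi]
  · simp [chainPoint, henkinPoint, node, extendAngle, hi, hp]

/-- The frame matrix is an arrow with c = i r, since ∂ζ_k/∂θ_k is i r times ∂ζ_k/∂r. Conjugation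
turns i r into -i r, so in the determinant the angular entries of g add to the radial one instead of
cancelling it. Hence the factor 2. -/
theorem henkinIntegrand_eq {n : ℕ} (g : Fin n → polydisc n → ℂ) (J : Finset (Fin n))
    (z : Fin n → ℂ) {p : ℝ × ({k // k ∉ J} → ℝ)} (hp : p.1 ≠ 0) :
    henkinIntegrand g J z p =
      (∏ k : {k // k ∉ J}, (p.1 * Complex.exp (p.2 k * Complex.I) /
        (2 * π * (p.1 * Complex.exp (p.2 k * Complex.I) - z k)))) *
      ∑ k : {k // k ∉ J}, 2 * Complex.exp (-(p.2 k * Complex.I)) *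
        zeroExt (g k) (henkinPoint J z p) := by
  have hpt : ∀ k : {k // k ∉ J}, henkinPoint J z p k = p.1 * Complex.exp (p.2 k * Complex.I) :=
    fun k => by simp [henkinPoint, k.2]
  have hconj : ∀ k : {k // k ∉ J}, (starRingEnd ℂ) (Complex.exp (p.2 k * Complex.I)) =
      Complex.exp (-(p.2 k * Complex.I)) := fun k => by
    rw [← Complex.exp_conj]; simp
  have hI : (p.1 : ℂ) * Complex.I ≠ 0 := by simp [hp]
  unfold henkinIntegrand
  rw [det_arrow (∑ k : {k // k ∉ J}, zeroExt (g k) (henkinPoint J z p) *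
      Complex.exp (-(p.2 k * Complex.I))) (p.1 * Complex.I) hI
    (fun k : {k // k ∉ J} => zeroExt (g k) (henkinPoint J z p) * -(p.1 * Complex.I *
      Complex.exp (-(p.2 k * Complex.I))))
    (fun k : {k // k ∉ J} => Complex.exp (p.2 k * Complex.I) /
      (2 * π * Complex.I * (p.1 * Complex.exp (p.2 k * Complex.I) - z k)))]
  · congr 1
    · refine Finset.prod_congr rfl fun k _ => ?_
      rw [mul_div_assoc', mul_assoc (2 * (π : ℂ)), mul_comm Complex.I, ← mul_assoc,
        show (p.1 : ℂ) * Complex.I * Complex.exp (p.2 k * Complex.I) =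
          p.1 * Complex.exp (p.2 k * Complex.I) * Complex.I by ring,
        mul_div_mul_right _ _ Complex.I_ne_zero]
    · rw [← Finset.sum_sub_distrib]
      refine Finset.sum_congr rfl fun k _ => ?_
      rw [mul_neg, neg_div, mul_comm (zeroExt _ _) (_ * _), mul_assoc (_ * Complex.I),
        mul_div_cancel_left₀ _ hI]
      ring
  · simp only [Matrix.of_apply, henkinFactor, henkinFrame]
    rw [← Fintype.sum_subtype_add_sum_subtype (fun i => i ∉ J), add_eq_left.2]
    · refine Finset.sum_congr rfl fun k _ => ?_
      simp [k.2, hconj]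
    · refine Finset.sum_eq_zero fun k _ => ?_
      simp [not_not.1 k.2]
  · intro k
    simp only [Matrix.of_apply, henkinFactor, henkinFrame]
    rw [Finset.sum_eq_single k.1]
    · simp [hconj]
    · intro j _ hj; simp [hj]
    · simp
  · intro k
    simp [Matrix.of_apply, henkinFactor, henkinFrame, hpt, k.2]
  · intro j k
    simp only [Matrix.of_apply, henkinFactor, henkinFrame, hpt]
    by_cases h : j = k
    · subst h; simp; ring
    · have : j.1 ≠ k.1 := fun h' => h (Subtype.ext h')
      simp [h, this]

/-- On the stratum J the frozen weights multiply to the cut-off that bounds γ_J(z), and `radial`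
kills the terms k ∈ J of the sum. -/
theorem density_extendAngle {n : ℕ} (g : Fin n → polydisc n → ℂ) (J : Finset (Fin n))
    (z : Fin n → ℂ) {p : ℝ × ({k // k ∉ J} → ℝ)} (hp : p.1 ≠ 0) (hp' : ∀ k, p.2 k ≠ 0) :
    density (fun k => zeroExt (g k)) z (Prod.map id (extendAngle J) p) =
      if ∀ j ∈ J, p.1 ≤ ‖z j‖ then henkinIntegrand g J z p else 0 := by
  classical
  have hw : ∀ i, weight p.1 (z i) (extendAngle J p.2 i) = if h : i ∉ J then
      p.1 * Complex.exp (p.2 ⟨i, h⟩ * Complex.I) /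
        (2 * π * (p.1 * Complex.exp (p.2 ⟨i, h⟩ * Complex.I) - z i))
      else if p.1 ≤ ‖z i‖ then 1 else 0 := by
    intro i
    by_cases hi : i ∈ J
    · simp [weight, extendAngle, hi]
    · simp [weight, extendAngle, hi, hp']
  unfold density kernel
  rw [chainPoint_extendAngle J z hp']
  simp only [Prod.map_fst, Prod.map_snd, id, hw]
  split_ifs with h
  · rw [henkinIntegrand_eq g J z hp]
    congr 1
    · rw [← Fintype.prod_subtype_mul_prod_subtype (fun i => i ∉ J)]
      refine Eq.trans (congrArg₂ _ (Finset.prod_congr rfl fun k _ => ?_)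
        (Finset.prod_eq_one fun k _ => ?_)) (mul_one _)
      · simp [k.2]
      · have hk := not_not.1 k.2
        simp [hk, h _ hk]
    · rw [← Fintype.sum_subtype_add_sum_subtype (fun i => i ∉ J), add_eq_left.2]
      · refine Finset.sum_congr rfl fun k _ => ?_
        simp [k.2, radial, extendAngle, hp']
      · refine Finset.sum_eq_zero fun k _ => ?_
        simp [not_not.1 k.2, radial, extendAngle]
  · push Not at h
    obtain ⟨j, hj, hlt⟩ := h
    rw [Finset.prod_eq_zero (Finset.mem_univ j), zero_mul]
    simp [hj, hlt]

theorem henkin_eq_integral {n : ℕ} (g : Fin n → polydisc n → ℂ) (z : polydisc n)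
    (h : Integrable (density (fun k => zeroExt (g k)) z) (chainMeasure n)) :
    (∀ J : Finset (Fin n), IntegrableOn (henkinIntegrand g J z) (henkinRegion J z)) ∧
    henkin g z = -∫ p, density (fun k => zeroExt (g k)) z p ∂(chainMeasure n) := by
  classical
  set f := density (fun k => zeroExt (g k)) z with hf
  set lam : (J : Finset (Fin n)) → Measure (ℝ × ({k // k ∉ J} → ℝ)) := fun J =>
    (volume.restrict (Ioo (0 : ℝ) 1)).prod
      (Measure.pi fun _ : {k // k ∉ J} => volume.restrict (Ioo 0 (2 * π))) with hlam
  have hmap : ∀ J : Finset (Fin n),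
      Measurable (Prod.map id (extendAngle J) : ℝ × ({k // k ∉ J} → ℝ) → ℝ × (Fin n → ℝ)) :=
    fun J => measurable_id.prodMap (measurable_extendAngle J)
  rw [chainMeasure_eq_sum, integrable_finsetSum_measure] at h
  have hJ : ∀ J, Integrable (f ∘ Prod.map id (extendAngle J)) (lam J) := fun J =>
    (h J (Finset.mem_univ J)).comp_measurable (hmap J)
  have hlamJ : ∀ J, lam J = (volume : Measure (ℝ × ({k // k ∉ J} → ℝ))).restrict
      (Ioo (0 : ℝ) 1 ×ˢ univ.pi fun _ => Ioo 0 (2 * π)) := by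
    intro J
    simp only [hlam]
    rw [← Measure.restrict_pi_pi, Measure.prod_restrict]
    rfl
  have hset : ∀ J : Finset (Fin n), henkinRegion J (z : Fin n → ℂ) =
      (Ioo (0 : ℝ) 1 ×ˢ univ.pi fun _ => Ioo 0 (2 * π)) ∩
        {p | ∀ j ∈ J, p.1 ≤ ‖(z : Fin n → ℂ) j‖} := by
    intro J
    ext p
    simp only [henkinRegion, mem_ofPred_eq, mem_inter_iff, mem_prod, mem_Ioo, mem_univ_pi]
    tauto
  have hm : ∀ J : Finset (Fin n), MeasurableSet
      {p : ℝ × ({k // k ∉ J} → ℝ) | ∀ j ∈ J, p.1 ≤ ‖(z : Fin n → ℂ) j‖} := by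
    intro J
    simp only [ofPred_forall]
    exact Finset.measurableSet_biInter J fun j _ => measurableSet_le measurable_fst measurable_const
  have hbox : ∀ J : Finset (Fin n), MeasurableSet
      (Ioo (0 : ℝ) 1 ×ˢ univ.pi fun _ : {k // k ∉ J} => Ioo 0 (2 * π)) := fun J =>
    measurableSet_Ioo.prod (MeasurableSet.univ_pi fun _ => measurableSet_Ioo)
  have hae : ∀ J, f ∘ Prod.map id (extendAngle J) =ᵐ[lam J]
      {p | ∀ j ∈ J, p.1 ≤ ‖(z : Fin n → ℂ) j‖}.indicator (henkinIntegrand g J z) := by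
    intro J
    rw [hlamJ]
    filter_upwards [ae_restrict_mem (hbox J)] with p hp
    rw [Function.comp, hf, density_extendAngle g J z hp.1.1.ne' fun k => (hp.2 k (mem_univ k)).1.ne']
    simp only [indicator_apply, mem_ofPred_eq]
  constructor
  · intro J
    have := (hJ J).congr (hae J)
    rw [integrable_indicator_iff (hm J), hlamJ] at this
    rw [hset, inter_comm]
    unfold IntegrableOn at this
    rwa [Measure.restrict_restrict (hm J)] at this
  · rw [chainMeasure_eq_sum, integral_finsetSum_measure h, henkin]
    congr 1
    have : ∀ J : Finset (Fin n), ∫ p, f p ∂((lam J).map (Prod.map id (extendAngle J))) =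
        ∫ p in henkinRegion J (z : Fin n → ℂ), henkinIntegrand g J z p := by
      intro J
      rw [integral_map (hmap J).aemeasurable (h J (Finset.mem_univ J)).1]
      refine (integral_congr_ae (hae J)).trans ?_
      rw [integral_indicator (hm J), hlamJ, Measure.restrict_restrict (hm J), hset, inter_comm]
    rw [Finset.sum_congr rfl fun J _ => this J, Finset.sum_filter]
    refine Finset.sum_congr rfl fun J _ => ?_
    split_ifs with hJu
    · rfl
    -- The stratum with all coordinates frozen is not among Henkin's chains. It contributes nothing,
    -- its sum over k ∉ J being empty.
    · push Not at hJu
      subst hJu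
      refine (setIntegral_eq_zero_of_forall_eq_zero fun p hp => ?_).symm
      rw [henkinIntegrand_eq g _ _ hp.1.1.ne', Finset.sum_eq_zero, mul_zero]
      exact fun k _ => absurd (Finset.mem_univ _) k.2

/-! ### Hölder estimates -/

theorem zeroExt_of_mem {n : ℕ} (f : polydisc n → ℂ) {z : Fin n → ℂ} (hz : z ∈ polydisc n) :
    zeroExt f z = f ⟨z, hz⟩ := by
  simp [zeroExt, hz]

theorem continuousOn_zeroExt {n : ℕ} {f : polydisc n → ℂ} (hf : Continuous f) :
    ContinuousOn (zeroExt f) (polydisc n : Set (Fin n → ℂ)) := by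
  rw [continuousOn_iff_continuous_domRestrict]
  exact hf.congr fun z => (zeroExt_of_mem f z.2).symm

theorem measurable_zeroExt {n : ℕ} {f : polydisc n → ℂ} (hf : Continuous f) :
    Measurable (zeroExt f) := by
  classical
  have h : zeroExt f = (polydisc n : Set (Fin n → ℂ)).piecewise (zeroExt f) (fun _ => 0) := by
    funext z
    by_cases hz : z ∈ (polydisc n : Set (Fin n → ℂ))
    · rw [piecewise_eq_of_mem _ _ _ hz]
    · rw [piecewise_eq_of_notMem _ _ _ hz]
      exact dif_neg hz
  rw [h]
  exact (continuousOn_zeroExt hf).measurable_piecewise continuousOn_const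
    (polydisc n).isOpen.measurableSet

theorem dist_polydisc_le {n : ℕ} (z w : polydisc n) : dist z w ≤ 2 := by
  rw [Subtype.dist_eq, dist_pi_le_iff (by norm_num)]
  intro i
  have h1 : ‖(z : Fin n → ℂ) i‖ < 1 := z.2 i
  have h2 : ‖(w : Fin n → ℂ) i‖ < 1 := w.2 i
  rw [dist_eq_norm]
  linarith [norm_sub_le ((z : Fin n → ℂ) i) ((w : Fin n → ℂ) i)]

theorem zero_mem_polydisc (n : ℕ) : (0 : Fin n → ℂ) ∈ polydisc n := fun i => by simp

instance (n : ℕ) : Nonempty (polydisc n) := ⟨⟨0, zero_mem_polydisc n⟩⟩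

theorem bddAbove_norm {n : ℕ} {α : ℝ≥0} {f : polydisc n → ℂ} (hf : MemHolder α f) :
    BddAbove (range fun z => ‖f z‖) := by
  obtain ⟨C, hC⟩ := hf
  let o : polydisc n := ⟨0, zero_mem_polydisc n⟩
  refine ⟨‖f o‖ + C * 2 ^ (α : ℝ), ?_⟩
  rintro _ ⟨z, rfl⟩
  have h := hC.dist_le_of_le (dist_polydisc_le z o)
  rw [dist_eq_norm] at h
  have := norm_le_norm_add_norm_sub' (f z) (f o)
  simp only
  linarith

theorem norm_zeroExt_le {n : ℕ} {α : ℝ≥0} {f : polydisc n → ℂ} (hf : MemHolder α f)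
    (z : Fin n → ℂ) : ‖zeroExt f z‖ ≤ ⨆ z, ‖f z‖ := by
  unfold zeroExt
  split_ifs with h
  · exact le_ciSup (bddAbove_norm hf) (⟨z, h⟩ : polydisc n)
  · rw [norm_zero]
    exact Real.iSup_nonneg fun _ => norm_nonneg _

theorem chainPoint_mem {n : ℕ} {z : Fin n → ℂ} (hz : z ∈ polydisc n) {p : ℝ × (Fin n → ℝ)}
    (hp : p.1 ∈ Ioo (0 : ℝ) 1) : chainPoint z p ∈ polydisc n := fun j =>
  (norm_node_le hp.1.le (z j) (p.2 j)).trans_lt (max_lt hp.2 (hz j))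

theorem chainMeasure_ae_mem (n : ℕ) : ∀ᵐ p ∂(chainMeasure n), p.1 ∈ Ioo (0 : ℝ) 1 :=
  Measure.quasiMeasurePreserving_fst.ae (ae_restrict_mem measurableSet_Ioo)

theorem chainMeasure_ae_ne (n : ℕ) (ρ : ℝ) : ∀ᵐ p ∂(chainMeasure n), p.1 ≠ ρ :=
  Measure.quasiMeasurePreserving_fst.ae (ae_restrict_of_ae (Measure.ae_ne volume ρ))

theorem measurable_density {n : ℕ} {X : Type*} [MeasurableSpace X]
    {g : Fin n → (Fin n → ℂ) → ℂ} (hg : ∀ k, Measurable (g k)) {z : X → Fin n → ℂ}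
    {p : X → ℝ × (Fin n → ℝ)} (hz : Measurable z) (hp : Measurable p) :
    Measurable fun x => density g (z x) (p x) := by
  unfold density
  refine (measurable_kernel hz hp).mul (Finset.measurable_fun_sum _ fun k _ => ?_)
  exact (measurable_radial.comp ((measurable_pi_apply k).comp hp.snd)).mul
    ((hg k).comp (measurable_chainPoint hz hp))

theorem norm_density_le {n : ℕ} {g : Fin n → (Fin n → ℂ) → ℂ} {M : Fin n → ℝ}
    (hM : ∀ k z, ‖g k z‖ ≤ M k) (z : Fin n → ℂ) (p : ℝ × (Fin n → ℝ)) :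
    ‖density g z p‖ ≤ ‖kernel z p‖ * (2 * ∑ k, M k) := by
  unfold density
  rw [norm_mul, Finset.mul_sum]
  gcongr
  refine (norm_sum_le _ _).trans (Finset.sum_le_sum fun k _ => ?_)
  rw [norm_mul]
  exact mul_le_mul (norm_radial_le _) (hM k _) (norm_nonneg _) (by norm_num)

theorem integrable_kernel {n : ℕ} {z : Fin n → ℂ} (hz : z ∈ polydisc n) :
    Integrable (kernel z) (chainMeasure n) := by
  obtain ⟨C, -, hC⟩ := exists_kernel_bound n (le_refl (0 : ℝ)) one_pos
  have := (hC z 0 hz (by simp)).1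
  simp only [neg_zero, Real.rpow_zero, one_mul] at this
  rwa [integrable_norm_iff] at this
  exact (measurable_kernel measurable_const measurable_id).aestronglyMeasurable

theorem integrable_density {n : ℕ} {g : Fin n → (Fin n → ℂ) → ℂ} {M : Fin n → ℝ}
    (hg : ∀ k, Measurable (g k)) (hM : ∀ k z, ‖g k z‖ ≤ M k) {z : Fin n → ℂ}
    (hz : z ∈ polydisc n) : Integrable (density g z) (chainMeasure n) :=
  ((integrable_kernel hz).norm.mul_const (2 * ∑ k, M k)).mono'
    (measurable_density hg measurable_const measurable_id).aestronglyMeasurable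
    (ae_of_all _ (norm_density_le hM z))

/-- Let a and b be the distances from the circle point to z and w, and δ = |z - w|. The Cauchy
weights differ by r δ/(2πab), and δ ≤ a + b gives δ ≤ δ^α (a^{1-α} + b^{1-α}), which splits into the
two terms. At the atom the cut-offs differ only if r separates |z| from |w|; then r is within δ of
both moduli and the right side is at least 1. -/
theorem norm_weight_sub_le {α : ℝ} (hα0 : 0 ≤ α) (hα1 : α ≤ 1) {r : ℝ} (hr : 0 < r) {z w : ℂ}
    (hz : r ≠ ‖z‖) (hw : r ≠ ‖w‖) (θ : ℝ) :
    ‖weight r z θ - weight r w θ‖ ≤ ‖z - w‖ ^ α *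
      (|r - ‖z‖| ^ (-α) * ‖weight r w θ‖ + |r - ‖w‖| ^ (-α) * ‖weight r z θ‖) := by
  have hz0 : 0 < |r - ‖z‖| := abs_pos.2 (sub_ne_zero.2 hz)
  have hw0 : 0 < |r - ‖w‖| := abs_pos.2 (sub_ne_zero.2 hw)
  have hzw : |‖z‖ - ‖w‖| ≤ ‖z - w‖ := abs_norm_sub_norm_le z w
  have one_le : ∀ x : ℝ, 0 < x → x ≤ ‖z - w‖ → 1 ≤ ‖z - w‖ ^ α * x ^ (-α) := by
    intro x hx hxz
    rw [Real.rpow_neg hx.le, ← div_eq_mul_inv, one_le_div (by positivity)]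
    exact Real.rpow_le_rpow hx.le hxz hα0
  by_cases hθ : θ = 0
  · simp only [weight, hθ, if_true]
    rcases lt_or_ge ‖z‖ r with h1 | h1 <;> rcases lt_or_ge ‖w‖ r with h2 | h2
    · simp [not_le.2 h1, not_le.2 h2]
    · simp only [not_le.2 h1, h2, if_true, if_false, zero_sub, norm_neg, norm_one, mul_one,
        norm_zero, mul_zero, add_zero]
      exact one_le _ hz0 (by rw [abs_of_pos (by linarith)]; linarith [neg_abs_le (‖z‖ - ‖w‖)])
    · simp only [not_le.2 h2, h1, if_true, if_false, sub_zero, norm_one, mul_one,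
        norm_zero, mul_zero, zero_add]
      exact one_le _ hw0 (by rw [abs_of_pos (by linarith)]; linarith [le_abs_self (‖z‖ - ‖w‖)])
    · simp only [h1, h2, if_true, sub_self, norm_zero]
      positivity
  · have ha := abs_sub_le_norm_circle_sub hr.le z θ
    have hb := abs_sub_le_norm_circle_sub hr.le w θ
    have hweq : weight r z θ - weight r w θ = (r * Complex.exp (θ * Complex.I)) / (2 * π) *
        (z - w) / ((r * Complex.exp (θ * Complex.I) - z) *
          (r * Complex.exp (θ * Complex.I) - w)) := by
      have h1 : (r : ℂ) * Complex.exp (θ * Complex.I) - z ≠ 0 := norm_pos_iff.1 (hz0.trans_le ha)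
      have h2 : (r : ℂ) * Complex.exp (θ * Complex.I) - w ≠ 0 := norm_pos_iff.1 (hw0.trans_le hb)
      have h3 : (π : ℂ) ≠ 0 := by exact_mod_cast Real.pi_ne_zero
      simp only [weight, if_neg hθ]
      field_simp
      ring
    rw [hweq, norm_weight_of_ne hr.le z hθ, norm_weight_of_ne hr.le w hθ, norm_div, norm_mul,
      norm_div, norm_mul (_ - z), norm_circle_point hr.le]
    have hab : ‖z - w‖ ≤ ‖(r : ℂ) * Complex.exp (θ * Complex.I) - z‖ +
        ‖(r : ℂ) * Complex.exp (θ * Complex.I) - w‖ := by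
      rw [norm_sub_rev _ z]
      simpa using norm_add_le (z - r * Complex.exp (θ * Complex.I))
        (r * Complex.exp (θ * Complex.I) - w)
    set a := ‖(r : ℂ) * Complex.exp (θ * Complex.I) - z‖
    set b := ‖(r : ℂ) * Complex.exp (θ * Complex.I) - w‖
    have ha0 : 0 < a := hz0.trans_le ha
    have hb0 : 0 < b := hw0.trans_le hb
    set δ := ‖z - w‖
    have hδ : 0 ≤ δ := norm_nonneg _
    have e1 : δ ≤ δ ^ α * (a ^ (1 - α) + b ^ (1 - α)) := by
      have e2 : δ ^ (1 - α) ≤ a ^ (1 - α) + b ^ (1 - α) :=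
        (Real.rpow_le_rpow hδ hab (by linarith)).trans
          (Real.rpow_add_le_add_rpow ha0.le hb0.le (by linarith) (by linarith))
      calc δ = δ ^ α * δ ^ (1 - α) := by
            rw [← Real.rpow_add_of_nonneg hδ hα0 (by linarith), add_sub_cancel, Real.rpow_one]
        _ ≤ _ := by gcongr
    have e3 : a ^ (1 - α) = a * a ^ (-α) := by
      rw [sub_eq_add_neg, Real.rpow_add ha0, Real.rpow_one]
    have e4 : b ^ (1 - α) = b * b ^ (-α) := by
      rw [sub_eq_add_neg, Real.rpow_add hb0, Real.rpow_one]
    have e5 : a ^ (-α) ≤ |r - ‖z‖| ^ (-α) := Real.rpow_le_rpow_of_nonpos hz0 ha (by linarith)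
    have e6 : b ^ (-α) ≤ |r - ‖w‖| ^ (-α) := Real.rpow_le_rpow_of_nonpos hw0 hb (by linarith)
    have hpi : ‖(2 : ℂ) * π‖ = 2 * π := by simp [abs_of_pos Real.pi_pos]
    rw [hpi]
    calc r / (2 * π) * δ / (a * b)
        ≤ r / (2 * π) * (δ ^ α * (a ^ (1 - α) + b ^ (1 - α))) / (a * b) := by gcongr
      _ = δ ^ α * (a ^ (-α) * (r / (2 * π * b)) + b ^ (-α) * (r / (2 * π * a))) := by
          rw [e3, e4]; field_simp
      _ ≤ _ := by gcongr

theorem kernel_eq_mul {n : ℕ} (z : Fin n → ℂ) (i : Fin n) (p : ℝ × (Fin n → ℝ)) :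
    kernel z p = weight p.1 (z i) (p.2 i) *
      ∏ j ∈ Finset.univ.erase i, weight p.1 (z j) (p.2 j) :=
  (Finset.mul_prod_erase _ _ (Finset.mem_univ i)).symm

theorem kernel_update {n : ℕ} (z : Fin n → ℂ) (i : Fin n) (a : ℂ) (p : ℝ × (Fin n → ℝ)) :
    kernel (Function.update z i a) p = weight p.1 a (p.2 i) *
      ∏ j ∈ Finset.univ.erase i, weight p.1 (z j) (p.2 j) := by
  rw [kernel_eq_mul _ i, Function.update_self]
  congr 1
  refine Finset.prod_congr rfl fun j hj => ?_
  rw [Function.update_of_ne (Finset.ne_of_mem_erase hj)]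

theorem norm_kernel_sub_le {n : ℕ} {α : ℝ} (hα0 : 0 ≤ α) (hα1 : α ≤ 1) (z : Fin n → ℂ)
    (i : Fin n) (a : ℂ) {p : ℝ × (Fin n → ℝ)} (hr : 0 < p.1) (hz : p.1 ≠ ‖z i‖)
    (ha : p.1 ≠ ‖a‖) :
    ‖kernel z p - kernel (Function.update z i a) p‖ ≤ ‖z i - a‖ ^ α *
      (|p.1 - ‖z i‖| ^ (-α) * ‖kernel (Function.update z i a) p‖ +
        |p.1 - ‖a‖| ^ (-α) * ‖kernel z p‖) := by
  rw [kernel_update, kernel_eq_mul z i, ← sub_mul, norm_mul, norm_mul, norm_mul]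
  calc _ ≤ (‖z i - a‖ ^ α * (|p.1 - ‖z i‖| ^ (-α) * ‖weight p.1 a (p.2 i)‖ +
        |p.1 - ‖a‖| ^ (-α) * ‖weight p.1 (z i) (p.2 i)‖)) * _ :=
        mul_le_mul_of_nonneg_right (norm_weight_sub_le hα0 hα1 hr hz ha _) (norm_nonneg _)
    _ = _ := by ring

theorem norm_zeroExt_sub_le {n : ℕ} {α : ℝ≥0} {f : polydisc n → ℂ} (hf : MemHolder α f)
    {z w : Fin n → ℂ} (hz : z ∈ polydisc n) (hw : w ∈ polydisc n) {d : ℝ} (h : dist z w ≤ d) :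
    ‖zeroExt f z - zeroExt f w‖ ≤ nnHolderNorm α f * d ^ (α : ℝ) := by
  rw [zeroExt_of_mem f hz, zeroExt_of_mem f hw, ← dist_eq_norm]
  exact hf.holderWith.dist_le_of_le (by rwa [Subtype.dist_eq])

theorem update_mem_polydisc {n : ℕ} {z : Fin n → ℂ} (hz : z ∈ polydisc n) (i : Fin n) {a : ℂ}
    (ha : ‖a‖ < 1) : Function.update z i a ∈ polydisc n := by
  intro j
  by_cases h : j = i
  · subst h; simpa using ha
  · simpa [h] using hz j

theorem dist_chainPoint_update_le {n : ℕ} (z : Fin n → ℂ) (i : Fin n) (a : ℂ)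
    (p : ℝ × (Fin n → ℝ)) :
    dist (chainPoint z p) (chainPoint (Function.update z i a) p) ≤ ‖z i - a‖ := by
  rw [dist_pi_le_iff (norm_nonneg _)]
  intro j
  unfold chainPoint node
  by_cases h : j = i
  · subst h
    split_ifs
    · simp [dist_eq_norm]
    · simp
  · simp [h]

/-- With X the form factor of the density, K X - K'X' = (K - K')X + K'(X - X'). The first term uses
the supremum of g and the Hölder estimate of the kernel. The second uses the Hölder constants of g,
as the point on the chain moves no further than z does. -/
theorem norm_density_sub_le {n : ℕ} {α : ℝ≥0} (hα1 : α ≤ 1) {g : Fin n → polydisc n → ℂ}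
    (hg : ∀ k, MemHolder α (g k)) {z : Fin n → ℂ} (hz : z ∈ polydisc n) (i : Fin n) {a : ℂ}
    (ha : ‖a‖ < 1) {p : ℝ × (Fin n → ℝ)} (hp : p.1 ∈ Ioo (0 : ℝ) 1) (hpz : p.1 ≠ ‖z i‖)
    (hpa : p.1 ≠ ‖a‖) :
    ‖density (fun k => zeroExt (g k)) z p -
        density (fun k => zeroExt (g k)) (Function.update z i a) p‖ ≤
      ‖z i - a‖ ^ (α : ℝ) * (2 * formHolderNorm α g *
        (|p.1 - ‖z i‖| ^ (-(α : ℝ)) * ‖kernel (Function.update z i a) p‖ +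
          |p.1 - ‖a‖| ^ (-(α : ℝ)) * ‖kernel z p‖ + ‖kernel (Function.update z i a) p‖)) := by
  set z' := Function.update z i a
  have hz' : z' ∈ polydisc n := update_mem_polydisc hz i ha
  set N := formHolderNorm α g with hN
  have hM : ∑ k, (⨆ z, ‖g k z‖) ≤ N := Finset.sum_le_sum fun k _ => by
    unfold holderNorm; simp
  have hK : ∑ k, (nnHolderNorm α (g k) : ℝ) ≤ N := Finset.sum_le_sum fun k _ => by
    unfold holderNorm
    have : 0 ≤ ⨆ z, ‖g k z‖ := Real.iSup_nonneg fun _ => norm_nonneg _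
    linarith
  have hX : ‖∑ k, radial (p.2 k) * zeroExt (g k) (chainPoint z p)‖ ≤ 2 * N := by
    refine (norm_sum_le _ _).trans ((Finset.sum_le_sum fun k _ => ?_).trans
      ((Finset.mul_sum _ _ _).symm.trans_le (mul_le_mul_of_nonneg_left hM zero_le_two)))
    rw [norm_mul]
    exact mul_le_mul (norm_radial_le _) (norm_zeroExt_le (hg k) _) (norm_nonneg _) (by norm_num)
  have hXX : ‖∑ k, radial (p.2 k) * zeroExt (g k) (chainPoint z p) -
      ∑ k, radial (p.2 k) * zeroExt (g k) (chainPoint z' p)‖ ≤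
      2 * N * ‖z i - a‖ ^ (α : ℝ) := by
    rw [← Finset.sum_sub_distrib]
    refine (norm_sum_le _ _).trans ?_
    calc _ ≤ ∑ k, 2 * (nnHolderNorm α (g k) * ‖z i - a‖ ^ (α : ℝ)) := by
          refine Finset.sum_le_sum fun k _ => ?_
          rw [← mul_sub, norm_mul]
          exact mul_le_mul (norm_radial_le _) (norm_zeroExt_sub_le (hg k) (chainPoint_mem hz hp)
            (chainPoint_mem hz' hp) (dist_chainPoint_update_le z i a p)) (norm_nonneg _)
            (by norm_num)
      _ = 2 * (∑ k, (nnHolderNorm α (g k) : ℝ)) * ‖z i - a‖ ^ (α : ℝ) := by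
          rw [← Finset.mul_sum, ← Finset.sum_mul]; ring
      _ ≤ _ := by gcongr
  have hker := norm_kernel_sub_le (α := (α : ℝ)) α.coe_nonneg (by exact_mod_cast hα1) z i a hp.1 hpz hpa
  unfold density
  set X := ∑ k, radial (p.2 k) * zeroExt (g k) (chainPoint z p)
  set X' := ∑ k, radial (p.2 k) * zeroExt (g k) (chainPoint z' p)
  have hdec : kernel z p * X - kernel z' p * X' =
      (kernel z p - kernel z' p) * X + kernel z' p * (X - X') := by ring
  rw [hdec]
  refine (norm_add_le _ _).trans ?_
  rw [norm_mul, norm_mul]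
  calc _ ≤ ‖z i - a‖ ^ (α : ℝ) * (|p.1 - ‖z i‖| ^ (-(α : ℝ)) * ‖kernel z' p‖ +
        |p.1 - ‖a‖| ^ (-(α : ℝ)) * ‖kernel z p‖) * (2 * N) +
        ‖kernel z' p‖ * (2 * N * ‖z i - a‖ ^ (α : ℝ)) := by gcongr
    _ = _ := by ring

/-- The coordinates are exchanged one at a time; the intermediate points stay inside because the
polydisc is a product. -/
theorem norm_sub_le_of_coordinatewise {n : ℕ} {f : (Fin n → ℂ) → ℂ} {K α : ℝ} (hK : 0 ≤ K)
    (hα : 0 ≤ α)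
    (h : ∀ z ∈ polydisc n, ∀ i, ∀ a : ℂ, ‖a‖ < 1 →
      ‖f z - f (Function.update z i a)‖ ≤ K * ‖z i - a‖ ^ α)
    {z w : Fin n → ℂ} (hz : z ∈ polydisc n) (hw : w ∈ polydisc n) :
    ‖f z - f w‖ ≤ n * K * dist z w ^ α := by
  classical
  have key : ∀ s : Finset (Fin n), s.piecewise w z ∈ polydisc n ∧
      ‖f z - f (s.piecewise w z)‖ ≤ s.card * K * dist z w ^ α := by
    intro s
    induction s using Finset.induction_on with
    | empty => simpa using hz
    | insert i s hi ih =>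
      rw [Finset.piecewise_insert]
      refine ⟨update_mem_polydisc ih.1 i (hw i), ?_⟩
      have h1 := h _ ih.1 i (w i) (hw i)
      rw [Finset.piecewise_eq_of_notMem _ _ _ hi] at h1
      have h2 : ‖z i - w i‖ ^ α ≤ dist z w ^ α :=
        Real.rpow_le_rpow (norm_nonneg _) (by rw [← dist_eq_norm]; exact dist_le_pi_dist z w i) hα
      rw [Finset.card_insert_of_notMem hi]
      push_cast
      calc _ ≤ ‖f z - f (s.piecewise w z)‖ + ‖f (s.piecewise w z) -
            f (Function.update (s.piecewise w z) i (w i))‖ := norm_sub_le_norm_sub_add_norm_sub ..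
        _ ≤ s.card * K * dist z w ^ α + K * dist z w ^ α :=
            add_le_add ih.2 (h1.trans (by gcongr))
        _ = _ := by ring
  have := (key Finset.univ).2
  rwa [Finset.card_univ, Fintype.card_fin, Finset.piecewise_univ] at this

theorem exists_henkin_bound (n : ℕ) {α : ℝ≥0} (hα1 : α < 1) :
    ∃ C : ℝ, 0 ≤ C ∧ ∀ g : Fin n → polydisc n → ℂ, (∀ k, MemHolder α (g k)) → 0 < α →
      (∀ z : polydisc n, ‖henkin g z‖ ≤ C * formHolderNorm α g) ∧
      ∀ z w : polydisc n, ‖henkin g z - henkin g w‖ ≤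
        C * formHolderNorm α g * dist z w ^ (α : ℝ) := by
  obtain ⟨A, hA0, hA⟩ := exists_kernel_bound n α.coe_nonneg (by exact_mod_cast hα1 : (α : ℝ) < 1)
  obtain ⟨B, hB0, hB⟩ := exists_kernel_bound n (le_refl (0 : ℝ)) one_pos
  simp only [neg_zero, Real.rpow_zero, one_mul] at hB
  -- 2B serves the supremum. Each of the n coordinate moves costs 2(A + A + B): one A for each
  -- singular term of the kernel difference, and B for the variation of g.
  refine ⟨2 * B + n * (2 * (A + A + B)), by positivity, fun g hg hα0 => ?_⟩
  set N := formHolderNorm α g with hN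
  have hN0 : 0 ≤ N := Finset.sum_nonneg fun k _ =>
    add_nonneg (Real.iSup_nonneg fun _ => norm_nonneg _) NNReal.zero_le_coe
  have hM : ∑ k, (⨆ z, ‖g k z‖) ≤ N := Finset.sum_le_sum fun k _ => by
    unfold holderNorm; simp
  have hmeas : ∀ k, Measurable (zeroExt (g k)) := fun k =>
    measurable_zeroExt ((hg k).holderWith.continuous hα0)
  have hbd : ∀ k z, ‖zeroExt (g k) z‖ ≤ ⨆ z, ‖g k z‖ := fun k => norm_zeroExt_le (hg k)
  have hint : ∀ z ∈ polydisc n, Integrable (density (fun k => zeroExt (g k)) z) (chainMeasure n) :=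
    fun z hz => integrable_density hmeas hbd hz
  have heq : ∀ z : polydisc n, henkin g z =
      -∫ p, density (fun k => zeroExt (g k)) z p ∂(chainMeasure n) := fun z =>
    (henkin_eq_integral g z (hint z z.2)).2
  constructor
  · intro z
    rw [heq, norm_neg]
    have h1 : ‖∫ p, density (fun k => zeroExt (g k)) z p ∂(chainMeasure n)‖ ≤
        ∫ p, ‖kernel (z : Fin n → ℂ) p‖ * (2 * N) ∂(chainMeasure n) :=
      norm_integral_le_of_norm_le ((integrable_kernel z.2).norm.mul_const _)
        (ae_of_all _ fun p => (norm_density_le hbd z p).trans (by gcongr))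
    rw [integral_mul_const] at h1
    refine h1.trans ?_
    calc _ ≤ B * (2 * N) := by gcongr; exact (hB z 0 z.2 (by simp)).2
      _ ≤ _ := by
        have h2 : 0 ≤ n * (2 * (A + A + B)) * N := by positivity
        linarith
  · intro z w
    have hcoord : ∀ z ∈ polydisc n, ∀ i, ∀ a : ℂ, ‖a‖ < 1 →
        ‖(∫ p, density (fun k => zeroExt (g k)) z p ∂(chainMeasure n)) -
          ∫ p, density (fun k => zeroExt (g k)) (Function.update z i a) p ∂(chainMeasure n)‖ ≤
        2 * N * (A + A + B) * ‖z i - a‖ ^ (α : ℝ) := by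
      intro z hz i a ha
      have hz' := update_mem_polydisc hz i ha
      have i1 := hA (Function.update z i a) ‖z i‖ hz' ⟨norm_nonneg _, (hz i).le⟩
      have i2 := hA z ‖a‖ hz ⟨norm_nonneg _, ha.le⟩
      have i3 := hB (Function.update z i a) 0 hz' (by simp)
      rw [← integral_sub (hint z hz) (hint _ hz')]
      refine (norm_integral_le_of_norm_le
        ((((i1.1.add i2.1).add i3.1).const_mul (2 * N)).const_mul (‖z i - a‖ ^ (α : ℝ))) ?_).trans ?_
      · filter_upwards [chainMeasure_ae_mem n, chainMeasure_ae_ne n ‖z i‖,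
          chainMeasure_ae_ne n ‖a‖] with p h1 h2 h3
        exact norm_density_sub_le hα1.le hg hz i ha h1 h2 h3
      · rw [integral_const_mul, integral_const_mul]
        have hI := integral_add (i1.1.add i2.1) i3.1
        simp only [Pi.add_apply] at hI ⊢
        rw [hI, integral_add i1.1 i2.1]
        calc _ ≤ ‖z i - a‖ ^ (α : ℝ) * (2 * N * (A + A + B)) := by
              gcongr
              · exact i1.2
              · exact i2.2
              · exact i3.2
          _ = _ := by ring
    have := norm_sub_le_of_coordinatewise (by positivity) α.coe_nonneg hcoord z.2 w.2
    rw [heq, heq, neg_sub_neg, norm_sub_rev]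
    refine this.trans ?_
    rw [← Subtype.dist_eq]
    refine mul_le_mul_of_nonneg_right ?_ (by positivity)
    nlinarith [mul_nonneg hB0 hN0]

theorem continuous_of_memHolder {n : ℕ} {α : ℝ≥0} (hα : 0 < α) {f : polydisc n → ℂ}
    (hf : MemHolder α f) : Continuous f := hf.holderWith.continuous hα

/-! ### The Wirtinger derivative in one variable -/

/-- The Wirtinger derivative `∂f/∂z̄` of a function of one complex variable. -/
def dbar (f : ℂ → ℂ) (z : ℂ) : ℂ := (fderiv ℝ f z 1 + Complex.I * fderiv ℝ f z Complex.I) / 2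

theorem fderiv_apply_eq (L : ℂ →L[ℝ] ℂ) (v : ℂ) : L v = v.re * L 1 + v.im * L Complex.I := by
  conv_lhs => rw [show v = v.re • (1 : ℂ) + v.im • Complex.I by
    simp [Complex.re_add_im]]
  rw [map_add, map_smul, map_smul, Complex.real_smul, Complex.real_smul]

/-- This is 2e^{-iθ}∂̄ = ∂_r + (i/r)∂_θ, with the tangential derivative taken along the unit tangent
so that no division by r occurs. -/
theorem polar_dbar (f : ℂ → ℂ) (ζ : ℂ) (θ : ℝ) :
    2 * Complex.exp (-(θ * Complex.I)) * dbar f ζ = fderiv ℝ f ζ (Complex.exp (θ * Complex.I)) +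
      Complex.I * fderiv ℝ f ζ (Complex.I * Complex.exp (θ * Complex.I)) := by
  rw [fderiv_apply_eq _ (Complex.exp _), fderiv_apply_eq _ (_ * _), dbar]
  have h1 : Complex.exp (-(θ * Complex.I)) = Complex.cos θ - Complex.sin θ * Complex.I := by
    rw [← neg_mul, Complex.exp_mul_I, Complex.cos_neg, Complex.sin_neg]; ring
  rw [h1]
  simp only [Complex.mul_re, Complex.mul_im, Complex.I_re, Complex.I_im, zero_mul, one_mul,
    Complex.exp_ofReal_mul_I_re, Complex.exp_ofReal_mul_I_im, zero_sub, zero_add]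
  push_cast
  linear_combination (-(Complex.sin θ) * fderiv ℝ f ζ Complex.I) * Complex.I_sq

theorem dbar_mul {f g : ℂ → ℂ} {z : ℂ} (hf : DifferentiableAt ℝ f z)
    (hg : DifferentiableAt ℝ g z) :
    dbar (fun w => f w * g w) z = dbar f z * g z + f z * dbar g z := by
  unfold dbar
  rw [show (fun w => f w * g w) = f * g from rfl, fderiv_mul hf hg]
  simp only [add_apply, smul_apply, smul_eq_mul]
  ring

theorem dbar_eq_zero {f : ℂ → ℂ} {z : ℂ} (hf : DifferentiableAt ℂ f z) : dbar f z = 0 := by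
  unfold dbar
  rw [hf.fderiv_restrictScalars ℝ]
  simp only [ContinuousLinearMap.coe_restrictScalars']
  have : fderiv ℂ f z Complex.I = Complex.I * fderiv ℂ f z 1 := by
    rw [← smul_eq_mul, ← map_smul, smul_eq_mul, mul_one]
  rw [this]
  linear_combination (1 / 2 * fderiv ℂ f z 1) * Complex.I_sq

theorem dbar_comp_add (f : ℂ → ℂ) (a z : ℂ) : dbar (fun w => f (w + a)) z = dbar f (z + a) := by
  unfold dbar
  rw [fderiv_comp_add_right]

theorem continuous_dbar {f : ℂ → ℂ} (hf : ContDiff ℝ 1 f) : Continuous (dbar f) := by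
  have := hf.continuous_fderiv (by simp)
  unfold dbar
  fun_prop

theorem support_dbar_subset (f : ℂ → ℂ) : Function.support (dbar f) ⊆ tsupport f := by
  intro z hz
  by_contra h
  have h0 : fderiv ℝ f z = 0 := by
    by_contra h'
    exact h (support_fderiv_subset ℝ h')
  exact hz (by simp [dbar, h0])

theorem hasCompactSupport_dbar {f : ℂ → ℂ} (hf : HasCompactSupport f) :
    HasCompactSupport (dbar f) :=
  hf.mono' (support_dbar_subset f)

/-! ### Integration in polar coordinates -/

/-- Integrate the polar form of ∂̄ over the annulus. The radial derivative gives the two boundary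
values after exchanging the integrals, and the tangential one has mean zero over each circle. This
is the only form of Stokes' theorem used. -/
theorem integral_circle_sub {f : ℂ → ℂ} {a b : ℝ} (ha : 0 ≤ a) (hab : a ≤ b)
    (hf : ∀ ζ, a ≤ ‖ζ‖ → ‖ζ‖ ≤ b → ContDiffAt ℝ 1 f ζ) :
    (∫ θ in (0 : ℝ)..2 * π, f (b * Complex.exp (θ * Complex.I))) -
      ∫ θ in (0 : ℝ)..2 * π, f (a * Complex.exp (θ * Complex.I)) =
    ∫ s in a..b, ∫ θ in (0 : ℝ)..2 * π,
      2 * Complex.exp (-(θ * Complex.I)) * dbar f (s * Complex.exp (θ * Complex.I)) := by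
  set Z : ℝ × ℝ → ℂ := fun q => q.1 * Complex.exp (q.2 * Complex.I) with hZ
  have hZc : Continuous Z := by fun_prop
  have hZn : ∀ q : ℝ × ℝ, q.1 ∈ Icc a b → ContDiffAt ℝ 1 f (Z q) := fun q hq => by
    have := norm_circle_point (ha.trans hq.1) q.2
    exact hf _ (by rw [hZ, this]; exact hq.1) (by rw [hZ, this]; exact hq.2)
  have hc : ContinuousOn (fun q => fderiv ℝ f (Z q)) (Icc a b ×ˢ univ) := by
    intro q hq
    have h1 : ContinuousAt (fderiv ℝ f) (Z q) :=
      ((hZn q hq.1).fderiv_right (m := 0) (by simp)).continuousAt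
    exact (h1.comp hZc.continuousAt).continuousWithinAt
  set P : ℝ → ℝ → ℂ := fun s θ => fderiv ℝ f (Z (s, θ)) (Complex.exp (θ * Complex.I)) with hP
  set Q : ℝ → ℝ → ℂ := fun s θ =>
    fderiv ℝ f (Z (s, θ)) (Complex.I * Complex.exp (θ * Complex.I)) with hQ
  have hPc : ContinuousOn P.uncurry (Icc a b ×ˢ univ) :=
    hc.clm_apply (Continuous.continuousOn (by fun_prop))
  have hQc : ContinuousOn Q.uncurry (Icc a b ×ˢ univ) :=
    hc.clm_apply (Continuous.continuousOn (by fun_prop))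
  have slice : ∀ {R : ℝ → ℝ → ℂ}, ContinuousOn R.uncurry (Icc a b ×ˢ univ) → ∀ s ∈ Icc a b,
      Continuous (R s) := by
    intro R hR s hs
    rw [← continuousOn_univ]
    exact hR.comp (Continuous.continuousOn (by fun_prop : Continuous fun θ : ℝ => (s, θ)))
      fun θ _ => ⟨hs, mem_univ θ⟩
  have hpi : (0 : ℝ) ≤ 2 * π := by positivity
  have hPint : IntegrableOn P.uncurry (uIoc a b ×ˢ uIoc 0 (2 * π)) := by
    rw [uIoc_of_le hab, uIoc_of_le hpi]
    refine IntegrableOn.mono_set ?_ (prod_mono Ioc_subset_Icc_self Ioc_subset_Icc_self)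
    exact (hPc.mono (prod_mono_right (subset_univ _))).integrableOn_compact
      (isCompact_Icc.prod isCompact_Icc)
  -- s Q(s, θ) is the θ-derivative of a 2π-periodic function; s > 0 can be cancelled.
  have hQ0 : ∀ s ∈ Icc a b, 0 < s → ∫ θ in (0 : ℝ)..2 * π, Q s θ = 0 := by
    intro s hs hs0
    have hd : ∀ θ : ℝ, HasDerivAt (fun θ : ℝ => f (Z (s, θ))) ((s : ℂ) * Q s θ) θ := by
      intro θ
      have h1 : HasDerivAt (fun θ : ℝ => Z (s, θ))
          (s * (Complex.I * Complex.exp (θ * Complex.I))) θ := by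
        have h3 : HasDerivAt (fun θ : ℝ => Complex.exp (θ * Complex.I))
            (Complex.I * Complex.exp (θ * Complex.I)) θ := by
          have := ((Complex.ofRealCLM.hasDerivAt (x := θ)).mul_const Complex.I).cexp
          simpa [mul_comm] using this
        exact h3.const_mul (s : ℂ)
      have h2 := ((hZn (s, θ) hs).differentiableAt (by simp)).hasFDerivAt.comp_hasDerivAt θ h1
      have h4 : (s : ℂ) * Q s θ = fderiv ℝ f (Z (s, θ))
          (s * (Complex.I * Complex.exp (θ * Complex.I))) := by
        rw [← Complex.real_smul, ← Complex.real_smul, map_smul]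
      rw [h4]
      exact h2
    have hftc := intervalIntegral.integral_eq_sub_of_hasDerivAt (a := 0) (b := 2 * π)
      (fun θ _ => hd θ) ((continuous_const.mul (slice hQc s hs)).intervalIntegrable _ _)
    rw [intervalIntegral.integral_const_mul] at hftc
    have h0 : f (Z (s, 2 * π)) - f (Z (s, 0)) = 0 := by
      simp [hZ, Complex.exp_two_pi_mul_I]
    rw [h0] at hftc
    exact (mul_eq_zero.1 hftc).resolve_left (by exact_mod_cast hs0.ne')
  have hPd : ∀ θ : ℝ, ∫ s in a..b, P s θ = f (Z (b, θ)) - f (Z (a, θ)) := by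
    intro θ
    have hd : ∀ s ∈ Icc a b, HasDerivAt (fun s : ℝ => f (Z (s, θ))) (P s θ) s := by
      intro s hs
      have h1 : HasDerivAt (fun s : ℝ => Z (s, θ)) (Complex.exp (θ * Complex.I)) s := by
        simpa using (Complex.ofRealCLM.hasDerivAt (x := s)).mul_const (Complex.exp (θ * Complex.I))
      exact ((hZn (s, θ) hs).differentiableAt (by simp)).hasFDerivAt.comp_hasDerivAt s h1
    refine intervalIntegral.integral_eq_sub_of_hasDerivAt (f := fun s : ℝ => f (Z (s, θ))) ?_ ?_
    · rw [uIcc_of_le hab]; exact hd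
    · refine ContinuousOn.intervalIntegrable ?_
      rw [uIcc_of_le hab]
      exact hPc.comp (Continuous.continuousOn (by fun_prop : Continuous fun s : ℝ => (s, θ)))
        fun s hs => ⟨hs, mem_univ θ⟩
  have hfc : ∀ s ∈ Icc a b, Continuous fun θ : ℝ => f (Z (s, θ)) := fun s hs =>
    continuous_iff_continuousAt.2 fun θ =>
      (hZn (s, θ) hs).continuousAt.comp (f := fun θ : ℝ => Z (s, θ)) (by fun_prop)
  have hswap := intervalIntegral_intervalIntegral_swap hPint
  simp only [hPd] at hswap
  rw [intervalIntegral.integral_sub ((hfc b ⟨hab, le_rfl⟩).intervalIntegrable _ _)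
    ((hfc a ⟨le_rfl, hab⟩).intervalIntegrable _ _)] at hswap
  rw [← hswap]
  refine intervalIntegral.integral_congr_ae (ae_of_all _ fun s hs => ?_)
  rw [uIoc_of_le hab] at hs
  have hs' : s ∈ Icc a b := Ioc_subset_Icc_self hs
  simp only [polar_dbar]
  change _ = ∫ θ in (0 : ℝ)..2 * π, (P s θ + Complex.I * Q s θ)
  rw [intervalIntegral.integral_add ((slice hPc s hs').intervalIntegrable _ _)
    (((slice hQc s hs').intervalIntegrable _ _).const_mul _),
    intervalIntegral.integral_const_mul, hQ0 s hs' (ha.trans_lt hs.1), mul_zero, add_zero]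

theorem polarCoord_symm_eq (p : ℝ × ℝ) :
    Complex.polarCoord.symm p = p.1 * Complex.exp (p.2 * Complex.I) := by
  rw [Complex.polarCoord_symm_apply, Complex.exp_mul_I]
  simp

theorem integrable_polar {F : ℂ → ℂ} (hm : Measurable F) (hF : Integrable F) :
    Integrable (fun p : ℝ × ℝ => (p.1 : ℂ) * F (p.1 * Complex.exp (p.2 * Complex.I)))
      ((volume.restrict (Ioi 0)).prod (volume.restrict (Ioo (-π) π))) := by
  refine ⟨Measurable.aestronglyMeasurable (by fun_prop), ?_⟩
  rw [Measure.prod_restrict, ← Measure.volume_eq_prod]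
  have h := Complex.lintegral_comp_polarCoord_symm (fun z => ‖F z‖ₑ)
  rw [HasFiniteIntegral]
  refine lt_of_le_of_lt (le_of_eq ?_) (h.trans_lt hF.2)
  rw [polarCoord_target]
  refine setLIntegral_congr_fun (measurableSet_Ioi.prod measurableSet_Ioo) fun p hp => ?_
  rw [polarCoord_symm_eq]
  have : ‖(p.1 : ℂ)‖ₑ = ENNReal.ofReal p.1 := by
    rw [← ofReal_norm, Complex.norm_real, Real.norm_of_nonneg (le_of_lt hp.1)]
  simp only [enorm_mul, this, smul_eq_mul]

theorem integral_circle_shift {G : ℂ → ℂ} (s : ℝ) :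
    ∫ θ in Ioo (-π) π, G (s * Complex.exp (θ * Complex.I)) =
      ∫ θ in Ioo 0 (2 * π), G (s * Complex.exp (θ * Complex.I)) := by
  have hper : Function.Periodic (fun θ : ℝ => G (s * Complex.exp (θ * Complex.I))) (2 * π) := by
    intro θ
    simp only [Complex.ofReal_add, add_mul, Complex.exp_add, Complex.ofReal_mul,
      Complex.ofReal_ofNat, Complex.exp_two_pi_mul_I, mul_one]
  have h := hper.intervalIntegral_add_eq (-π) 0
  rw [zero_add, show -π + 2 * π = π by ring, intervalIntegral.integral_of_le (by linarith [Real.pi_pos]),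
    intervalIntegral.integral_of_le (by positivity), integral_Ioc_eq_integral_Ioo,
    integral_Ioc_eq_integral_Ioo] at h
  exact h

theorem integral_polar {F : ℂ → ℂ} (hm : Measurable F) (hF : Integrable F) :
    ∫ z, F z = ∫ s in Ioi (0 : ℝ), ∫ θ in Ioo 0 (2 * π),
      (s : ℂ) * F (s * Complex.exp (θ * Complex.I)) := by
  rw [← Complex.integral_comp_polarCoord_symm, polarCoord_target]
  have h := integrable_polar hm hF
  have h2 := integral_prod _ h
  rw [Measure.prod_restrict, ← Measure.volume_eq_prod] at h2
  calc _ = ∫ p in Ioi (0 : ℝ) ×ˢ Ioo (-π) π,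
        (p.1 : ℂ) * F (p.1 * Complex.exp (p.2 * Complex.I)) := by
        refine integral_congr_ae (ae_of_all _ fun p => ?_)
        simp only [polarCoord_symm_eq, Complex.real_smul]
    _ = _ := h2
    _ = _ := by
        refine integral_congr_ae (ae_of_all _ fun s => ?_)
        exact integral_circle_shift (G := fun ζ => (s : ℂ) * F ζ) s

/-- After translation the polar Jacobian cancels the singularity. The bound depends on w only
through its modulus, hence is constant along a circle. -/
theorem integrableOn_inv_norm_sub (w : ℂ) (R : ℝ) :
    IntegrableOn (fun z : ℂ => ‖z - w‖⁻¹) (Metric.ball 0 R) ∧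
      ∫ z in Metric.ball (0 : ℂ) R, ‖z - w‖⁻¹ ≤
        ∫ z in Metric.ball (0 : ℂ) (R + ‖w‖), ‖z‖⁻¹ := by
  have h0 : IntegrableOn (fun z : ℂ => ‖z‖⁻¹) (Metric.ball 0 (R + ‖w‖)) := by
    rw [integrableOn_fun_norm_addHaar volume (f := fun y => y⁻¹)]
    have : IntegrableOn (fun _ : ℝ => (1 : ℝ)) (Ioo 0 (R + ‖w‖)) :=
      integrableOn_const (by simp)
    refine this.congr_fun (fun y hy => ?_) measurableSet_Ioo
    simp [Complex.finrank_real_complex, hy.1.ne']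
  have hp : MeasurePreserving (fun x : ℂ => x - w) volume volume := measurePreserving_sub_right _ w
  have he : MeasurableEmbedding (fun x : ℂ => x - w) := measurableEmbedding_subRight w
  have hsub : Metric.ball (0 : ℂ) R ⊆ (fun x : ℂ => x - w) ⁻¹' Metric.ball 0 (R + ‖w‖) := by
    intro z hz
    simp only [mem_preimage, mem_ball_zero_iff] at hz ⊢
    linarith [norm_sub_le z w]
  have h1 := (hp.integrableOn_comp_preimage he).2 h0
  refine ⟨h1.mono_set hsub, ?_⟩
  rw [← hp.setIntegral_preimage_emb he (fun z => ‖z‖⁻¹)]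
  exact setIntegral_mono_set h1 (ae_of_all _ fun _ => by positivity) (LE.le.eventuallyLE hsub)

/-! ### The Cauchy–Pompeiu formula and its consequences -/

theorem intervalIntegral_eq_Ioo (F : ℝ → ℂ) :
    ∫ θ in (0 : ℝ)..2 * π, F θ = ∫ θ in Ioo 0 (2 * π), F θ := by
  rw [intervalIntegral.integral_of_le (by positivity), integral_Ioc_eq_integral_Ioo]

theorem dbar_eq_zero_of_notMem {f : ℂ → ℂ} {z : ℂ} (h : z ∉ tsupport f) : dbar f z = 0 := by
  by_contra h'
  exact h (support_dbar_subset f h')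

theorem exists_support_bound {f : ℂ → ℂ} (hf : HasCompactSupport f) (a : ℝ) :
    ∃ M, a < M ∧ ∀ ζ, M ≤ ‖ζ‖ → ζ ∉ tsupport f := by
  obtain ⟨R, hR⟩ := hf.isBounded.subset_ball 0
  refine ⟨max R (a + 1), by linarith [le_max_right R (a + 1)], fun ζ hζ h => ?_⟩
  have := hR h
  rw [mem_ball_zero_iff] at this
  linarith [le_max_left R (a + 1)]

/-- The annulus formula with its outer circle beyond the support. Smoothness is asked only for |ζ| ≥
a, so that f may have a pole inside. -/
theorem integral_exterior_dbar {f : ℂ → ℂ} {a : ℝ} (ha : 0 ≤ a)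
    (hf : ∀ ζ, a ≤ ‖ζ‖ → ContDiffAt ℝ 1 f ζ) (hc : HasCompactSupport f) :
    ∫ s in Ioi a, ∫ θ in Ioo 0 (2 * π),
        2 * Complex.exp (-(θ * Complex.I)) * dbar f (s * Complex.exp (θ * Complex.I)) =
      -∫ θ in Ioo 0 (2 * π), f (a * Complex.exp (θ * Complex.I)) := by
  obtain ⟨M, haM, hM⟩ := exists_support_bound hc a
  have h := integral_circle_sub ha haM.le (fun ζ h1 _ => hf ζ h1)
  have h0 : ∀ θ : ℝ, f (M * Complex.exp (θ * Complex.I)) = 0 := fun θ =>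
    image_eq_zero_of_notMem_tsupport (hM _ (norm_circle_point (ha.trans haM.le) θ).ge)
  simp only [h0, intervalIntegral.integral_zero, zero_sub, intervalIntegral_eq_Ioo] at h
  rw [h, intervalIntegral.integral_of_le haM.le]
  refine setIntegral_eq_of_subset_of_forall_sdiff_eq_zero measurableSet_Ioi Ioc_subset_Ioi_self ?_
  intro s hs
  have hs1 : M < s := by
    by_contra h'
    exact hs.2 ⟨hs.1, not_lt.1 h'⟩
  refine setIntegral_eq_zero_of_forall_eq_zero fun θ _ => ?_
  rw [dbar_eq_zero_of_notMem (hM _ _), mul_zero]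
  rw [norm_circle_point (ha.trans (le_of_lt hs.1))]
  exact hs1.le

theorem integrable_div_sub {h : ℂ → ℂ} (hm : Measurable h) {M R : ℝ} (hM : ∀ z, ‖h z‖ ≤ M)
    (hR : ∀ z, R ≤ ‖z‖ → h z = 0) (w : ℂ) :
    Integrable (fun z => h z / (w - z)) ∧
      ∫ z, ‖h z / (w - z)‖ ≤ M * ∫ z in Metric.ball (0 : ℂ) (R + ‖w‖), ‖z‖⁻¹ := by
  have hI := integrableOn_inv_norm_sub w R
  have hM0 : 0 ≤ M := (norm_nonneg _).trans (hM 0)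
  have hle : ∀ z, ‖h z / (w - z)‖ ≤
      (Metric.ball (0 : ℂ) R).indicator (fun z => M * ‖z - w‖⁻¹) z := by
    intro z
    by_cases hz : z ∈ Metric.ball (0 : ℂ) R
    · rw [indicator_of_mem hz, norm_div, norm_sub_rev, div_eq_mul_inv]
      gcongr
      exact hM z
    · rw [indicator_of_notMem hz, hR z (by simpa using hz)]
      simp
  have hi : Integrable ((Metric.ball (0 : ℂ) R).indicator fun z => M * ‖z - w‖⁻¹) :=
    (integrable_indicator_iff measurableSet_ball).2 (hI.1.const_mul M)
  have hint : Integrable (fun z => h z / (w - z)) :=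
    hi.mono' (Measurable.aestronglyMeasurable (by fun_prop)) (ae_of_all _ hle)
  refine ⟨hint, (integral_mono hint.norm hi hle).trans ?_⟩
  rw [integral_indicator measurableSet_ball, integral_const_mul]
  exact mul_le_mul_of_nonneg_left hI.2 hM0

theorem exists_norm_bound {h : ℂ → ℂ} (hc : Continuous h) (hs : HasCompactSupport h) :
    ∃ M R : ℝ, 0 ≤ R ∧ (∀ z, ‖h z‖ ≤ M) ∧ ∀ z, R ≤ ‖z‖ → h z = 0 := by
  obtain ⟨M, hM⟩ := hc.bounded_above_of_compact_support hs
  obtain ⟨R, hR0, hR⟩ := exists_support_bound hs 0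
  exact ⟨M, R, hR0.le, hM, fun z hz => image_eq_zero_of_notMem_tsupport (hR z hz)⟩

/-- Centre polar coordinates at z. The Jacobian cancels the pole and leaves -½ · 2e^{-iθ}∂̄f, whose
integral is given by `integral_exterior_dbar` with inner radius 0. -/
theorem cauchy_pompeiu {ψ : ℂ → ℂ} (hψ : ContDiff ℝ 1 ψ) (hc : HasCompactSupport ψ) (z : ℂ) :
    ∫ w, dbar ψ w / (z - w) = π * ψ z := by
  set f : ℂ → ℂ := fun ζ => ψ (ζ + z) with hf
  have hfd : ContDiff ℝ 1 f := hψ.comp (contDiff_id.add contDiff_const)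
  have hfc : HasCompactSupport f := hc.comp_homeomorph (Homeomorph.addRight z)
  have hdf : ∀ ζ, dbar f ζ = dbar ψ (ζ + z) := fun ζ => dbar_comp_add ψ z ζ
  have hcont := continuous_dbar hfd
  obtain ⟨M, R, -, hM, hR⟩ := exists_norm_bound hcont (hasCompactSupport_dbar hfc)
  have hint := (integrable_div_sub hcont.measurable hM hR 0).1
  simp only [zero_sub] at hint
  have h1 : ∫ w, dbar ψ w / (z - w) = ∫ ζ, dbar f ζ / (-ζ) := by
    rw [← integral_add_right_eq_self _ z]
    refine integral_congr_ae (ae_of_all _ fun ζ => ?_)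
    simp only [hdf]
    congr 1; ring
  rw [h1, integral_polar (by fun_prop) hint]
  have h2 := integral_exterior_dbar (a := 0) le_rfl (fun ζ _ => hfd.contDiffAt) hfc
  have h3 : ∫ s in Ioi (0 : ℝ), ∫ θ in Ioo 0 (2 * π), (s : ℂ) * (dbar f (s * Complex.exp (θ * Complex.I)) /
      (-(s * Complex.exp (θ * Complex.I)))) = ∫ s in Ioi (0 : ℝ), (-(1 / 2) : ℂ) *
        ∫ θ in Ioo 0 (2 * π), 2 * Complex.exp (-(θ * Complex.I)) *
          dbar f (s * Complex.exp (θ * Complex.I)) := by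
    refine setIntegral_congr_fun measurableSet_Ioi fun s hs => ?_
    rw [← integral_const_mul]
    refine integral_congr_ae (ae_of_all _ fun θ => ?_)
    have hs0 : (s : ℂ) ≠ 0 := by exact_mod_cast (ne_of_gt hs)
    simp only [Complex.exp_neg]
    have := Complex.exp_ne_zero (θ * Complex.I)
    field_simp
  rw [h3, integral_const_mul, h2]
  have h4 : volume.real (Ioo 0 (2 * π)) = 2 * π := by
    rw [Real.volume_real_Ioo_of_le (by positivity), sub_zero]
  simp only [hf, Complex.ofReal_zero, zero_mul, zero_add, setIntegral_const, h4, Complex.real_smul]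
  push_cast
  ring

theorem measurableSet_le_norm (r : ℝ) : MeasurableSet {z : ℂ | r ≤ ‖z‖} :=
  measurableSet_le measurable_const measurable_norm

/-- The Jacobian s equals ζ e^{-iθ}, and ζ ∂̄f = ∂̄(ζf); so the area integral is the polar integral
of ∂̄(ζf) treated by `integral_exterior_dbar`. -/
theorem green_exterior {f : ℂ → ℂ} (hf : ContDiff ℝ 1 f) (hc : HasCompactSupport f) {r : ℝ}
    (hr : 0 ≤ r) :
    ∫ z in {z : ℂ | r ≤ ‖z‖}, dbar f z =
      -(1 / 2) * ∫ θ in Ioo 0 (2 * π), (r * Complex.exp (θ * Complex.I)) *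
        f (r * Complex.exp (θ * Complex.I)) := by
  have hcont := continuous_dbar hf
  have hint : Integrable (dbar f) := hcont.integrable_of_hasCompactSupport (hasCompactSupport_dbar hc)
  have hs := measurableSet_le_norm r
  rw [← integral_indicator hs, integral_polar (hcont.measurable.indicator hs) (hint.indicator hs)]
  set F : ℂ → ℂ := fun ζ => ζ * f ζ with hF
  have hFd : ContDiff ℝ 1 F := contDiff_id.mul hf
  have hFc : HasCompactSupport F := hc.mul_left
  have h2 := integral_exterior_dbar hr (fun ζ _ => hFd.contDiffAt) hFc
  have hdF : ∀ ζ, dbar F ζ = ζ * dbar f ζ := by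
    intro ζ
    rw [hF, dbar_mul (f := fun w => w) differentiableAt_id (hf.differentiable (by simp) ζ),
      dbar_eq_zero (f := fun w => w) differentiableAt_id, zero_mul, zero_add]
  have h3 : ∫ s in Ioi (0 : ℝ), ∫ θ in Ioo 0 (2 * π), (s : ℂ) *
      ({z : ℂ | r ≤ ‖z‖}.indicator (dbar f) (s * Complex.exp (θ * Complex.I))) =
      ∫ s in Ioi (0 : ℝ), (Ici r).indicator (fun s : ℝ => (1 / 2 : ℂ) *
        ∫ θ in Ioo 0 (2 * π), 2 * Complex.exp (-(θ * Complex.I)) *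
          dbar F (s * Complex.exp (θ * Complex.I))) s := by
    refine setIntegral_congr_fun measurableSet_Ioi fun s hs => ?_
    have hn : ∀ θ : ℝ, ‖(s : ℂ) * Complex.exp (θ * Complex.I)‖ = s :=
      norm_circle_point (le_of_lt hs)
    by_cases hrs : r ≤ s
    · rw [indicator_of_mem (show s ∈ Ici r from hrs), ← integral_const_mul]
      refine integral_congr_ae (ae_of_all _ fun θ => ?_)
      simp only
      rw [indicator_of_mem (by simp only [mem_ofPred_eq, hn]; exact hrs), hdF, Complex.exp_neg]
      have := Complex.exp_ne_zero (θ * Complex.I)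
      field_simp
    · rw [indicator_of_notMem (show s ∉ Ici r from hrs)]
      refine setIntegral_eq_zero_of_forall_eq_zero fun θ _ => ?_
      rw [indicator_of_notMem (by simp only [mem_ofPred_eq, hn]; exact hrs), mul_zero]
  rw [h3, integral_indicator measurableSet_Ici, Measure.restrict_restrict measurableSet_Ici,
    integral_const_mul]
  have h4 : (Ici r ∩ Ioi 0 : Set ℝ) =ᵐ[volume] Ioi r := by
    have : (Ici r ∩ Ioi 0 : Set ℝ) =ᵐ[volume] (Ioi r ∩ Ioi 0 : Set ℝ) :=
      Ioi_ae_eq_Ici.symm.inter (ae_eq_refl _)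
    refine this.trans (Filter.EventuallyEq.of_eq ?_)
    exact inter_eq_left.2 (Ioi_subset_Ioi hr)
  rw [setIntegral_congr_set h4, h2]
  ring

/-- The Cauchy transform of a density on a circle. -/
def cauchyMean (h : ℂ → ℂ) (r : ℝ) (z : ℂ) : ℂ :=
  ∫ θ in Ioo 0 (2 * π), h (r * Complex.exp (θ * Complex.I)) /
    (2 * π * (r * Complex.exp (θ * Complex.I) - z))

/-- By Fubini this is the Cauchy–Pompeiu formula at each point of the circle. The factor ½ is
π/(2π). -/
theorem integral_cauchyMean_mul_dbar {h : ℂ → ℂ} (hh : Continuous h) {r : ℝ} (hr : 0 ≤ r)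
    {ψ : ℂ → ℂ} (hψ : ContDiff ℝ 1 ψ) (hc : HasCompactSupport ψ) :
    Integrable (fun z => cauchyMean h r z * dbar ψ z) ∧
    ∫ z, cauchyMean h r z * dbar ψ z = (1 / 2) * ∫ θ in Ioo 0 (2 * π),
      h (r * Complex.exp (θ * Complex.I)) * ψ (r * Complex.exp (θ * Complex.I)) := by
  have hcont := continuous_dbar hψ
  obtain ⟨M, R, -, hM, hR⟩ := exists_norm_bound hcont (hasCompactSupport_dbar hc)
  set ζ : ℝ → ℂ := fun θ => r * Complex.exp (θ * Complex.I) with hζ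
  have hζc : Continuous ζ := by fun_prop
  have hζn : ∀ θ, ‖ζ θ‖ = r := norm_circle_point hr
  obtain ⟨A, hA⟩ : ∃ A, ∀ θ, ‖h (ζ θ)‖ ≤ A := by
    obtain ⟨A, hA⟩ := (isCompact_closedBall (0 : ℂ) r).exists_bound_of_continuousOn hh.continuousOn
    exact ⟨A, fun θ => hA _ (by simp [hζn])⟩
  have hA0 : 0 ≤ A := (norm_nonneg _).trans (hA 0)
  set f : ℂ → ℝ → ℂ := fun z θ => h (ζ θ) / (2 * π) * (dbar ψ z / (ζ θ - z)) with hf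
  have hfm : Measurable f.uncurry := by
    have : Measurable h := hh.measurable
    have : Measurable (dbar ψ) := hcont.measurable
    have : Measurable ζ := hζc.measurable
    unfold Function.uncurry
    fun_prop
  have hfint : Integrable f.uncurry (volume.prod (volume.restrict (Ioo 0 (2 * π)))) := by
    rw [integrable_prod_iff' hfm.aestronglyMeasurable]
    constructor
    · refine ae_of_all _ fun θ => ?_
      exact (integrable_div_sub hcont.measurable hM hR (ζ θ)).1.const_mul (h (ζ θ) / (2 * π))
    · refine Integrable.of_bound (C := A / (2 * π) * (M * ∫ z in Metric.ball (0 : ℂ) (R + r), ‖z‖⁻¹))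
        ?_ (ae_of_all _ fun θ => ?_)
      · exact (hfm.norm.comp measurable_swap).stronglyMeasurable.integral_prod_right'.aestronglyMeasurable
      · rw [Real.norm_of_nonneg (integral_nonneg fun _ => norm_nonneg _)]
        have h1 := (integrable_div_sub hcont.measurable hM hR (ζ θ)).2
        rw [hζn] at h1
        have h2 : ‖h (ζ θ) / (2 * π)‖ ≤ A / (2 * π) := by
          rw [norm_div]
          have : ‖(2 : ℂ) * π‖ = 2 * π := by simp [abs_of_pos Real.pi_pos]
          rw [this]
          gcongr
          exact hA θ
        calc ∫ z, ‖f z θ‖ = ‖h (ζ θ) / (2 * π)‖ * ∫ z, ‖dbar ψ z / (ζ θ - z)‖ := by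
              rw [← integral_const_mul]
              simp only [hf, norm_mul]
          _ ≤ _ := mul_le_mul h2 h1 (integral_nonneg fun _ => norm_nonneg _) (by positivity)
  have heq : ∀ z, cauchyMean h r z * dbar ψ z = ∫ θ in Ioo 0 (2 * π), f z θ := by
    intro z
    rw [cauchyMean, ← integral_mul_const]
    refine integral_congr_ae (ae_of_all _ fun θ => ?_)
    simp only [hf, hζ]
    rw [div_mul_div_comm, div_mul_eq_mul_div]
  simp only [heq]
  refine ⟨hfint.integral_prod_left, ?_⟩
  rw [integral_integral_swap hfint, ← integral_const_mul]
  refine integral_congr_ae (ae_of_all _ fun θ => ?_)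
  simp only [hf]
  rw [integral_const_mul, cauchy_pompeiu hψ hc]
  have h3 : (π : ℂ) ≠ 0 := by exact_mod_cast Real.pi_ne_zero
  field_simp
  rfl

/-! ### One-variable factors of the operator -/

/-- The frozen value outside the circle of radius `r`, plus the Cauchy integral over it. -/
def tau (e : ℂ → ℂ) (z : ℂ) (r : ℝ) : ℂ :=
  ∫ θ, weight r z θ * e (node r z θ) ∂angleMeasure

/-- The contribution of the radius `r` to the Cauchy transform of `-e`. -/
def beta (e : ℂ → ℂ) (z : ℂ) (r : ℝ) : ℂ :=
  ∫ θ, weight r z θ * (radial θ * e (node r z θ)) ∂angleMeasure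

theorem circle_sub_ne_zero {r : ℝ} (hr : 0 ≤ r) {z : ℂ} (hz : r ≠ ‖z‖) (θ : ℝ) :
    (r : ℂ) * Complex.exp (θ * Complex.I) - z ≠ 0 := by
  intro h
  apply hz
  rw [← norm_circle_point hr θ, sub_eq_zero.1 h]

theorem integrableOn_circle_div {h : ℂ → ℂ} (hh : Continuous h) {r : ℝ} (hr : 0 ≤ r) {z : ℂ}
    (hz : r ≠ ‖z‖) :
    IntegrableOn (fun θ : ℝ => h (r * Complex.exp (θ * Complex.I)) /
      (2 * π * (r * Complex.exp (θ * Complex.I) - z))) (Ioo 0 (2 * π)) := by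
  have hc : Continuous fun θ : ℝ => h (r * Complex.exp (θ * Complex.I)) /
      (2 * π * (r * Complex.exp (θ * Complex.I) - z)) := by
    refine Continuous.div (by fun_prop) (by fun_prop) fun θ => ?_
    have h3 : (π : ℂ) ≠ 0 := by exact_mod_cast Real.pi_ne_zero
    exact mul_ne_zero (mul_ne_zero two_ne_zero h3) (circle_sub_ne_zero hr hz θ)
  exact hc.continuousOn.integrableOn_Icc.mono_set Ioo_subset_Icc_self

theorem tau_eq {e : ℂ → ℂ} (he : Continuous e) {r : ℝ} (hr : 0 ≤ r) {z : ℂ} (hz : r ≠ ‖z‖) :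
    tau e z r = (if r ≤ ‖z‖ then e z else 0) + cauchyMean (fun ζ => ζ * e ζ) r z := by
  have heq : EqOn (fun θ => weight r z θ * e (node r z θ))
      (fun θ : ℝ => (r * Complex.exp (θ * Complex.I)) * e (r * Complex.exp (θ * Complex.I)) /
        (2 * π * (r * Complex.exp (θ * Complex.I) - z))) (Ioo 0 (2 * π)) := by
    intro θ hθ
    simp only [weight, node, if_neg hθ.1.ne']
    ring
  have hint := integrableOn_circle_div (h := fun ζ => ζ * e ζ) (by fun_prop) hr hz
  rw [tau, integral_angleMeasure (hint.congr_fun heq.symm measurableSet_Ioo),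
    setIntegral_congr_fun measurableSet_Ioo heq, cauchyMean]
  simp [weight, node]

theorem beta_eq {e : ℂ → ℂ} (he : Continuous e) {r : ℝ} (hr : 0 ≤ r) {z : ℂ} (hz : r ≠ ‖z‖) :
    beta e z r = cauchyMean (fun ζ => 2 * r * e ζ) r z := by
  have heq : EqOn (fun θ => weight r z θ * (radial θ * e (node r z θ)))
      (fun θ : ℝ => (2 * r * e (r * Complex.exp (θ * Complex.I))) /
        (2 * π * (r * Complex.exp (θ * Complex.I) - z))) (Ioo 0 (2 * π)) := by
    intro θ hθ
    simp only [weight, node, radial, if_neg hθ.1.ne', Complex.exp_neg]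
    have := Complex.exp_ne_zero (θ * Complex.I)
    field_simp
  have hint := integrableOn_circle_div (h := fun ζ => 2 * r * e ζ) (by fun_prop) hr hz
  rw [beta, integral_angleMeasure (hint.congr_fun heq.symm measurableSet_Ioo),
    setIntegral_congr_fun measurableSet_Ioo heq, cauchyMean]
  simp [radial]

theorem ae_norm_ne (r : ℝ) : ∀ᵐ z : ℂ, r ≠ ‖z‖ := by
  have h : volume (Metric.sphere (0 : ℂ) r) = 0 := by
    by_cases hr : r = 0
    · subst hr; simp
    · exact Measure.addHaar_sphere_of_ne_zero _ _ hr
  filter_upwards [measure_eq_zero_iff_ae_notMem.1 h] with z hz hz'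
  exact hz (by simp [hz'])

/-- In z, ∂̄β is -e times arc length on |z| = r. The factor r is the polar Jacobian with which the
circles reassemble to an area integral in `integral_pair_prod_same`. -/
theorem integral_beta_mul_dbar {e : ℂ → ℂ} (he : Continuous e) {r : ℝ} (hr : 0 ≤ r)
    {ψ : ℂ → ℂ} (hψ : ContDiff ℝ 1 ψ) (hc : HasCompactSupport ψ) :
    ∫ z, beta e z r * dbar ψ z = ∫ θ in Ioo 0 (2 * π),
      r * (e (r * Complex.exp (θ * Complex.I)) * ψ (r * Complex.exp (θ * Complex.I))) := by
  have h := (integral_cauchyMean_mul_dbar (h := fun ζ => 2 * r * e ζ) (by fun_prop) hr hψ hc).2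
  rw [integral_congr_ae (g := fun z => cauchyMean (fun ζ => 2 * r * e ζ) r z * dbar ψ z), h,
    ← integral_const_mul]
  · refine integral_congr_ae (ae_of_all _ fun θ => ?_)
    simp only
    ring
  · filter_upwards [ae_norm_ne r] with z hz
    rw [beta_eq he hr hz]

/-- The frozen term jumps across |z| = r and the Cauchy integral jumps back. Concretely,
`green_exterior` for eψ and `integral_cauchyMean_mul_dbar` for ζe produce opposite boundary terms.
This is why the chains with frozen coordinates belong to the operator. -/
theorem integral_tau_mul_dbar {e : ℂ → ℂ} (he : ContDiff ℝ 1 e) {r : ℝ} (hr : 0 ≤ r)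
    {ψ : ℂ → ℂ} (hψ : ContDiff ℝ 1 ψ) (hc : HasCompactSupport ψ) :
    ∫ z, tau e z r * dbar ψ z = -∫ z in {z : ℂ | r ≤ ‖z‖}, dbar e z * ψ z := by
  have hec := he.continuous
  have h := integral_cauchyMean_mul_dbar (h := fun ζ => ζ * e ζ) (by fun_prop) hr hψ hc
  have hs := measurableSet_le_norm r
  have i1 : Integrable (fun z => e z * dbar ψ z) :=
    (hec.mul (continuous_dbar hψ)).integrable_of_hasCompactSupport (hasCompactSupport_dbar hc).mul_left
  have i2 : Integrable (fun z => dbar e z * ψ z) :=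
    ((continuous_dbar he).mul hψ.continuous).integrable_of_hasCompactSupport hc.mul_left
  have hg := green_exterior (he.mul hψ) hc.mul_left hr
  have hd : ∀ z, dbar (fun w => e w * ψ w) z = dbar e z * ψ z + e z * dbar ψ z := fun z =>
    dbar_mul (he.differentiable (by simp) z) (hψ.differentiable (by simp) z)
  simp only [hd] at hg
  rw [integral_add i2.integrableOn i1.integrableOn] at hg
  have hcongr : ∫ z, tau e z r * dbar ψ z = ∫ z, ({z : ℂ | r ≤ ‖z‖}.indicator
      (fun z => e z * dbar ψ z) z + cauchyMean (fun ζ => ζ * e ζ) r z * dbar ψ z) := by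
    refine integral_congr_ae ?_
    filter_upwards [ae_norm_ne r] with z hz
    rw [tau_eq hec hr hz, add_mul, ite_mul, zero_mul]
    rfl
  rw [hcongr, integral_add (i1.indicator hs) h.1, h.2, integral_indicator hs]
  have hm : ∫ θ in Ioo 0 (2 * π), (r * Complex.exp (θ * Complex.I)) *
      e (r * Complex.exp (θ * Complex.I)) * ψ (r * Complex.exp (θ * Complex.I)) =
      ∫ θ in Ioo 0 (2 * π), (r * Complex.exp (θ * Complex.I)) *
      (e (r * Complex.exp (θ * Complex.I)) * ψ (r * Complex.exp (θ * Complex.I))) := by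
    simp only [mul_assoc]
  rw [hm]
  linear_combination hg

/-- Polar coordinates about the origin, not about z; the singular radius s = |z| is a null set. -/
theorem integrableOn_beta {h : ℂ → ℂ} (hh : Continuous h) (hc : HasCompactSupport h) (z : ℂ) :
    IntegrableOn (beta h z) (Ioi 0) ∧
      ∫ s in Ioi 0, beta h z s = -(1 / π : ℂ) * ∫ ζ, h ζ / (z - ζ) := by
  obtain ⟨M, R, -, hM, hR⟩ := exists_norm_bound hh hc
  have hint := (integrable_div_sub hh.measurable hM hR z).1
  have hmeas : Measurable fun ζ => h ζ / (z - ζ) := by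
    have := hh.measurable
    fun_prop
  have heq : ∀ᵐ s : ℝ ∂(volume.restrict (Ioi (0 : ℝ))), -(1 / π : ℂ) * ∫ θ in Ioo 0 (2 * π),
      (s : ℂ) * (h (s * Complex.exp (θ * Complex.I)) / (z - s * Complex.exp (θ * Complex.I))) =
        beta h z s := by
    filter_upwards [ae_restrict_mem measurableSet_Ioi,
      ae_restrict_of_ae (Measure.ae_ne volume ‖z‖)] with s hs hsz
    rw [beta_eq hh (le_of_lt hs) hsz, cauchyMean, ← integral_const_mul]
    refine integral_congr_ae (ae_of_all _ fun θ => ?_)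
    have h1 := circle_sub_ne_zero (le_of_lt hs) hsz θ
    have h2 : z - s * Complex.exp (θ * Complex.I) ≠ 0 := by
      rw [← neg_sub]; exact neg_ne_zero.2 h1
    have h3 : (π : ℂ) ≠ 0 := by exact_mod_cast Real.pi_ne_zero
    simp only
    field_simp
    ring
  have hI := (integrable_polar hmeas hint).integral_prod_left
  simp only at hI
  have hI2 : Integrable (fun s : ℝ => ∫ θ in Ioo 0 (2 * π), (s : ℂ) *
      (h (s * Complex.exp (θ * Complex.I)) / (z - s * Complex.exp (θ * Complex.I))))
      (volume.restrict (Ioi 0)) := by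
    refine hI.congr (ae_of_all _ fun s => ?_)
    exact integral_circle_shift (G := fun ζ => (s : ℂ) * (h ζ / (z - ζ))) s
  constructor
  · exact (hI2.const_mul _).congr heq
  · rw [integral_polar hmeas hint, ← integral_const_mul]
    exact integral_congr_ae (heq.mono fun s hs => hs.symm)

theorem contDiffAt_circle_kernel {e : ℂ → ℂ} (he : ContDiff ℝ 1 e) {z ζ : ℂ} (h : ζ ≠ z) :
    ContDiffAt ℝ 1 (fun ζ => ζ / (ζ - z) * e ζ) ζ := by
  have hk : ContDiffAt ℂ 1 (fun ζ => ζ / (ζ - z)) ζ :=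
    ContDiffAt.div contDiffAt_id (contDiffAt_id.sub contDiffAt_const) (sub_ne_zero.2 h)
  exact (hk.restrict_scalars ℝ).mul he.contDiffAt

theorem dbar_circle_kernel {e : ℂ → ℂ} (he : ContDiff ℝ 1 e) {z ζ : ℂ} (h : ζ ≠ z) :
    dbar (fun ζ => ζ / (ζ - z) * e ζ) ζ = ζ / (ζ - z) * dbar e ζ := by
  have hd : DifferentiableAt ℂ (fun ζ => ζ / (ζ - z)) ζ :=
    differentiableAt_id.div (differentiableAt_id.sub (differentiableAt_const _)) (sub_ne_zero.2 h)
  rw [dbar_mul (hd.restrictScalars ℝ) (he.differentiable (by simp) ζ), dbar_eq_zero hd, zero_mul,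
    zero_add]

theorem beta_dbar_eq {e : ℂ → ℂ} (he : ContDiff ℝ 1 e) {z : ℂ} {s : ℝ} (hs : 0 ≤ s)
    (hsz : s ≠ ‖z‖) :
    beta (dbar e) z s = (1 / (2 * π)) * ∫ θ in Ioo 0 (2 * π), 2 * Complex.exp (-(θ * Complex.I)) *
      dbar (fun ζ => ζ / (ζ - z) * e ζ) (s * Complex.exp (θ * Complex.I)) := by
  rw [beta_eq (continuous_dbar he) hs hsz, cauchyMean, ← integral_const_mul]
  refine integral_congr_ae (ae_of_all _ fun θ => ?_)
  have h1 := circle_sub_ne_zero hs hsz θ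
  have h3 : (π : ℂ) ≠ 0 := by exact_mod_cast Real.pi_ne_zero
  have := Complex.exp_ne_zero (θ * Complex.I)
  simp only
  rw [dbar_circle_kernel he (sub_ne_zero.1 h1), Complex.exp_neg]
  field_simp

/-- Both parts of τ jump at ρ = |z|, their sum does not. If ρ < |z|, apply the annulus formula to ζ
e(ζ)/(ζ - z) on |ζ| ≤ ρ, where it has no pole and vanishes at 0. If ρ > |z|, apply it to |ζ| ≥ ρ and
subtract from the integral of β over all radii, which is -e(z) by Cauchy–Pompeiu. -/
theorem tau_eq_add_integral_beta {e : ℂ → ℂ} (he : ContDiff ℝ 1 e) (hc : HasCompactSupport e)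
    {z : ℂ} {ρ : ℝ} (hρ : 0 < ρ) (hρz : ρ ≠ ‖z‖) :
    tau e z ρ = e z + ∫ s in Ioo 0 ρ, beta (dbar e) z s := by
  have hb := integrableOn_beta (continuous_dbar he) (hasCompactSupport_dbar hc) z
  have hpi : (π : ℂ) ≠ 0 := by exact_mod_cast Real.pi_ne_zero
  have hmean : cauchyMean (fun ζ => ζ * e ζ) ρ z = (1 / (2 * π)) * ∫ θ in Ioo 0 (2 * π),
      (fun ζ => ζ / (ζ - z) * e ζ) (ρ * Complex.exp (θ * Complex.I)) := by
    rw [cauchyMean, ← integral_const_mul]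
    refine integral_congr_ae (ae_of_all _ fun θ => ?_)
    have h1 := circle_sub_ne_zero hρ.le hρz θ
    simp only
    field_simp
  rw [tau_eq he.continuous hρ.le hρz, hmean]
  rcases lt_or_gt_of_ne hρz with h | h
  · rw [if_pos h.le]
    congr 1
    have hk := integral_circle_sub le_rfl hρ.le (fun ζ _ h2 =>
      contDiffAt_circle_kernel he (z := z) (ζ := ζ) (by rintro rfl; linarith))
    have h0 : ∫ θ in (0 : ℝ)..2 * π, ((0 : ℝ) * Complex.exp (θ * Complex.I) /
        ((0 : ℝ) * Complex.exp (θ * Complex.I) - z) * e ((0 : ℝ) * Complex.exp (θ * Complex.I))) = 0 := by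
      simp
    rw [h0, sub_zero] at hk
    simp only [intervalIntegral_eq_Ioo] at hk
    rw [hk, intervalIntegral.integral_of_le hρ.le, integral_Ioc_eq_integral_Ioo,
      ← integral_const_mul]
    refine setIntegral_congr_fun measurableSet_Ioo fun s hs => ?_
    exact (beta_dbar_eq he hs.1.le (hs.2.trans h).ne).symm
  · rw [if_neg (not_le.2 h), zero_add]
    have hk := integral_exterior_dbar hρ.le (fun ζ h1 =>
      contDiffAt_circle_kernel he (z := z) (ζ := ζ) (by rintro rfl; linarith)) hc.mul_left
    have h1 : ∫ s in Ioi ρ, beta (dbar e) z s = (1 / (2 * π)) * ∫ s in Ioi ρ,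
        ∫ θ in Ioo 0 (2 * π), 2 * Complex.exp (-(θ * Complex.I)) *
          dbar (fun ζ => ζ / (ζ - z) * e ζ) (s * Complex.exp (θ * Complex.I)) := by
      rw [← integral_const_mul]
      refine setIntegral_congr_fun measurableSet_Ioi fun s hs => ?_
      exact beta_dbar_eq he (hρ.le.trans (le_of_lt hs)) (h.trans hs).ne'
    rw [hk] at h1
    have h2 : ∫ s in Ioi 0, beta (dbar e) z s = (∫ s in Ioo 0 ρ, beta (dbar e) z s) +
        ∫ s in Ioi ρ, beta (dbar e) z s := by
      rw [← integral_Ioc_eq_integral_Ioo, ← setIntegral_union (by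
        rw [disjoint_left]; exact fun x h1 h2 => not_lt.2 h1.2 h2) measurableSet_Ioi
        (hb.1.mono_set Ioc_subset_Ioi_self) (hb.1.mono_set (Ioi_subset_Ioi hρ.le)),
        Ioc_union_Ioi_eq_Ioi hρ.le]
    rw [hb.2, cauchy_pompeiu he hc] at h2
    have h3 : -(1 / (π : ℂ)) * (π * e z) = -e z := by field_simp
    rw [h3] at h2
    linear_combination h1 + h2

/-! ### Products of primitives -/

/-- The product rule for primitives of merely integrable functions, obtained by cutting the square
(0, ρ)² along its diagonal. Here β need not be bounded near s = |z|. -/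
theorem primitive_mul {b b' : ℝ → ℂ} {ρ : ℝ} (hb : IntegrableOn b (Ioo 0 ρ))
    (hb' : IntegrableOn b' (Ioo 0 ρ)) (c c' : ℂ) :
    IntegrableOn (fun r => b r * (c' + ∫ s in Ioo 0 r, b' s) + (c + ∫ s in Ioo 0 r, b s) * b' r)
      (Ioo 0 ρ) ∧
    (c + ∫ s in Ioo 0 ρ, b s) * (c' + ∫ s in Ioo 0 ρ, b' s) = c * c' + ∫ r in Ioo 0 ρ,
      (b r * (c' + ∫ s in Ioo 0 r, b' s) + (c + ∫ s in Ioo 0 r, b s) * b' r) := by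
  set lam := volume.restrict (Ioo (0 : ℝ) ρ) with hlam
  have hf : Integrable (fun p : ℝ × ℝ => b p.1 * b' p.2) (lam.prod lam) := hb.mul_prod hb'
  set S : Set (ℝ × ℝ) := {p | p.2 < p.1} with hS
  have hSm : MeasurableSet S := measurableSet_lt measurable_snd measurable_fst
  have prim : ∀ (h : ℝ → ℂ), ∀ r ∈ Ioo 0 ρ, ∫ s, (Iio r).indicator h s ∂lam =
      ∫ s in Ioo 0 r, h s := by
    intro h r hr
    rw [integral_indicator measurableSet_Iio, hlam, Measure.restrict_restrict measurableSet_Iio]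
    congr 2
    ext s
    simp only [mem_inter_iff, mem_Iio, mem_Ioo]
    constructor
    · exact fun h => ⟨h.2.1, h.1⟩
    · exact fun h => ⟨h.2, h.1, h.2.trans hr.2⟩
  have e1 : ∀ᵐ r ∂lam, ∫ s, S.indicator (fun p => b p.1 * b' p.2) (r, s) ∂lam =
      b r * ∫ s in Ioo 0 r, b' s := by
    filter_upwards [ae_restrict_mem measurableSet_Ioo] with r hr
    rw [← prim b' r hr, ← integral_const_mul]
    refine integral_congr_ae (ae_of_all _ fun s => ?_)
    by_cases h : s < r
    · simp [hS, indicator, h]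
    · simp [hS, indicator, h]
  have e2 : ∀ᵐ r ∂lam, ∫ s, Sᶜ.indicator (fun p => b p.1 * b' p.2) (s, r) ∂lam =
      (∫ s in Ioo 0 r, b s) * b' r := by
    filter_upwards [ae_restrict_mem measurableSet_Ioo] with r hr
    rw [← prim b r hr, ← integral_mul_const]
    refine integral_congr_ae ?_
    filter_upwards [ae_restrict_of_ae (Measure.ae_ne volume r)] with s hs
    rcases lt_or_gt_of_ne hs with h | h
    · simp [hS, indicator, h, h.le]
    · simp [hS, indicator, h, not_lt.2 h.le]
  have i1 := (hf.indicator hSm).integral_prod_left.congr e1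
  have i2 := (hf.indicator hSm.compl).integral_prod_right.congr e2
  have hI : Integrable (fun r => b r * (c' + ∫ s in Ioo 0 r, b' s) +
      (c + ∫ s in Ioo 0 r, b s) * b' r) lam := by
    have := ((hb.mul_const c').add i1).add ((hb'.const_mul c).add i2)
    refine this.congr (ae_of_all _ fun r => ?_)
    simp only [Pi.add_apply]
    ring
  refine ⟨hI, ?_⟩
  have j1 : ∫ r in Ioo 0 ρ, b r * ∫ s in Ioo 0 r, b' s =
      ∫ p, S.indicator (fun p => b p.1 * b' p.2) p ∂(lam.prod lam) := by
    rw [integral_prod _ (hf.indicator hSm)]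
    exact (integral_congr_ae e1).symm
  have j2 : ∫ r in Ioo 0 ρ, (∫ s in Ioo 0 r, b s) * b' r =
      ∫ p, Sᶜ.indicator (fun p => b p.1 * b' p.2) p ∂(lam.prod lam) := by
    rw [integral_prod_symm _ (hf.indicator hSm.compl)]
    exact (integral_congr_ae e2).symm
  have j3 : (∫ p, S.indicator (fun p => b p.1 * b' p.2) p ∂(lam.prod lam)) +
      ∫ p, Sᶜ.indicator (fun p => b p.1 * b' p.2) p ∂(lam.prod lam) =
      (∫ s in Ioo 0 ρ, b s) * ∫ s in Ioo 0 ρ, b' s := by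
    rw [integral_indicator hSm, integral_indicator hSm.compl, integral_add_compl hSm hf]
    exact integral_prod_mul b b'
  have j4 : ∫ r in Ioo 0 ρ, (b r * (c' + ∫ s in Ioo 0 r, b' s) +
      (c + ∫ s in Ioo 0 r, b s) * b' r) = ((∫ r in Ioo 0 ρ, b r) * c' +
        ∫ r in Ioo 0 ρ, b r * ∫ s in Ioo 0 r, b' s) + (c * (∫ r in Ioo 0 ρ, b' r) +
        ∫ r in Ioo 0 ρ, (∫ s in Ioo 0 r, b s) * b' r) := by
    rw [← integral_mul_const, ← integral_const_mul, ← integral_add (hb.mul_const c') i1,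
      ← integral_add (hb'.const_mul c) i2]
    refine Eq.trans ?_ (integral_add ((hb.mul_const c').add i1) ((hb'.const_mul c).add i2))
    refine integral_congr_ae (ae_of_all _ fun r => ?_)
    simp only
    ring
  rw [j4, j1, j2]
  linear_combination -j3

/-- Induction with `primitive_mul`. The formula is claimed at all radii up to ρ because the
induction step rewrites the integrand with it at interior radii. -/
theorem primitive_prod {ι : Type*} [DecidableEq ι] {b : ι → ℝ → ℂ} (c : ι → ℂ) {ρ : ℝ}
    (s : Finset ι) (hb : ∀ i ∈ s, IntegrableOn (b i) (Ioo 0 ρ)) :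
    IntegrableOn (fun r => ∑ k ∈ s, b k r * ∏ j ∈ s.erase k, (c j + ∫ t in Ioo 0 r, b j t))
      (Ioo 0 ρ) ∧
    ∀ r ≤ ρ, ∏ j ∈ s, (c j + ∫ t in Ioo 0 r, b j t) = ∏ j ∈ s, c j +
      ∫ r in Ioo 0 r, ∑ k ∈ s, b k r * ∏ j ∈ s.erase k, (c j + ∫ t in Ioo 0 r, b j t) := by
  induction s using Finset.induction_on with
  | empty => simp
  | insert i s hi ih =>
    obtain ⟨ih1, ih2⟩ := ih fun j hj => hb j (Finset.mem_insert_of_mem hj)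
    have hbi := hb i (Finset.mem_insert_self i s)
    set B : ℝ → ℂ := fun r => ∑ k ∈ s, b k r * ∏ j ∈ s.erase k, (c j + ∫ t in Ioo 0 r, b j t)
    have hB : EqOn (fun r => b i r * (∏ j ∈ s, c j + ∫ t in Ioo 0 r, B t) +
        (c i + ∫ t in Ioo 0 r, b i t) * B r)
        (fun r => ∑ k ∈ insert i s, b k r *
          ∏ j ∈ (insert i s).erase k, (c j + ∫ t in Ioo 0 r, b j t)) (Ioo 0 ρ) := by
      intro r hr
      simp only
      rw [Finset.sum_insert hi, Finset.erase_insert hi, ih2 r hr.2.le]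
      congr 1
      rw [Finset.mul_sum]
      refine Finset.sum_congr rfl fun k hk => ?_
      have hne : i ≠ k := fun h => hi (h ▸ hk)
      rw [Finset.erase_insert_of_ne hne, Finset.prod_insert (fun h => hi (Finset.mem_of_mem_erase h))]
      ring
    refine ⟨(primitive_mul hbi ih1 _ _).1.congr_fun hB measurableSet_Ioo, fun r hr => ?_⟩
    rw [Finset.prod_insert hi, Finset.prod_insert hi, ih2 r hr]
    have hsub : Ioo 0 r ⊆ Ioo 0 ρ := Ioo_subset_Ioo_right hr
    rw [(primitive_mul (hbi.mono_set hsub) (ih1.mono_set hsub) _ _).2]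
    congr 1
    exact setIntegral_congr_fun measurableSet_Ioo (hB.mono hsub)

/-- The `j`-th factor of the `k`-th component of the operator on a product function. -/
def factor {n : ℕ} (k j : Fin n) (e : ℂ → ℂ) (z : ℂ) (r : ℝ) : ℂ :=
  if j = k then beta e z r else tau e z r

/-- The product rule in r. The k-th term is the angular integral of the k-th component of the
operator applied to ∂̄_k of the product function, cut off at radius ρ. -/
theorem prod_tau_eq {n : ℕ} {e : Fin n → ℂ → ℂ} (he : ∀ j, ContDiff ℝ 1 (e j))
    (hc : ∀ j, HasCompactSupport (e j)) (z : Fin n → ℂ) {ρ : ℝ} (hρ : 0 < ρ)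
    (hρz : ∀ j, ρ ≠ ‖z j‖) :
    ∏ j, tau (e j) (z j) ρ = ∏ j, e j (z j) + ∫ r in Ioo 0 ρ,
      ∑ k, ∏ j, factor k j (Function.update e k (dbar (e k)) j) (z j) r := by
  have hb : ∀ j, IntegrableOn (beta (dbar (e j)) (z j)) (Ioo 0 ρ) := fun j =>
    (integrableOn_beta (continuous_dbar (he j)) (hasCompactSupport_dbar (hc j)) (z j)).1.mono_set
      Ioo_subset_Ioi_self
  have h := (primitive_prod (fun j => e j (z j)) Finset.univ fun j _ => hb j).2 ρ le_rfl
  rw [Finset.prod_congr rfl fun j _ => tau_eq_add_integral_beta (he j) (hc j) hρ (hρz j), h]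
  congr 1
  refine setIntegral_congr_ae measurableSet_Ioo ?_
  have hae : ∀ᵐ r : ℝ, ∀ j, r ≠ ‖z j‖ := ae_all_iff.2 fun j => Measure.ae_ne volume _
  filter_upwards [hae] with r hrz hr
  refine Finset.sum_congr rfl fun k _ => ?_
  rw [← Finset.mul_prod_erase _ _ (Finset.mem_univ k)]
  congr 1
  · simp [factor]
  · refine Finset.prod_congr rfl fun j hj => ?_
    have hjk := Finset.ne_of_mem_erase hj
    rw [factor, if_neg hjk, Function.update_of_ne hjk,
      tau_eq_add_integral_beta (he j) (hc j) hr.1 (hrz j)]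

/-- At fixed r the kernel, the radial factor and the product function all split over coordinates, as
does the angle measure. The radial factor turns τ into β in position k. -/
theorem integral_kernel_radial_prod {n : ℕ} (z : Fin n → ℂ) (r : ℝ) (k : Fin n)
    (e : Fin n → ℂ → ℂ) :
    ∫ θ, kernel z (r, θ) * (radial (θ k) * ∏ j, e j (chainPoint z (r, θ) j))
      ∂(Measure.pi fun _ : Fin n => angleMeasure) = ∏ j, factor k j (e j) (z j) r := by
  have h := integral_fintype_prod_eq_prod (μ := fun _ : Fin n => angleMeasure)
    (fun j θ => weight r (z j) θ * ((if j = k then radial θ else 1) * e j (node r (z j) θ)))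
  have h2 : ∀ θ : Fin n → ℝ, kernel z (r, θ) * (radial (θ k) *
      ∏ j, e j (chainPoint z (r, θ) j)) = ∏ j, (weight r (z j) (θ j) *
        ((if j = k then radial (θ j) else 1) * e j (node r (z j) (θ j)))) := by
    intro θ
    rw [Finset.prod_mul_distrib, Finset.prod_mul_distrib, Finset.prod_ite_eq' Finset.univ k]
    simp [kernel, chainPoint]
  simp only [h2]
  rw [h]
  refine Finset.prod_congr rfl fun j _ => ?_
  unfold factor tau beta
  split_ifs <;> simp

theorem integral_kernel_prod {n : ℕ} (z : Fin n → ℂ) (r : ℝ) (e : Fin n → ℂ → ℂ) :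
    ∫ θ, kernel z (r, θ) * ∏ j, e j (chainPoint z (r, θ) j)
      ∂(Measure.pi fun _ : Fin n => angleMeasure) = ∏ j, tau (e j) (z j) r := by
  have h := integral_fintype_prod_eq_prod (μ := fun _ : Fin n => angleMeasure)
    (fun j θ => weight r (z j) θ * e j (node r (z j) θ))
  simp only [kernel, chainPoint, ← Finset.prod_mul_distrib]
  exact h

theorem measurable_prod_eval {n : ℕ} {e : Fin n → ℂ → ℂ} (he : ∀ j, Measurable (e j)) :
    Measurable fun ζ : Fin n → ℂ => ∏ j, e j (ζ j) :=
  Finset.measurable_fun_prod _ fun j _ => (he j).comp (measurable_pi_apply j)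

theorem norm_prod_eval_le {n : ℕ} {e : Fin n → ℂ → ℂ} {M : Fin n → ℝ}
    (hM : ∀ j z, ‖e j z‖ ≤ M j) (ζ : Fin n → ℂ) : ‖∏ j, e j (ζ j)‖ ≤ ∏ j, M j := by
  rw [norm_prod]
  exact Finset.prod_le_prod (fun _ _ => norm_nonneg _) fun j _ => hM j _

theorem integrable_kernel_radial {n : ℕ} {z : Fin n → ℂ} (hz : z ∈ polydisc n) (k : Fin n) :
    Integrable (fun p => kernel z p * radial (p.2 k)) (chainMeasure n) := by
  refine (integrable_kernel hz).mul_bdd (c := 2) ?_ (ae_of_all _ fun p => norm_radial_le _)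
  exact (measurable_radial.comp
    ((measurable_pi_apply k).comp measurable_snd)).aestronglyMeasurable

/-- Integrability of the single factors would not suffice for their product when several |z_j|
coincide; the joint kernel bound does. -/
theorem integrableOn_prod_factor {n : ℕ} {z : Fin n → ℂ} (hz : z ∈ polydisc n) (k : Fin n)
    {e : Fin n → ℂ → ℂ} (he : ∀ j, Measurable (e j)) {M : Fin n → ℝ} (hM : ∀ j z, ‖e j z‖ ≤ M j) :
    IntegrableOn (fun r => ∏ j, factor k j (e j) (z j) r) (Ioo 0 1) := by
  have h : Integrable (fun p => kernel z p * radial (p.2 k) * ∏ j, e j (chainPoint z p j))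
      (chainMeasure n) := by
    refine (integrable_kernel_radial hz k).mul_bdd ?_
      (ae_of_all _ fun p => norm_prod_eval_le hM (chainPoint z p))
    exact ((measurable_prod_eval he).comp
      (measurable_chainPoint measurable_const measurable_id)).aestronglyMeasurable
  refine (Integrable.integral_prod_left h).congr (ae_of_all _ fun r => ?_)
  simp only [mul_assoc]
  exact integral_kernel_radial_prod z r k e

theorem integrableOn_prod_tau {n : ℕ} {z : Fin n → ℂ} (hz : z ∈ polydisc n)
    {e : Fin n → ℂ → ℂ} (he : ∀ j, Measurable (e j)) {M : Fin n → ℝ} (hM : ∀ j z, ‖e j z‖ ≤ M j) :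
    IntegrableOn (fun r => ∏ j, tau (e j) (z j) r) (Ioo 0 1) := by
  have h : Integrable (fun p => kernel z p * ∏ j, e j (chainPoint z p j)) (chainMeasure n) := by
    refine (integrable_kernel hz).mul_bdd ?_
      (ae_of_all _ fun p => norm_prod_eval_le hM (chainPoint z p))
    exact ((measurable_prod_eval he).comp
      (measurable_chainPoint measurable_const measurable_id)).aestronglyMeasurable
  refine (Integrable.integral_prod_left h).congr (ae_of_all _ fun r => ?_)
  exact integral_kernel_prod z r e

theorem measurable_tau {e : ℂ → ℂ} (he : Measurable e) (z : ℂ) : Measurable (tau e z) := by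
  have h : Measurable fun p : ℝ × ℝ => weight p.1 z p.2 * e (node p.1 z p.2) :=
    (measurable_weight measurable_fst measurable_const measurable_snd).mul
      (he.comp (measurable_node measurable_fst measurable_const measurable_snd))
  exact h.stronglyMeasurable.integral_prod_right'.measurable

/-! ### Pairing with a test function in one variable -/

/-- The point with `l`-th coordinate `a` and remaining coordinates `z`. -/
def insertAt {m : ℕ} (l : Fin (m + 1)) (a : ℂ) (z : Fin m → ℂ) : Fin (m + 1) → ℂ :=
  l.insertNth (α := fun _ => ℂ) a z

@[simp] theorem insertAt_same {m : ℕ} (l : Fin (m + 1)) (a : ℂ) (z : Fin m → ℂ) :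
    insertAt l a z l = a := Fin.insertNth_apply_same ..

@[simp] theorem insertAt_succAbove {m : ℕ} (l : Fin (m + 1)) (a : ℂ) (z : Fin m → ℂ)
    (j : Fin m) : insertAt l a z (l.succAbove j) = z j := Fin.insertNth_apply_succAbove ..

theorem insertAt_mem {m : ℕ} (l : Fin (m + 1)) {a : ℂ} (ha : ‖a‖ < 1) {z : Fin m → ℂ}
    (hz : z ∈ polydisc m) : insertAt l a z ∈ polydisc (m + 1) := by
  refine (Fin.forall_iff_succAbove l).2 ⟨?_, fun j => ?_⟩
  · simpa using ha
  · simpa using hz j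

theorem measurable_insertAt {m : ℕ} (l : Fin (m + 1)) {X : Type*} [MeasurableSpace X]
    {a : X → ℂ} {z : X → Fin m → ℂ} (ha : Measurable a) (hz : Measurable z) :
    Measurable fun x => insertAt l (a x) (z x) := by
  refine measurable_pi_lambda _ ((Fin.forall_iff_succAbove l).2 ⟨?_, fun j => ?_⟩)
  · simpa using ha
  · simp only [insertAt_succAbove]
    exact (measurable_pi_apply j).comp hz

/-- The product measure pairing a variable in the unit disc with the parameters of the chains. -/
def pairMeasure (n : ℕ) : Measure ((ℂ × ℝ) × (Fin n → ℝ)) :=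
  ((volume.restrict (Metric.ball (0 : ℂ) 1)).prod (volume.restrict (Ioo (0 : ℝ) 1))).prod
    (Measure.pi fun _ => angleMeasure)

/-- The kernel of the pairing of the `k`-th component of the operator with `∂ψ/∂z̄`. -/
def pairKernel {m : ℕ} (ψ : ℂ → ℂ) (l : Fin (m + 1)) (z : Fin m → ℂ) (k : Fin (m + 1))
    (q : (ℂ × ℝ) × (Fin (m + 1) → ℝ)) : ℂ :=
  dbar ψ q.1.1 * (kernel (insertAt l q.1.1 z) (q.1.2, q.2) * radial (q.2 k))

/-- The point at which the form is evaluated. -/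
def pairPoint {m : ℕ} (l : Fin (m + 1)) (z : Fin m → ℂ) (q : (ℂ × ℝ) × (Fin (m + 1) → ℝ)) :
    Fin (m + 1) → ℂ :=
  chainPoint (insertAt l q.1.1 z) (q.1.2, q.2)

theorem measurable_pairPoint {m : ℕ} (l : Fin (m + 1)) (z : Fin m → ℂ) :
    Measurable (pairPoint l z) :=
  measurable_chainPoint (measurable_insertAt l (by fun_prop) measurable_const) (by fun_prop)

/-- The kernel bound is uniform in z, so integrating the l-th coordinate over the disc costs only
its finite area. -/
theorem integrable_pairKernel_assoc {m : ℕ} {ψ : ℂ → ℂ} (hψ : ContDiff ℝ 1 ψ)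
    (hc : HasCompactSupport ψ) (l : Fin (m + 1)) {z : Fin m → ℂ} (hz : z ∈ polydisc m)
    (k : Fin (m + 1)) :
    Integrable (fun q : ℂ × (ℝ × (Fin (m + 1) → ℝ)) =>
      dbar ψ q.1 * (kernel (insertAt l q.1 z) q.2 * radial (q.2.2 k)))
      ((volume.restrict (Metric.ball (0 : ℂ) 1)).prod (chainMeasure (m + 1))) := by
  obtain ⟨C, hC0, hC⟩ := exists_kernel_bound (m + 1) (le_refl (0 : ℝ)) one_pos
  simp only [neg_zero, Real.rpow_zero, one_mul] at hC
  have hcont := continuous_dbar hψ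
  obtain ⟨M, R, -, hM, -⟩ := exists_norm_bound hcont (hasCompactSupport_dbar hc)
  have hM0 : 0 ≤ M := (norm_nonneg _).trans (hM 0)
  have hmeas : Measurable (fun q : ℂ × (ℝ × (Fin (m + 1) → ℝ)) =>
      dbar ψ q.1 * (kernel (insertAt l q.1 z) q.2 * radial (q.2.2 k))) := by
    refine (hcont.measurable.comp measurable_fst).mul (Measurable.mul ?_ ?_)
    · exact measurable_kernel (measurable_insertAt l measurable_fst measurable_const) measurable_snd
    · exact measurable_radial.comp ((measurable_pi_apply k).comp (by fun_prop))
  have : IsFiniteMeasure (volume.restrict (Metric.ball (0 : ℂ) 1)) :=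
    ⟨by simp⟩
  rw [integrable_prod_iff hmeas.aestronglyMeasurable]
  constructor
  · filter_upwards [ae_restrict_mem measurableSet_ball] with a ha
    exact (integrable_kernel_radial (insertAt_mem l (mem_ball_zero_iff.1 ha) hz) k).const_mul _
  · refine Integrable.of_bound (C := M * (2 * C)) ?_ ?_
    · exact hmeas.norm.stronglyMeasurable.integral_prod_right'.aestronglyMeasurable
    · filter_upwards [ae_restrict_mem measurableSet_ball] with a ha
      have hmem := insertAt_mem l (mem_ball_zero_iff.1 ha) hz
      have hk := hC _ 0 hmem (by simp)
      rw [Real.norm_of_nonneg (integral_nonneg fun _ => norm_nonneg _)]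
      calc _ ≤ ∫ p, M * (2 * ‖kernel (insertAt l a z) p‖) ∂(chainMeasure (m + 1)) := by
            refine integral_mono_of_nonneg (ae_of_all _ fun _ => norm_nonneg _)
              ((hk.1.const_mul 2).const_mul M) (ae_of_all _ fun p => ?_)
            simp only [norm_mul]
            rw [mul_comm 2]
            gcongr
            · exact hM a
            · exact norm_radial_le _
        _ = M * (2 * ∫ p, ‖kernel (insertAt l a z) p‖ ∂(chainMeasure (m + 1))) := by
            rw [integral_const_mul, integral_const_mul]
        _ ≤ _ := by gcongr; exact hk.2

theorem measurePreserving_pairAssoc (n : ℕ) :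
    MeasurePreserving (MeasurableEquiv.prodAssoc : (ℂ × ℝ) × (Fin n → ℝ) ≃ᵐ ℂ × ℝ × (Fin n → ℝ))
      (pairMeasure n)
      ((volume.restrict (Metric.ball (0 : ℂ) 1)).prod (chainMeasure n)) :=
  measurePreserving_prodAssoc _ _ _

theorem integrable_pairKernel {m : ℕ} {ψ : ℂ → ℂ} (hψ : ContDiff ℝ 1 ψ)
    (hc : HasCompactSupport ψ) (l : Fin (m + 1)) {z : Fin m → ℂ} (hz : z ∈ polydisc m)
    (k : Fin (m + 1)) : Integrable (pairKernel ψ l z k) (pairMeasure (m + 1)) :=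
  (measurePreserving_pairAssoc (m + 1)).integrable_comp_of_integrable
    (integrable_pairKernel_assoc hψ hc l hz k)

theorem integrable_pairKernel_mul {m : ℕ} {ψ : ℂ → ℂ} (hψ : ContDiff ℝ 1 ψ)
    (hc : HasCompactSupport ψ) (l : Fin (m + 1)) {z : Fin m → ℂ} (hz : z ∈ polydisc m)
    (k : Fin (m + 1)) {F : (Fin (m + 1) → ℂ) → ℂ} (hF : Measurable F) {M : ℝ}
    (hM : ∀ ζ, ‖F ζ‖ ≤ M) :
    Integrable (fun q => pairKernel ψ l z k q * F (pairPoint l z q)) (pairMeasure (m + 1)) :=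
  (integrable_pairKernel hψ hc l hz k).mul_bdd
    (hF.comp (measurable_pairPoint l z)).aestronglyMeasurable (ae_of_all _ fun _ => hM _)

theorem integral_ball_dbar_mul {ψ : ℂ → ℂ} (hs : tsupport ψ ⊆ Metric.ball 0 1) (F : ℂ → ℂ) :
    ∫ a in Metric.ball (0 : ℂ) 1, dbar ψ a * F a = ∫ a, F a * dbar ψ a := by
  rw [setIntegral_eq_integral_of_forall_compl_eq_zero]
  · simp only [mul_comm]
  · intro a ha
    rw [dbar_eq_zero_of_notMem fun h => ha (hs h), zero_mul]

/-- After the angles are integrated, only the l-th factor depends on a, and the a-integral is its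
distributional ∂̄. -/
theorem integral_pair_prod {m : ℕ} {ψ : ℂ → ℂ} (hψ : ContDiff ℝ 1 ψ)
    (hc : HasCompactSupport ψ) (hs : tsupport ψ ⊆ Metric.ball 0 1)
    (l : Fin (m + 1)) {z : Fin m → ℂ} (hz : z ∈ polydisc m)
    (k : Fin (m + 1)) {e : Fin (m + 1) → ℂ → ℂ} (he : ∀ j, Measurable (e j))
    {M : Fin (m + 1) → ℝ} (hM : ∀ j z, ‖e j z‖ ≤ M j) :
    ∫ q, pairKernel ψ l z k q * ∏ j, e j (pairPoint l z q j) ∂(pairMeasure (m + 1)) =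
      ∫ r in Ioo (0 : ℝ) 1, (∏ j, factor k (l.succAbove j) (e (l.succAbove j)) (z j) r) *
        ∫ a, factor k l (e l) a r * dbar ψ a := by
  have hint := integrable_pairKernel_mul hψ hc l hz k (measurable_prod_eval he)
    (norm_prod_eval_le hM)
  unfold pairMeasure at hint ⊢
  have hinner : ∀ x : ℂ × ℝ, ∫ θ, pairKernel ψ l z k (x, θ) * ∏ j, e j (pairPoint l z (x, θ) j)
      ∂(Measure.pi fun _ : Fin (m + 1) => angleMeasure) =
      dbar ψ x.1 * factor k l (e l) x.1 x.2 *
        ∏ j, factor k (l.succAbove j) (e (l.succAbove j)) (z j) x.2 := by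
    intro x
    have h := integral_kernel_radial_prod (insertAt l x.1 z) x.2 k e
    rw [Fin.prod_univ_succAbove _ l] at h
    simp only [insertAt_same, insertAt_succAbove] at h
    rw [mul_assoc, ← h, ← integral_const_mul]
    refine integral_congr_ae (ae_of_all _ fun θ => ?_)
    simp only [pairKernel, pairPoint]
    ring
  have hint2 := hint.integral_prod_left
  simp only [hinner] at hint2
  rw [integral_prod _ hint]
  simp only [hinner]
  rw [integral_prod_symm _ hint2]
  refine integral_congr_ae (ae_of_all _ fun r => ?_)
  simp only
  rw [integral_mul_const, mul_comm, integral_ball_dbar_mul hs (fun a => factor k l (e l) a r)]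

/-- For k ≠ l the l-th factor is τ, so `integral_tau_mul_dbar` moves ∂̄ from ψ to e_l and introduces
the cut-off r ≤ |a|. -/
theorem integral_pair_prod_ne {m : ℕ} {ψ : ℂ → ℂ} (hψ : ContDiff ℝ 1 ψ)
    (hc : HasCompactSupport ψ) (hs : tsupport ψ ⊆ Metric.ball 0 1)
    (l : Fin (m + 1)) {z : Fin m → ℂ} (hz : z ∈ polydisc m)
    (k : Fin m) {e : Fin (m + 1) → ℂ → ℂ} (he : ∀ j, ContDiff ℝ 1 (e j))
    {M : Fin (m + 1) → ℝ} (hM : ∀ j z, ‖e j z‖ ≤ M j) :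
    ∫ q, pairKernel ψ l z (l.succAbove k) q * ∏ j, e j (pairPoint l z q j)
        ∂(pairMeasure (m + 1)) =
      -∫ a, dbar (e l) a * ψ a * ∫ r in Ioo (0 : ℝ) 1, if r ≤ ‖a‖ then
        ∏ j, factor k j (e (l.succAbove j)) (z j) r else 0 := by
  have hem : ∀ j, Measurable (e j) := fun j => (he j).continuous.measurable
  rw [integral_pair_prod hψ hc hs l hz _ hem hM]
  set b : ℝ → ℂ := fun r => ∏ j, factor k j (e (l.succAbove j)) (z j) r with hb
  have hbint : IntegrableOn b (Ioo 0 1) :=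
    integrableOn_prod_factor hz k (fun j => hem _) (fun j => hM (l.succAbove j))
  have hfac : ∀ r, ∏ j, factor (l.succAbove k) (l.succAbove j) (e (l.succAbove j)) (z j) r = b r :=
    fun r => Finset.prod_congr rfl fun j _ => by
      simp only [factor, Fin.succAbove_right_inj]
  have hfl : ∀ a r, factor (l.succAbove k) l (e l) a r = tau (e l) a r := fun a r => by
    rw [factor, if_neg (Fin.succAbove_ne l k).symm]
  simp only [hfac, hfl]
  set c : ℂ → ℂ := fun a => dbar (e l) a * ψ a with hcdef
  have hcint : Integrable c :=
    ((continuous_dbar (he l)).mul hψ.continuous).integrable_of_hasCompactSupport hc.mul_left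
  have hI : Integrable (Function.uncurry fun (r : ℝ) (a : ℂ) =>
      {p : ℝ × ℂ | p.1 ≤ ‖p.2‖}.indicator (fun p => b p.1 * c p.2) (r, a))
      ((volume.restrict (Ioo (0 : ℝ) 1)).prod volume) :=
    (hbint.mul_prod hcint).indicator (measurableSet_le measurable_fst measurable_snd.norm)
  have hswap := integral_integral_swap hI
  have h1 : ∫ r in Ioo (0 : ℝ) 1, b r * ∫ a, tau (e l) a r * dbar ψ a =
      -∫ r in Ioo (0 : ℝ) 1, ∫ a, {p : ℝ × ℂ | p.1 ≤ ‖p.2‖}.indicator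
        (fun p => b p.1 * c p.2) (r, a) := by
    rw [← integral_neg]
    refine setIntegral_congr_fun measurableSet_Ioo fun r hr => ?_
    rw [integral_tau_mul_dbar (he l) hr.1.le hψ hc, mul_neg,
      ← integral_indicator (measurableSet_le_norm r), ← integral_const_mul]
    congr 1
    refine integral_congr_ae (ae_of_all _ fun a => ?_)
    by_cases h : r ≤ ‖a‖ <;> simp [indicator, h, hcdef]
  rw [h1, hswap]
  congr 1
  refine integral_congr_ae (ae_of_all _ fun a => ?_)
  simp only
  rw [← integral_const_mul]
  refine integral_congr_ae (ae_of_all _ fun r => ?_)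
  by_cases h : r ≤ ‖a‖
  · simp only [indicator, h, mem_ofPred_eq, if_true, hcdef, hb]
    ring
  · simp [indicator, h]

/-- For k = l the l-th factor is β, and ∂̄β lives on |a| = r. Integrating over r fills the disc and
evaluates the other factors at radius |a|. -/
theorem integral_pair_prod_same {m : ℕ} {ψ : ℂ → ℂ} (hψ : ContDiff ℝ 1 ψ)
    (hc : HasCompactSupport ψ) (hs : tsupport ψ ⊆ Metric.ball 0 1)
    (l : Fin (m + 1)) {z : Fin m → ℂ} (hz : z ∈ polydisc m)
    {e : Fin (m + 1) → ℂ → ℂ} (he : ∀ j, ContDiff ℝ 1 (e j))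
    {M : Fin (m + 1) → ℝ} (hM : ∀ j z, ‖e j z‖ ≤ M j) :
    Integrable (fun a => e l a * ψ a * ∏ j, tau (e (l.succAbove j)) (z j) ‖a‖) ∧
    ∫ q, pairKernel ψ l z l q * ∏ j, e j (pairPoint l z q j) ∂(pairMeasure (m + 1)) =
      ∫ a, e l a * ψ a * ∏ j, tau (e (l.succAbove j)) (z j) ‖a‖ := by
  have hem : ∀ j, Measurable (e j) := fun j => (he j).continuous.measurable
  set b : ℝ → ℂ := fun r => ∏ j, tau (e (l.succAbove j)) (z j) r with hb
  have hbint : IntegrableOn b (Ioo 0 1) :=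
    integrableOn_prod_tau hz (fun j => hem _) (fun j => hM (l.succAbove j))
  have hbm : Measurable b := Finset.measurable_fun_prod _ fun j _ => measurable_tau (hem _) _
  have hψ0 : ∀ a : ℂ, 1 ≤ ‖a‖ → ψ a = 0 := fun a ha =>
    image_eq_zero_of_notMem_tsupport fun h => not_lt.2 ha (mem_ball_zero_iff.1 (hs h))
  obtain ⟨A, hA⟩ := ((he l).continuous.mul hψ.continuous).bounded_above_of_compact_support
    (hc.mul_left (f := e l))
  have hbn : IntegrableOn (fun a : ℂ => b ‖a‖) (Metric.ball 0 1) := by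
    rw [integrableOn_fun_norm_addHaar volume (f := b)]
    refine Integrable.bdd_smul (φ := fun y : ℝ => y ^ (Module.finrank ℝ ℂ - 1)) hbint 1 ?_ ?_
    · exact Measurable.aestronglyMeasurable (by fun_prop)
    · filter_upwards [ae_restrict_mem measurableSet_Ioo] with r hr
      simp only [Complex.finrank_real_complex, Nat.add_one_sub_one, pow_one]
      rw [Real.norm_of_nonneg hr.1.le]
      exact hr.2.le
  have hFm : Measurable fun a => e l a * ψ a * b ‖a‖ := by
    have := hem l
    have := hψ.continuous.measurable
    fun_prop
  have hF : Integrable fun a => e l a * ψ a * b ‖a‖ := by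
    have h1 : IntegrableOn (fun a => e l a * ψ a * b ‖a‖) (Metric.ball 0 1) :=
      hbn.bdd_mul (c := A) ((hem l).mul hψ.continuous.measurable).aestronglyMeasurable
        (ae_of_all _ hA)
    refine (integrableOn_iff_integrable_of_support_subset ?_).1 h1
    intro a ha
    by_contra h
    rw [mem_ball_zero_iff, not_lt] at h
    exact ha (by simp [hψ0 a h])
  refine ⟨hF, ?_⟩
  rw [integral_pair_prod hψ hc hs l hz _ hem hM, integral_polar hFm hF]
  have hfac : ∀ r, ∏ j, factor l (l.succAbove j) (e (l.succAbove j)) (z j) r = b r :=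
    fun r => Finset.prod_congr rfl fun j _ => by rw [factor, if_neg (Fin.succAbove_ne l j)]
  have hfl : ∀ a r, factor l l (e l) a r = beta (e l) a r := fun a r => by rw [factor, if_pos rfl]
  simp only [hfac, hfl]
  symm
  rw [setIntegral_eq_of_subset_of_forall_sdiff_eq_zero measurableSet_Ioi
    (Ioo_subset_Ioi_self : Ioo (0 : ℝ) 1 ⊆ Ioi 0)]
  · refine setIntegral_congr_fun measurableSet_Ioo fun r hr => ?_
    rw [integral_beta_mul_dbar (he l).continuous hr.1.le hψ hc, ← integral_const_mul]
    refine integral_congr_ae (ae_of_all _ fun θ => ?_)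
    simp only
    rw [norm_circle_point hr.1.le]
    ring
  · intro r hr
    have hr1 : 1 ≤ r := by
      by_contra h
      exact hr.2 ⟨hr.1, not_le.1 h⟩
    refine setIntegral_eq_zero_of_forall_eq_zero fun θ _ => ?_
    rw [hψ0 _ (by rw [norm_circle_point (le_of_lt hr.1)]; exact hr1)]
    simp

/-! ### Superposition of products -/

/-- The superposition with density `c` of the translates of a product function. -/
def mollify {n : ℕ} (e : Fin n → ℂ → ℂ) (c : (Fin n → ℂ) → ℂ) (ζ : Fin n → ℂ) : ℂ :=
  ∫ w, c w * ∏ j, e j (ζ j - w j)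

/-- Fubini. The coefficient of the form is the density c, and the translated bumps are the product
functions, so identities for products extend to mollified coefficients. -/
theorem integral_mul_mollify {n : ℕ} {Ω : Type*} [MeasurableSpace Ω] {μ : Measure Ω} [SFinite μ]
    {a : Ω → ℂ} (ha : Integrable a μ) {pt : Ω → Fin n → ℂ} (hpt : Measurable pt)
    {c : (Fin n → ℂ) → ℂ} (hc : Integrable c) {e : Fin n → ℂ → ℂ} (he : ∀ j, Measurable (e j))
    {M : Fin n → ℝ} (hM : ∀ j z, ‖e j z‖ ≤ M j) :
    Integrable (fun w => c w * ∫ x, a x * ∏ j, e j (pt x j - w j) ∂μ) ∧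
    ∫ x, a x * mollify e c (pt x) ∂μ = ∫ w, c w * ∫ x, a x * ∏ j, e j (pt x j - w j) ∂μ := by
  have hI : Integrable (fun p : Ω × (Fin n → ℂ) =>
      a p.1 * c p.2 * ∏ j, e j (pt p.1 j - p.2 j)) (μ.prod volume) := by
    refine (ha.mul_prod hc).mul_bdd ?_
      (ae_of_all _ fun p => norm_prod_eval_le hM (fun j => pt p.1 j - p.2 j))
    refine Measurable.aestronglyMeasurable ((measurable_prod_eval he).comp ?_)
    refine measurable_pi_lambda _ fun j => ?_
    exact ((measurable_pi_apply j).comp (hpt.comp measurable_fst)).sub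
      ((measurable_pi_apply j).comp measurable_snd)
  have hl : ∀ w, ∫ x, a x * c w * ∏ j, e j (pt x j - w j) ∂μ =
      c w * ∫ x, a x * ∏ j, e j (pt x j - w j) ∂μ := fun w => by
    rw [← integral_const_mul]
    exact integral_congr_ae (ae_of_all _ fun x => by ring)
  have hr : ∀ x, ∫ w, a x * c w * ∏ j, e j (pt x j - w j) = a x * mollify e c (pt x) := fun x => by
    rw [mollify, ← integral_const_mul]
    exact integral_congr_ae (ae_of_all _ fun w => by ring)
  refine ⟨?_, ?_⟩
  · simpa only [hl] using hI.integral_prod_right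
  · simpa only [hl, hr] using integral_integral_swap
      (f := fun x w => a x * c w * ∏ j, e j (pt x j - w j)) hI

/-- The kernel of the slice integrals which remain after integrating by parts. -/
def sliceKernel {m : ℕ} (ψ : ℂ → ℂ) (z : Fin m → ℂ) (k : Fin m) (q : ℂ × (ℝ × (Fin m → ℝ))) : ℂ :=
  if q.2.1 ≤ ‖q.1‖ then ψ q.1 * (kernel z q.2 * radial (q.2.2 k)) else 0

/-- The point at which the form is evaluated in the slice integrals. -/
def slicePoint {m : ℕ} (l : Fin (m + 1)) (z : Fin m → ℂ) (q : ℂ × (ℝ × (Fin m → ℝ))) :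
    Fin (m + 1) → ℂ :=
  insertAt l q.1 (chainPoint z q.2)

theorem measurable_slicePoint {m : ℕ} (l : Fin (m + 1)) (z : Fin m → ℂ) :
    Measurable (slicePoint l z) :=
  measurable_insertAt l measurable_fst (measurable_chainPoint measurable_const measurable_snd)

theorem integrable_sliceKernel {m : ℕ} {ψ : ℂ → ℂ} (hψ : Integrable ψ) {z : Fin m → ℂ}
    (hz : z ∈ polydisc m) (k : Fin m) :
    Integrable (sliceKernel ψ z k) ((volume : Measure ℂ).prod (chainMeasure m)) := by
  have h := (hψ.mul_prod (integrable_kernel_radial hz k)).indicator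
    (s := {q : ℂ × (ℝ × (Fin m → ℝ)) | q.2.1 ≤ ‖q.1‖})
    (measurableSet_le (by fun_prop) (by fun_prop))
  refine h.congr (ae_of_all _ fun q => ?_)
  by_cases hq : q.2.1 ≤ ‖q.1‖ <;> simp [sliceKernel, indicator, hq]

theorem integral_slice_prod {m : ℕ} {ψ : ℂ → ℂ} (hψ : Integrable ψ) (l : Fin (m + 1))
    {z : Fin m → ℂ} (hz : z ∈ polydisc m) (k : Fin m) {e : Fin (m + 1) → ℂ → ℂ}
    (he : ∀ j, Measurable (e j)) {M : Fin (m + 1) → ℝ} (hM : ∀ j z, ‖e j z‖ ≤ M j) :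
    Integrable (fun a => e l a * ψ a * ∫ r in Ioo (0 : ℝ) 1, if r ≤ ‖a‖ then
        ∏ j, factor k j (e (l.succAbove j)) (z j) r else 0) ∧
    ∫ q, sliceKernel ψ z k q * ∏ j, e j (slicePoint l z q j)
        ∂((volume : Measure ℂ).prod (chainMeasure m)) =
      ∫ a, e l a * ψ a * ∫ r in Ioo (0 : ℝ) 1, if r ≤ ‖a‖ then
        ∏ j, factor k j (e (l.succAbove j)) (z j) r else 0 := by
  have hint : Integrable (fun q => sliceKernel ψ z k q * ∏ j, e j (slicePoint l z q j))
      ((volume : Measure ℂ).prod (chainMeasure m)) :=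
    (integrable_sliceKernel hψ hz k).mul_bdd
      ((measurable_prod_eval he).comp (measurable_slicePoint l z)).aestronglyMeasurable
      (ae_of_all _ fun q => norm_prod_eval_le hM _)
  have hinner : ∀ a, ∫ p, sliceKernel ψ z k (a, p) * ∏ j, e j (slicePoint l z (a, p) j)
      ∂(chainMeasure m) = e l a * ψ a * ∫ r in Ioo (0 : ℝ) 1, if r ≤ ‖a‖ then
        ∏ j, factor k j (e (l.succAbove j)) (z j) r else 0 := by
    intro a
    have h1 : ∀ p : ℝ × (Fin m → ℝ),
        sliceKernel ψ z k (a, p) * ∏ j, e j (slicePoint l z (a, p) j) =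
        e l a * ψ a * {p : ℝ × (Fin m → ℝ) | p.1 ≤ ‖a‖}.indicator (fun p => kernel z p *
          radial (p.2 k) * ∏ j, e (l.succAbove j) (chainPoint z p j)) p := fun p => by
      rw [Fin.prod_univ_succAbove _ l]
      by_cases hp : p.1 ≤ ‖a‖
      · simp only [sliceKernel, slicePoint, insertAt_same, insertAt_succAbove, hp, if_true,
          indicator, mem_ofPred_eq]
        ring
      · simp [sliceKernel, indicator, hp]
    have h2 : Integrable ({p : ℝ × (Fin m → ℝ) | p.1 ≤ ‖a‖}.indicator (fun p => kernel z p *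
          radial (p.2 k) * ∏ j, e (l.succAbove j) (chainPoint z p j))) (chainMeasure m) := by
      refine Integrable.indicator ?_ (measurableSet_le measurable_fst measurable_const)
      refine (integrable_kernel_radial hz k).mul_bdd ?_
        (ae_of_all _ fun p => norm_prod_eval_le (fun j => hM (l.succAbove j)) (chainPoint z p))
      exact ((measurable_prod_eval fun j => he (l.succAbove j)).comp
        (measurable_chainPoint measurable_const measurable_id)).aestronglyMeasurable
    simp only [h1]
    rw [integral_const_mul]
    congr 1
    unfold chainMeasure at h2 ⊢
    rw [integral_prod _ h2]
    refine integral_congr_ae (ae_of_all _ fun r => ?_)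
    by_cases hr : r ≤ ‖a‖
    · simp only [indicator, mem_ofPred_eq, hr, if_true]
      rw [← integral_kernel_radial_prod z r k fun j => e (l.succAbove j)]
      simp only [mul_assoc]
    · simp [indicator, hr]
  refine ⟨?_, ?_⟩
  · simpa only [hinner] using hint.integral_prod_left
  · rw [integral_prod _ hint]
    simp only [hinner]

/-- Apply `prod_tau_eq` in the remaining variables at radius ρ = |a|, valid for almost every a:
those with a ≠ 0 and |a| ≠ |z_j| for all j. -/
theorem integral_tau_eq_add_slice {m : ℕ} {ψ : ℂ → ℂ} (hψ : ContDiff ℝ 1 ψ)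
    (hc : HasCompactSupport ψ) (hs : tsupport ψ ⊆ Metric.ball 0 1) (l : Fin (m + 1))
    {z : Fin m → ℂ} (hz : z ∈ polydisc m) {e : Fin (m + 1) → ℂ → ℂ}
    (he : ∀ j, ContDiff ℝ 1 (e j)) (hec : ∀ j, HasCompactSupport (e j)) :
    ∫ a, e l a * ψ a * ∏ j, tau (e (l.succAbove j)) (z j) ‖a‖ =
      (∫ a, ψ a * ∏ j, e j (insertAt l a z j)) +
      ∑ k, ∫ q, sliceKernel ψ z k q * ∏ j, Function.update e (l.succAbove k)
          (dbar (e (l.succAbove k))) j (slicePoint l z q j)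
        ∂((volume : Measure ℂ).prod (chainMeasure m)) := by
  have hem : ∀ j, Measurable (e j) := fun j => (he j).continuous.measurable
  have hψi : Integrable ψ := hψ.continuous.integrable_of_hasCompactSupport hc
  choose M _ _ hM _ using fun j => exists_norm_bound (he j).continuous (hec j)
  choose M' _ _ hM' _ using fun j => exists_norm_bound (continuous_dbar (he j))
    (hasCompactSupport_dbar (hec j))
  have hum : ∀ i j, Measurable (Function.update e i (dbar (e i)) j) := fun i j => by
    rcases eq_or_ne j i with rfl | h
    · simpa using (continuous_dbar (he j)).measurable
    · simpa [h] using hem j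
  have huM : ∀ i j z, ‖Function.update e i (dbar (e i)) j z‖ ≤ max (M j) (M' j) := fun i j z => by
    rcases eq_or_ne j i with rfl | h
    · simpa using Or.inr (hM' j z)
    · simpa [h] using Or.inl (hM j z)
  have hsl := fun k => integral_slice_prod hψi l hz k (hum (l.succAbove k)) (huM (l.succAbove k))
  have hsimp : ∀ k j, Function.update e (l.succAbove k) (dbar (e (l.succAbove k)))
      (l.succAbove j) = Function.update (fun j => e (l.succAbove j)) k
        (dbar (e (l.succAbove k))) j := fun k j => by
    rcases eq_or_ne j k with rfl | h
    · simp
    · simp [h]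
  have hl : ∀ k, Function.update e (l.succAbove k) (dbar (e (l.succAbove k))) l = e l := fun k => by
    rw [Function.update_of_ne (Fin.succAbove_ne l k).symm]
  simp only [hsimp, hl] at hsl
  simp only [fun k => (hsl k).2]
  have hp : Integrable fun a => ψ a * ∏ j, e j (insertAt l a z j) :=
    hψi.mul_bdd ((measurable_prod_eval hem).comp
      (measurable_insertAt l measurable_id measurable_const)).aestronglyMeasurable
      (ae_of_all _ fun a => norm_prod_eval_le hM _)
  rw [← integral_finsetSum _ fun k _ => (hsl k).1,
    ← integral_add hp (integrable_finsetSum _ fun k _ => (hsl k).1)]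
  have hne : ∀ᵐ a : ℂ, ∀ j, ‖a‖ ≠ ‖z j‖ := ae_all_iff.2 fun j => by
    filter_upwards [ae_norm_ne ‖z j‖] with a ha using ha.symm
  refine integral_congr_ae ?_
  filter_upwards [hne, ae_norm_ne 0] with a ha ha0
  by_cases hψa : ψ a = 0
  · simp [hψa]
  have ha1 : ‖a‖ < 1 := mem_ball_zero_iff.1 (hs (subset_tsupport _ hψa))
  rw [prod_tau_eq (fun j => he (l.succAbove j)) (fun j => hec (l.succAbove j)) z
    (lt_of_le_of_ne (norm_nonneg a) ha0) ha, ← Finset.mul_sum, Fin.prod_univ_succAbove _ l]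
  simp only [insertAt_same, insertAt_succAbove]
  have hfi : ∀ k, IntegrableOn (fun r => ∏ j, factor k j (Function.update
      (fun j => e (l.succAbove j)) k (dbar (e (l.succAbove k))) j) (z j) r) (Ioo 0 1) := fun k => by
    have := integrableOn_prod_factor hz k (fun j => hum (l.succAbove k) (l.succAbove j))
      (fun j => huM (l.succAbove k) (l.succAbove j))
    simpa only [hsimp] using this
  rw [integral_finsetSum _ fun k _ => (hfi k).mono_set (Ioo_subset_Ioo_right ha1.le)]
  have hset : ∀ f : ℝ → ℂ, ∫ r in Ioo (0 : ℝ) 1, (if r ≤ ‖a‖ then f r else 0) =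
      ∫ r in Ioo 0 ‖a‖, f r := fun f => by
    rw [← integral_Ioc_eq_integral_Ioo (μ := volume) (x := 0) (y := ‖a‖)]
    have : ∀ r, (if r ≤ ‖a‖ then f r else 0) = (Iic ‖a‖).indicator f r := fun r => by
      simp [indicator]
    simp only [this]
    rw [setIntegral_indicator measurableSet_Iic]
    congr 2
    ext r
    exact ⟨fun h => ⟨h.1.1, h.2⟩, fun h => ⟨⟨h.1, h.2.trans_lt ha1⟩, h.2⟩⟩
  simp only [hset]
  ring

/-! ### Closedness of mollified forms -/

theorem wirtingerBar_eq_dbar {n : ℕ} {φ : (Fin n → ℂ) → ℂ} {w : Fin n → ℂ}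
    (hφ : DifferentiableAt ℝ φ w) (l : Fin n) :
    wirtingerBar l φ w = dbar (fun a => φ (Function.update w l a)) (w l) := by
  have h1 := hasFDerivAt_update (𝕜 := ℝ) w (i := l) (w l)
  have h2 : HasFDerivAt φ (fderiv ℝ φ w) (Function.update w l (w l)) := by
    rw [Function.update_eq_self]
    exact hφ.hasFDerivAt
  have h3 := (h2.comp (w l) h1).fderiv
  have h4 : ∀ v : ℂ, ContinuousLinearMap.pi (Pi.single (M := fun _ => ℂ →L[ℝ] ℂ) l
      (ContinuousLinearMap.id ℝ ℂ)) v = (Pi.single l v : Fin n → ℂ) := fun v => by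
    ext j
    rcases eq_or_ne j l with rfl | h
    · simp
    · simp [h]
  unfold wirtingerBar dbar
  change _ = (fderiv ℝ (φ ∘ Function.update w l) (w l) 1 +
    Complex.I * fderiv ℝ (φ ∘ Function.update w l) (w l) Complex.I) / 2
  rw [h3]
  simp only [ContinuousLinearMap.comp_apply]
  rw [← h4, ← h4]

theorem dbar_const_sub {f : ℂ → ℂ} (hf : Differentiable ℝ f) (ζ a : ℂ) :
    dbar (fun b => f (ζ - b)) a = -dbar f (ζ - a) := by
  have h1 : HasFDerivAt (fun b : ℂ => ζ - b) (-ContinuousLinearMap.id ℝ ℂ) a :=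
    (hasFDerivAt_id a).const_sub ζ
  have h2 := ((hf (ζ - a)).hasFDerivAt.comp a h1).fderiv
  unfold dbar
  change (fderiv ℝ (f ∘ fun b => ζ - b) a 1 + Complex.I *
    fderiv ℝ (f ∘ fun b => ζ - b) a Complex.I) / 2 = _
  rw [h2]
  simp
  ring

theorem dbar_mul_const {f : ℂ → ℂ} {a : ℂ} (hf : DifferentiableAt ℝ f a) (c : ℂ) :
    dbar (fun b => f b * c) a = dbar f a * c := by
  rw [dbar_mul hf (differentiableAt_const c), dbar_eq_zero (differentiableAt_const c)]
  ring

/-- The minus sign comes from differentiating in the centre w rather than in ζ. -/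
theorem wirtingerBar_prod_translate {n : ℕ} {χ : ℂ → ℂ} (hχ : Differentiable ℝ χ) (l : Fin n)
    (ζ w : Fin n → ℂ) :
    wirtingerBar l (fun w => ∏ j, χ (ζ j - w j)) w =
      -∏ j, Function.update (fun _ => χ) l (dbar χ) j (ζ j - w j) := by
  rw [wirtingerBar_eq_dbar (by fun_prop) l]
  have h : ∀ (f : Fin n → ℂ → ℂ) (v : Fin n → ℂ), ∏ j, f j (v j) =
      f l (v l) * ∏ j ∈ Finset.univ.erase l, f j (v j) := fun f v =>
    (Finset.mul_prod_erase _ _ (Finset.mem_univ l)).symm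
  have h1 : (fun a => ∏ j, χ (ζ j - Function.update w l a j)) =
      fun a => χ (ζ l - a) * ∏ j ∈ Finset.univ.erase l, χ (ζ j - w j) := by
    funext a
    rw [h (fun j v => χ (ζ j - v)) (Function.update w l a)]
    simp only [Function.update_self]
    congr 1
    refine Finset.prod_congr rfl fun j hj => ?_
    rw [Function.update_of_ne (Finset.ne_of_mem_erase hj)]
  rw [h1, dbar_mul_const (by fun_prop), dbar_const_sub hχ,
    h (fun j v => Function.update (fun _ => χ) l (dbar χ) j v) (fun j => ζ j - w j)]
  simp only [Function.update_self]
  rw [neg_mul]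
  congr 2
  refine Finset.prod_congr rfl fun j hj => ?_
  rw [Function.update_of_ne (Finset.ne_of_mem_erase hj)]

/-- Closedness is tested against the translated bump w ↦ ∏ χ(ζ_j - w_j), an admissible test function
because the margin ε keeps its support in the polydisc. -/
theorem mollify_dbar_comm {n : ℕ} {g : Fin n → polydisc n → ℂ} (hg : IsDbarClosed g)
    {χ : ℂ → ℂ} (hχ : ContDiff ℝ (⊤ : ℕ∞) χ) {ε : ℝ} (hs : tsupport χ ⊆ Metric.closedBall 0 ε)
    {ζ : Fin n → ℂ} (hζ : ∀ j, ‖ζ j‖ + ε < 1) (l k : Fin n) :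
    mollify (Function.update (fun _ => χ) l (dbar χ)) (zeroExt (g k)) ζ =
      mollify (Function.update (fun _ => χ) k (dbar χ)) (zeroExt (g l)) ζ := by
  have hd : Differentiable ℝ χ := hχ.differentiable (by simp)
  have hsub : tsupport (fun w : Fin n → ℂ => ∏ j, χ (ζ j - w j)) ⊆
      Set.pi univ fun j => Metric.closedBall (ζ j) ε := by
    refine closure_minimal (fun w hw j _ => ?_)
      (isClosed_set_pi fun j _ => Metric.isClosed_closedBall)
    have hj : χ (ζ j - w j) ≠ 0 := fun h => hw (Finset.prod_eq_zero (Finset.mem_univ j) h)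
    have := hs (subset_tsupport _ hj)
    rwa [mem_closedBall_zero_iff, ← dist_eq_norm, dist_comm] at this
  let Φ : 𝓓(polydisc n, ℂ) :=
    { toFun := fun w => ∏ j, χ (ζ j - w j)
      contDiff' := contDiff_prod fun j _ => hχ.comp (by fun_prop)
      hasCompactSupport' := (isCompact_univ_pi fun j => isCompact_closedBall (ζ j) ε).of_isClosed_subset
        (isClosed_tsupport _) hsub
      tsupport_subset' := fun w hw j => by
        have h1 := hsub hw j (mem_univ j)
        rw [Metric.mem_closedBall, dist_eq_norm] at h1
        have h2 := norm_sub_norm_le (w j) (ζ j)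
        have h3 := hζ j
        linarith }
  have key := hg l k Φ
  have hΦ : ∀ i w, wirtingerBar i Φ w =
      -∏ j, Function.update (fun _ => χ) i (dbar χ) j (ζ j - w j) :=
    fun i w => wirtingerBar_prod_translate hd i ζ w
  have hset : ∀ i j, ∫ z in (polydisc n : Set (Fin n → ℂ)), zeroExt (g i) z * wirtingerBar j Φ z =
      -mollify (Function.update (fun _ => χ) j (dbar χ)) (zeroExt (g i)) ζ := fun i j => by
    rw [setIntegral_eq_integral_of_forall_compl_eq_zero, mollify, ← integral_neg]
    · simp only [hΦ, mul_neg]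
    · intro w hw
      have : zeroExt (g i) w = 0 := dif_neg hw
      rw [this, zero_mul]
  rw [hset, hset] at key
  exact neg_inj.1 key

/-! ### The homotopy formula for mollified forms -/

theorem integral_pair_eq_neg_slice {m : ℕ} {ψ : ℂ → ℂ} (hψ : ContDiff ℝ 1 ψ)
    (hc : HasCompactSupport ψ) (hs : tsupport ψ ⊆ Metric.ball 0 1)
    (l : Fin (m + 1)) {z : Fin m → ℂ} (hz : z ∈ polydisc m)
    (k : Fin m) {e : Fin (m + 1) → ℂ → ℂ} (he : ∀ j, ContDiff ℝ 1 (e j))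
    (hec : ∀ j, HasCompactSupport (e j)) :
    ∫ q, pairKernel ψ l z (l.succAbove k) q * ∏ j, e j (pairPoint l z q j)
        ∂(pairMeasure (m + 1)) =
      -∫ q, sliceKernel ψ z k q * ∏ j, Function.update e l (dbar (e l)) j (slicePoint l z q j)
        ∂((volume : Measure ℂ).prod (chainMeasure m)) := by
  choose M _ _ hM _ using fun j => exists_norm_bound (he j).continuous (hec j)
  choose M' _ _ hM' _ using fun j => exists_norm_bound (continuous_dbar (he j))
    (hasCompactSupport_dbar (hec j))
  have hum : ∀ j, Measurable (Function.update e l (dbar (e l)) j) := fun j => by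
    rcases eq_or_ne j l with rfl | h
    · simpa using (continuous_dbar (he j)).measurable
    · simpa [h] using (he j).continuous.measurable
  have huM : ∀ j z, ‖Function.update e l (dbar (e l)) j z‖ ≤ max (M j) (M' j) := fun j z => by
    rcases eq_or_ne j l with rfl | h
    · simpa using Or.inr (hM' j z)
    · simpa [h] using Or.inl (hM j z)
  rw [integral_pair_prod_ne hψ hc hs l hz k he hM,
    (integral_slice_prod (hψ.continuous.integrable_of_hasCompactSupport hc) l hz k hum huM).2]
  simp only [Function.update_self, Function.update_of_ne (Fin.succAbove_ne l _)]

theorem update_translate {n : ℕ} (χ : ℂ → ℂ) (w : Fin n → ℂ) (i j : Fin n) (ζ : ℂ) :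
    Function.update (fun j ζ => χ (ζ - w j)) i (dbar fun ζ => χ (ζ - w i)) j ζ =
      Function.update (fun _ => χ) i (dbar χ) j (ζ - w j) := by
  rcases eq_or_ne j i with rfl | h
  · simp only [Function.update_self, sub_eq_add_neg]
    exact dbar_comp_add _ _ _
  · simp [h]

instance (n : ℕ) : SFinite (pairMeasure n) := by unfold pairMeasure; infer_instance

/-- The cancellation at the heart of the proof. Component k ≠ l gives minus the slice integral of
∂̄_l g_k; component l gives the desired right side plus the slice integrals of ∂̄_k g_l. -/
theorem sum_integral_pair_mollify {m : ℕ} {g : Fin (m + 1) → polydisc (m + 1) → ℂ}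
    (hg : IsDbarClosed g) (hgi : ∀ k, Integrable (zeroExt (g k)))
    {ψ : ℂ → ℂ} (hψ : ContDiff ℝ 1 ψ) (hc : HasCompactSupport ψ) {R ε : ℝ}
    (hs : tsupport ψ ⊆ Metric.closedBall 0 R) (hε : 0 ≤ ε) (hR : R + ε < 1)
    (l : Fin (m + 1)) {z : Fin m → ℂ} (hz : ∀ j, ‖z j‖ ≤ R)
    {χ : ℂ → ℂ} (hχ : ContDiff ℝ (⊤ : ℕ∞) χ) (hχs : tsupport χ ⊆ Metric.closedBall 0 ε) :
    ∑ k, ∫ q, pairKernel ψ l z k q * mollify (fun _ => χ) (zeroExt (g k)) (pairPoint l z q)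
        ∂(pairMeasure (m + 1)) =
      ∫ a, ψ a * mollify (fun _ => χ) (zeroExt (g l)) (insertAt l a z) := by
  have hzm : z ∈ polydisc m := fun j => by linarith [hz j]
  have hsb : tsupport ψ ⊆ Metric.ball 0 1 :=
    hs.trans (Metric.closedBall_subset_ball (by linarith))
  have hψi : Integrable ψ := hψ.continuous.integrable_of_hasCompactSupport hc
  have hχ1 : ContDiff ℝ 1 χ := hχ.of_le (by simp)
  have hχc : HasCompactSupport χ :=
    (isCompact_closedBall (0 : ℂ) ε).of_isClosed_subset (isClosed_tsupport _) hχs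
  have hχm : Measurable χ := hχ1.continuous.measurable
  obtain ⟨M, _, _, hM, _⟩ := exists_norm_bound hχ1.continuous hχc
  obtain ⟨M', _, _, hM', _⟩ := exists_norm_bound (continuous_dbar hχ1) (hasCompactSupport_dbar hχc)
  have hum : ∀ i j : Fin (m + 1), Measurable (Function.update (fun _ => χ) i (dbar χ) j) :=
    fun i j => by
      rcases eq_or_ne j i with rfl | h
      · simpa using (continuous_dbar hχ1).measurable
      · simpa [h] using hχm
  have huM : ∀ (i j : Fin (m + 1)) z,
      ‖Function.update (fun _ => χ) i (dbar χ) j z‖ ≤ max M M' := fun i j z => by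
    rcases eq_or_ne j i with rfl | h
    · simpa using Or.inr (hM' z)
    · simpa [h] using Or.inl (hM z)
  have het : ∀ (w : Fin (m + 1) → ℂ) j, ContDiff ℝ 1 fun ζ => χ (ζ - w j) := fun w j =>
    hχ1.comp (by fun_prop)
  have hetc : ∀ (w : Fin (m + 1) → ℂ) j, HasCompactSupport fun ζ => χ (ζ - w j) := fun w j =>
    hχc.comp_homeomorph (Homeomorph.subRight (w j))
  have hpair := fun k => integral_mul_mollify (integrable_pairKernel hψ hc l hzm k)
    (measurable_pairPoint l z) (hgi k) (fun _ => hχm) (fun _ => hM)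
  have hslice := fun k i j => integral_mul_mollify (integrable_sliceKernel hψi hzm k)
    (measurable_slicePoint l z) (hgi j) (hum i) (huM i)
  have hend := integral_mul_mollify hψi (measurable_insertAt l measurable_id measurable_const)
    (hgi l) (fun _ => hχm) (fun _ => hM) (pt := fun a => insertAt l a z)
  -- the components other than the `l`-th
  have hne : ∀ k, ∫ q, pairKernel ψ l z (l.succAbove k) q *
      mollify (fun _ => χ) (zeroExt (g (l.succAbove k))) (pairPoint l z q) ∂(pairMeasure (m + 1)) =
      -∫ w, zeroExt (g l) w * ∫ q, sliceKernel ψ z k q *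
        ∏ j, Function.update (fun _ => χ) (l.succAbove k) (dbar χ) j (slicePoint l z q j - w j)
          ∂((volume : Measure ℂ).prod (chainMeasure m)) := fun k => by
    rw [(hpair (l.succAbove k)).2, ← (hslice k (l.succAbove k) l).2]
    have h1 : ∀ w : Fin (m + 1) → ℂ, ∫ q, pairKernel ψ l z (l.succAbove k) q *
        ∏ j, χ (pairPoint l z q j - w j) ∂(pairMeasure (m + 1)) =
        -∫ q, sliceKernel ψ z k q *
          ∏ j, Function.update (fun _ => χ) l (dbar χ) j (slicePoint l z q j - w j)
          ∂((volume : Measure ℂ).prod (chainMeasure m)) := fun w => by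
      rw [integral_pair_eq_neg_slice hψ hc hsb l hzm k (het w) (hetc w)]
      simp only [update_translate]
    simp only [h1, mul_neg]
    rw [integral_neg, ← (hslice k l (l.succAbove k)).2]
    congr 1
    have hpos : ∀ᵐ q ∂((volume : Measure ℂ).prod (chainMeasure m)), q.2.1 ∈ Ioo (0 : ℝ) 1 :=
      Measure.quasiMeasurePreserving_snd.ae (chainMeasure_ae_mem m)
    refine integral_congr_ae ?_
    filter_upwards [hpos] with q hq
    by_cases h0 : sliceKernel ψ z k q = 0
    · simp [h0]
    have hqa : q.2.1 ≤ ‖q.1‖ := by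
      by_contra h
      exact h0 (by simp [sliceKernel, h])
    have hψa : ψ q.1 ≠ 0 := fun h => h0 (by simp [sliceKernel, h])
    have haR : ‖q.1‖ ≤ R := mem_closedBall_zero_iff.1 (hs (subset_tsupport _ hψa))
    -- The extension of g by zero need not be closed across the boundary, so closedness is available
    -- only with margin ε. It is needed only where the slice kernel is nonzero: there r ≤ |a| ≤ R
    -- and |z_j| ≤ R, so all coordinates of the slice point are at most R.
    rw [mollify_dbar_comm hg hχ hχs _ l (l.succAbove k)]
    refine (Fin.forall_iff_succAbove l).2 ⟨?_, fun j => ?_⟩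
    · simp only [slicePoint, insertAt_same]
      linarith
    · simp only [slicePoint, insertAt_succAbove]
      have := norm_node_le hq.1.le (z j) (q.2.2 j)
      have h2 : max q.2.1 ‖z j‖ ≤ R := max_le (hqa.trans haR) (hz j)
      have h3 : ‖chainPoint z q.2 j‖ ≤ R := this.trans h2
      linarith
  rw [Fin.sum_univ_succAbove _ l, hend.2]
  simp only [hne]
  rw [Finset.sum_neg_distrib, ← sub_eq_add_neg, sub_eq_iff_eq_add, (hpair l).2,
    ← integral_finsetSum _ fun k _ => (hslice k (l.succAbove k) l).1,
    ← integral_add hend.1 (integrable_finsetSum _ fun k _ => (hslice k (l.succAbove k) l).1)]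
  refine integral_congr_ae (ae_of_all _ fun w => ?_)
  simp only
  rw [(integral_pair_prod_same hψ hc hsb l hzm (het w) (fun j ζ => hM _)).2,
    integral_tau_eq_add_slice hψ hc hsb l hzm (het w) (hetc w), mul_add, Finset.mul_sum]
  simp only [update_translate]

/-! ### Removing the mollification -/

/-- The mollified value is a weighted mean of values of c. With v = 0 this bounds it by the
supremum; with v = c(ζ) it gives convergence. -/
theorem norm_mollify_sub_le {n : ℕ} {h : ℂ → ℝ} (hh : Continuous h) (h0 : ∀ a, 0 ≤ h a)
    (hc : HasCompactSupport h) (h1 : ∫ a, h a = 1) {c : (Fin n → ℂ) → ℂ} (hci : Integrable c)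
    {ζ : Fin n → ℂ} {v : ℂ} {δ : ℝ}
    (hδ : ∀ w, (∀ j, h (ζ j - w j) ≠ 0) → ‖c w - v‖ ≤ δ) :
    ‖mollify (fun _ a => (h a : ℂ)) c ζ - v‖ ≤ δ := by
  have hi : Integrable h := hh.integrable_of_hasCompactSupport hc
  obtain ⟨A, hA⟩ := hh.bounded_above_of_compact_support hc
  have hP : Integrable fun w : Fin n → ℂ => ∏ j, h (ζ j - w j) :=
    Integrable.fintype_prod (f := fun j a => h (ζ j - a)) fun j => hi.comp_sub_left (ζ j)
  have hP1 : ∫ w : Fin n → ℂ, ∏ j, h (ζ j - w j) = 1 := by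
    rw [integral_fintype_prod_volume_eq_prod fun j a => h (ζ j - a)]
    refine Finset.prod_eq_one fun j _ => ?_
    rw [integral_sub_left_eq_self, h1]
  have hPc : ∀ w : Fin n → ℂ, ∏ j, (h (ζ j - w j) : ℂ) = ((∏ j, h (ζ j - w j) : ℝ) : ℂ) :=
    fun w => by push_cast; rfl
  have hcP : Integrable fun w : Fin n → ℂ => c w * ((∏ j, h (ζ j - w j) : ℝ) : ℂ) := by
    refine hci.mul_bdd (c := ∏ _j : Fin n, A) hP.ofReal.aestronglyMeasurable (ae_of_all _ fun w => ?_)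
    rw [Complex.norm_real, norm_prod]
    exact Finset.prod_le_prod (fun _ _ => norm_nonneg _) fun j _ => hA _
  have hvP : Integrable fun w : Fin n → ℂ => v * ((∏ j, h (ζ j - w j) : ℝ) : ℂ) :=
    hP.ofReal.const_mul v
  have hv : v = ∫ w : Fin n → ℂ, v * ((∏ j, h (ζ j - w j) : ℝ) : ℂ) := by
    rw [integral_const_mul, integral_complex_ofReal, hP1]
    simp
  unfold mollify
  simp only [hPc]
  conv_lhs => rw [hv]
  rw [← integral_sub hcP hvP]
  calc _ ≤ ∫ w : Fin n → ℂ, δ * ∏ j, h (ζ j - w j) := by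
        refine norm_integral_le_of_norm_le (hP.const_mul δ) (ae_of_all _ fun w => ?_)
        have hp : 0 ≤ ∏ j, h (ζ j - w j) := Finset.prod_nonneg fun j _ => h0 _
        rw [← sub_mul, norm_mul, Complex.norm_real, Real.norm_of_nonneg hp]
        by_cases hz : ∀ j, h (ζ j - w j) ≠ 0
        · exact mul_le_mul_of_nonneg_right (hδ w hz) hp
        · push Not at hz
          obtain ⟨j, hj⟩ := hz
          rw [Finset.prod_eq_zero (Finset.mem_univ j) hj, mul_zero, mul_zero]
    _ = δ := by rw [integral_const_mul, hP1, mul_one]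

theorem measurable_mollify {n : ℕ} {e : Fin n → ℂ → ℂ} (he : ∀ j, Measurable (e j))
    {c : (Fin n → ℂ) → ℂ} (hc : Measurable c) : Measurable (mollify e c) := by
  have : StronglyMeasurable fun p : (Fin n → ℂ) × (Fin n → ℂ) => c p.2 * ∏ j, e j (p.1 j - p.2 j) := by
    refine Measurable.stronglyMeasurable ((hc.comp measurable_snd).mul ?_)
    refine Finset.measurable_fun_prod _ fun j _ => (he j).comp ?_
    fun_prop
  exact this.integral_prod_right'.measurable

theorem exists_radius {m : ℕ} {K : Set ℂ} (hK : IsCompact K) (hs : K ⊆ Metric.ball 0 1)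
    {z : Fin m → ℂ} (hz : z ∈ polydisc m) :
    ∃ R < 1, 0 ≤ R ∧ K ⊆ Metric.closedBall 0 R ∧ ∀ j, ‖z j‖ ≤ R := by
  have hcl : IsClosed (K ∪ range z) := hK.isClosed.union (finite_range z).isClosed
  obtain ⟨r, hr, hsub⟩ := exists_lt_subset_ball hcl (show K ∪ range z ⊆ Metric.ball 0 1 from
    union_subset hs (range_subset_iff.2 fun j => mem_ball_zero_iff.2 (hz j)))
  refine ⟨max r 0, max_lt hr one_pos, le_max_right _ _, fun a ha => ?_, fun j => ?_⟩
  · exact mem_closedBall_zero_iff.2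
      ((mem_ball_zero_iff.1 (hsub (Or.inl ha))).le.trans (le_max_left _ _))
  · exact (mem_ball_zero_iff.1 (hsub (Or.inr (mem_range_self j)))).le.trans (le_max_left _ _)

theorem exists_mollifier {R : ℝ} (hR : R < 1) : ∃ (ε : ℕ → ℝ) (h : ℕ → ℂ → ℝ),
    (∀ N, 0 ≤ ε N ∧ R + ε N < 1) ∧ Filter.Tendsto ε Filter.atTop (nhds 0) ∧
    ∀ N, ContDiff ℝ (⊤ : ℕ∞) (h N) ∧ (∀ a, 0 ≤ h N a) ∧ (∫ a, h N a = 1) ∧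
      tsupport (h N) = Metric.closedBall 0 (ε N) := by
  -- N + 2 rather than N + 1 makes R plus the outer radius less than 1 already for N = 0.
  have hpos : ∀ N : ℕ, 0 < (1 - R) * (1 / ((N : ℝ) + 2)) := fun N =>
    mul_pos (by linarith) (by positivity)
  let f : ∀ N : ℕ, ContDiffBump (0 : ℂ) := fun N =>
    { rIn := (1 - R) * (1 / ((N : ℝ) + 2)) / 2
      rOut := (1 - R) * (1 / ((N : ℝ) + 2))
      rIn_pos := half_pos (hpos N)
      rIn_lt_rOut := half_lt_self (hpos N) }
  refine ⟨fun N => (1 - R) * (1 / ((N : ℝ) + 2)), fun N => (f N).normed volume, fun N => ⟨(hpos N).le, ?_⟩,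
    ?_, fun N => ⟨(f N).contDiff_normed, (f N).nonneg_normed, (f N).integral_normed,
      (f N).tsupport_normed_eq⟩⟩
  · have h1 : 1 / ((N : ℝ) + 2) < 1 := by
      rw [div_lt_one (by positivity)]
      have : (0 : ℝ) ≤ N := N.cast_nonneg
      linarith
    nlinarith
  · have h1 : Filter.Tendsto (fun N : ℕ => 1 / ((N : ℝ) + 2)) Filter.atTop (nhds 0) := by
      have := (tendsto_one_div_add_atTop_nhds_zero_nat (𝕜 := ℝ)).comp (Filter.tendsto_add_atTop_nat 1)
      refine this.congr fun N => ?_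
      simp only [Function.comp]
      push_cast
      ring_nf
    simpa using h1.const_mul (1 - R)

theorem tendsto_mollify {n : ℕ} {ε : ℕ → ℝ} {h : ℕ → ℂ → ℝ}
    (hε : Filter.Tendsto ε Filter.atTop (nhds 0))
    (hh : ∀ N, ContDiff ℝ (⊤ : ℕ∞) (h N) ∧ (∀ a, 0 ≤ h N a) ∧ (∫ a, h N a = 1) ∧
      tsupport (h N) = Metric.closedBall 0 (ε N)) {c : (Fin n → ℂ) → ℂ} (hc : Integrable c)
    {ζ : Fin n → ℂ} (hζ : ContinuousAt c ζ) :
    Filter.Tendsto (fun N => mollify (fun _ a => (h N a : ℂ)) c ζ) Filter.atTop (nhds (c ζ)) := by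
  rw [Metric.tendsto_atTop']
  intro η hη
  obtain ⟨δ, hδ, hδc⟩ := Metric.continuousAt_iff.1 hζ (η / 2) (half_pos hη)
  obtain ⟨N₀, hN₀⟩ := Filter.eventually_atTop.1 (hε.eventually (gt_mem_nhds (half_pos hδ)))
  refine ⟨N₀, fun N hN => ?_⟩
  obtain ⟨h1, h2, h3, h4⟩ := hh N
  have hcs : HasCompactSupport (h N) := by
    rw [HasCompactSupport, h4]
    exact isCompact_closedBall _ _
  rw [dist_eq_norm]
  refine lt_of_le_of_lt (norm_mollify_sub_le h1.continuous h2 hcs h3 hc (δ := η / 2)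
    fun w hw => ?_) (half_lt_self hη)
  rw [← dist_eq_norm]
  refine (hδc (lt_of_le_of_lt ((dist_pi_le_iff (half_pos hδ).le).2 fun j => ?_)
    (half_lt_self hδ))).le
  have h5 : ζ j - w j ∈ tsupport (h N) := subset_tsupport _ (hw j)
  rw [h4, mem_closedBall_zero_iff, ← dist_eq_norm, dist_comm] at h5
  exact h5.trans (hN₀ N hN.le).le

theorem pairMeasure_ae_mem {m : ℕ} (l : Fin (m + 1)) {z : Fin m → ℂ} (hz : z ∈ polydisc m) :
    ∀ᵐ q ∂(pairMeasure (m + 1)), pairPoint l z q ∈ polydisc (m + 1) := by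
  have h1 : ∀ᵐ x ∂((volume.restrict (Metric.ball (0 : ℂ) 1)).prod (volume.restrict (Ioo (0 : ℝ) 1))),
      x.1 ∈ Metric.ball (0 : ℂ) 1 ∧ x.2 ∈ Ioo (0 : ℝ) 1 :=
    (Measure.quasiMeasurePreserving_fst.ae (ae_restrict_mem measurableSet_ball)).and
      (Measure.quasiMeasurePreserving_snd.ae (ae_restrict_mem measurableSet_Ioo))
  filter_upwards [Measure.quasiMeasurePreserving_fst.ae h1] with q hq
  exact chainPoint_mem (insertAt_mem l (mem_ball_zero_iff.1 hq.1) hz) hq.2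

theorem integrable_zeroExt {n : ℕ} {f : polydisc n → ℂ} (hf : Continuous f) {M : ℝ}
    (hM : ∀ z, ‖zeroExt f z‖ ≤ M) : Integrable (zeroExt f) := by
  have hfin : volume (polydisc n : Set (Fin n → ℂ)) < ⊤ := by
    refine (Metric.isBounded_ball (x := (0 : Fin n → ℂ)) (r := 2)).subset ?_ |>.measure_lt_top
    intro z hz
    rw [mem_ball_zero_iff]
    exact lt_of_le_of_lt ((pi_norm_le_iff_of_nonneg zero_le_one).2 fun j => (hz j).le) one_lt_two
  have h : IntegrableOn (zeroExt f) (polydisc n : Set (Fin n → ℂ)) :=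
    Measure.integrableOn_of_bounded hfin.ne (measurable_zeroExt hf).aestronglyMeasurable
      (ae_of_all _ hM)
  refine (integrableOn_iff_integrable_of_support_subset fun z hz => ?_).1 h
  by_contra hn
  exact hz (dif_neg hn)

theorem continuousAt_zeroExt {n : ℕ} {f : polydisc n → ℂ} (hf : Continuous f) {ζ : Fin n → ℂ}
    (hζ : ζ ∈ polydisc n) : ContinuousAt (zeroExt f) ζ :=
  (continuousOn_zeroExt hf).continuousAt ((polydisc n).isOpen.mem_nhds hζ)

/-- Dominated convergence: mollification preserves the bounds of g, the kernel is integrable, and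
almost every evaluation point lies in the open polydisc, where g is continuous. -/
theorem sum_integral_pair {m : ℕ} {g : Fin (m + 1) → polydisc (m + 1) → ℂ}
    (hg : IsDbarClosed g) (hgc : ∀ k, Continuous (g k)) {M : Fin (m + 1) → ℝ}
    (hM : ∀ k z, ‖zeroExt (g k) z‖ ≤ M k) {ψ : ℂ → ℂ} (hψ : ContDiff ℝ 1 ψ)
    (hc : HasCompactSupport ψ) (hs : tsupport ψ ⊆ Metric.ball 0 1)
    (l : Fin (m + 1)) {z : Fin m → ℂ} (hz : z ∈ polydisc m) :
    ∑ k, ∫ q, pairKernel ψ l z k q * zeroExt (g k) (pairPoint l z q) ∂(pairMeasure (m + 1)) =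
      ∫ a, ψ a * zeroExt (g l) (insertAt l a z) := by
  obtain ⟨R, hR1, hR0, hKR, hzR⟩ := exists_radius hc hs hz
  obtain ⟨ε, h, hε, hεt, hh⟩ := exists_mollifier hR1
  have hgi := fun k => integrable_zeroExt (hgc k) (hM k)
  have hgm := fun k => measurable_zeroExt (hgc k)
  have hsupp : ∀ N, Function.support (fun a => (h N a : ℂ)) = Function.support (h N) := fun N => by
    ext a; simp
  have hcs : ∀ N, HasCompactSupport (h N) := fun N => by
    rw [HasCompactSupport, (hh N).2.2.2]
    exact isCompact_closedBall _ _
  have hbound : ∀ N k ζ, ‖mollify (fun _ a => (h N a : ℂ)) (zeroExt (g k)) ζ‖ ≤ M k :=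
    fun N k ζ => by
      simpa using norm_mollify_sub_le (hh N).1.continuous (hh N).2.1 (hcs N) (hh N).2.2.1 (hgi k)
        (ζ := ζ) (v := 0) (δ := M k) fun w _ => by simpa using hM k w
  have hmeas : ∀ N k, Measurable (mollify (fun _ a => (h N a : ℂ)) (zeroExt (g k))) := fun N k =>
    measurable_mollify (fun _ => Complex.measurable_ofReal.comp (hh N).1.continuous.measurable)
      (hgm k)
  have heq : ∀ N, _ := fun N => sum_integral_pair_mollify hg hgi hψ hc hKR (hε N).1 (hε N).2 l hzR
    (χ := fun a => (h N a : ℂ)) (Complex.ofRealCLM.contDiff.comp (hh N).1)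
    (by rw [tsupport, hsupp, ← tsupport, (hh N).2.2.2])
  have hlim1 := tendsto_finsetSum (Finset.univ : Finset (Fin (m + 1))) fun k _ =>
    tendsto_integral_of_dominated_convergence (μ := pairMeasure (m + 1))
      (F := fun N q => pairKernel ψ l z k q *
        mollify (fun _ a => (h N a : ℂ)) (zeroExt (g k)) (pairPoint l z q))
      (f := fun q => pairKernel ψ l z k q * zeroExt (g k) (pairPoint l z q))
      (fun q => ‖pairKernel ψ l z k q‖ * M k)
      (fun N => (integrable_pairKernel_mul hψ hc l hz k (hmeas N k) (hbound N k)).1)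
      ((integrable_pairKernel hψ hc l hz k).norm.mul_const _)
      (fun N => ae_of_all _ fun q => by
        rw [norm_mul]
        exact mul_le_mul_of_nonneg_left (hbound N k _) (norm_nonneg _))
      (by
        filter_upwards [pairMeasure_ae_mem l hz] with q hq
        exact (tendsto_mollify hεt hh (hgi k) (continuousAt_zeroExt (hgc k) hq)).const_mul _)
  have hψi : Integrable ψ := hψ.continuous.integrable_of_hasCompactSupport hc
  have hlim2 := tendsto_integral_of_dominated_convergence (μ := (volume : Measure ℂ))
      (F := fun N a => ψ a * mollify (fun _ a => (h N a : ℂ)) (zeroExt (g l)) (insertAt l a z))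
      (f := fun a => ψ a * zeroExt (g l) (insertAt l a z))
      (fun a => ‖ψ a‖ * M l)
      (fun N => (hψ.continuous.measurable.mul ((hmeas N l).comp
        (measurable_insertAt l measurable_id measurable_const))).aestronglyMeasurable)
      (hψi.norm.mul_const _)
      (fun N => ae_of_all _ fun q => by
        rw [norm_mul]
        exact mul_le_mul_of_nonneg_left (hbound N l _) (norm_nonneg _))
      (ae_of_all _ fun a => by
        by_cases ha : ψ a = 0
        · simp [ha]
        have ha1 : ‖a‖ < 1 := mem_ball_zero_iff.1 (hs (subset_tsupport _ ha))
        exact (tendsto_mollify hεt hh (hgi l)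
          (continuousAt_zeroExt (hgc l) (insertAt_mem l ha1 hz))).const_mul _)
  exact tendsto_nhds_unique hlim1 (hlim2.congr fun N => (heq N).symm)

/-- The equation `∂u/∂z̄_l = g_l` on slices, tested against functions of one variable. -/
theorem integral_henkin_mul_dbar {m : ℕ} {g : Fin (m + 1) → polydisc (m + 1) → ℂ}
    (hg : IsDbarClosed g) (hgc : ∀ k, Continuous (g k)) {M : Fin (m + 1) → ℝ}
    (hM : ∀ k z, ‖zeroExt (g k) z‖ ≤ M k) {ψ : ℂ → ℂ} (hψ : ContDiff ℝ 1 ψ)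
    (hc : HasCompactSupport ψ) (hs : tsupport ψ ⊆ Metric.ball 0 1)
    (l : Fin (m + 1)) {z : Fin m → ℂ} (hz : z ∈ polydisc m) :
    ∫ a, zeroExt (henkin g) (insertAt l a z) * dbar ψ a =
      -∫ a, zeroExt (g l) (insertAt l a z) * ψ a := by
  have hgm := fun k => measurable_zeroExt (hgc k)
  rw [← integral_ball_dbar_mul hs (fun a => zeroExt (henkin g) (insertAt l a z))]
  have key := sum_integral_pair hg hgc hM hψ hc hs l hz
  have hint : ∀ k, Integrable (fun q : ℂ × (ℝ × (Fin (m + 1) → ℝ)) =>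
      dbar ψ q.1 * (kernel (insertAt l q.1 z) q.2 * radial (q.2.2 k)) *
        zeroExt (g k) (chainPoint (insertAt l q.1 z) q.2))
      ((volume.restrict (Metric.ball (0 : ℂ) 1)).prod (chainMeasure (m + 1))) := fun k =>
    (integrable_pairKernel_assoc hψ hc l hz k).mul_bdd ((hgm k).comp (measurable_chainPoint
      (measurable_insertAt l measurable_fst measurable_const)
      measurable_snd)).aestronglyMeasurable (ae_of_all _ fun _ => hM k _)
  have hk : ∀ k, ∫ q, pairKernel ψ l z k q * zeroExt (g k) (pairPoint l z q)
      ∂(pairMeasure (m + 1)) = ∫ q : ℂ × (ℝ × (Fin (m + 1) → ℝ)),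
      dbar ψ q.1 * (kernel (insertAt l q.1 z) q.2 * radial (q.2.2 k)) *
        zeroExt (g k) (chainPoint (insertAt l q.1 z) q.2)
      ∂((volume.restrict (Metric.ball (0 : ℂ) 1)).prod (chainMeasure (m + 1))) := fun k => by
    rw [← (measurePreserving_pairAssoc (m + 1)).integral_comp']
    rfl
  simp only [hk] at key
  rw [← integral_finsetSum _ fun k _ => hint k, integral_prod _
    (integrable_finsetSum _ fun k _ => hint k)] at key
  simp only [mul_comm (zeroExt (g l) _)]
  rw [← key, ← integral_neg]
  refine setIntegral_congr_fun measurableSet_ball fun a ha => ?_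
  have hmem := insertAt_mem l (mem_ball_zero_iff.1 ha) hz
  simp only
  rw [zeroExt_of_mem _ hmem, (henkin_eq_integral g ⟨_, hmem⟩
    (integrable_density hgm hM hmem)).2, mul_neg, ← integral_const_mul]
  congr 1
  refine integral_congr_ae (ae_of_all _ fun p => ?_)
  simp only [density, Finset.mul_sum]
  refine Finset.sum_congr rfl fun k _ => ?_
  ring

/-! ### The equation in several variables -/

theorem update_insertAt {m : ℕ} (l : Fin (m + 1)) (a b : ℂ) (z : Fin m → ℂ) :
    Function.update (insertAt l a z) l b = insertAt l b z := Fin.update_insertNth ..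

theorem contDiff_insertAt {m : ℕ} (l : Fin (m + 1)) (z : Fin m → ℂ) :
    ContDiff ℝ (⊤ : ℕ∞) fun a => insertAt l a z := by
  refine contDiff_pi.2 ((Fin.forall_iff_succAbove l).2 ⟨?_, fun j => ?_⟩)
  · simpa using contDiff_fun_id
  · simpa using contDiff_const

theorem integral_eq_integral_insertAt {m : ℕ} (l : Fin (m + 1)) {F : (Fin (m + 1) → ℂ) → ℂ}
    (hF : Integrable F) : ∫ w, F w = ∫ z, ∫ a, F (insertAt l a z) := by
  have hmp := (volume_preserving_piFinSuccAbove (fun _ : Fin (m + 1) => ℂ) l).symm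
  have h1 := hmp.integral_comp' F
  have h2 : Integrable (fun p : ℂ × (Fin m → ℂ) => F (insertAt l p.1 p.2))
      ((volume : Measure ℂ).prod volume) := hmp.integrable_comp_of_integrable hF
  rw [← integral_prod_symm _ h2]
  exact h1.symm

/-- Slice the test function in the l-th variable and use the one-variable identity on each slice;
slices that miss the polydisc contribute zero on both sides. Continuity of the solution enters only
through integrability for Fubini. -/
theorem isDbarSolution_henkin {n : ℕ} {α : ℝ≥0} (hα0 : 0 < α)
    {g : Fin n → polydisc n → ℂ} (hg : IsDbarClosed g) (hgh : ∀ k, MemHolder α (g k))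
    (hu : Continuous (henkin g)) : IsDbarSolution (henkin g) g := by
  intro l φ
  cases n with
  | zero => exact l.elim0
  | succ m =>
  have hgc := fun k => continuous_of_memHolder hα0 (hgh k)
  have hM := fun k => norm_zeroExt_le (hgh k)
  have hoff : ∀ (f : polydisc (m + 1) → ℂ) (w : Fin (m + 1) → ℂ),
      w ∉ (polydisc (m + 1) : Set (Fin (m + 1) → ℂ)) → zeroExt f w = 0 := fun f w hw => dif_neg hw
  have hwhole : ∀ (f : polydisc (m + 1) → ℂ) (G : (Fin (m + 1) → ℂ) → ℂ),
      ∫ z in (polydisc (m + 1) : Set (Fin (m + 1) → ℂ)), zeroExt f z * G z =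
        ∫ z, zeroExt f z * G z := fun f G =>
    setIntegral_eq_integral_of_forall_compl_eq_zero fun w hw => by rw [hoff f w hw, zero_mul]
  have hi1 : Integrable fun w => zeroExt (henkin g) w * wirtingerBar l φ w := by
    refine (integrableOn_iff_integrable_of_support_subset fun w hw => ?_).1
      (integrable_zeroExt_mul_wirtingerBar hu l φ)
    by_contra h
    exact hw (by simp only [hoff _ w h, zero_mul])
  obtain ⟨A, hA⟩ := φ.continuous.bounded_above_of_compact_support φ.hasCompactSupport
  have hi2 : Integrable fun w => zeroExt (g l) w * φ w :=
    (integrable_zeroExt (hgc l) (hM l)).mul_bdd φ.continuous.aestronglyMeasurable (ae_of_all _ hA)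
  rw [hwhole, hwhole, integral_eq_integral_insertAt l hi1, integral_eq_integral_insertAt l hi2,
    ← integral_neg]
  refine integral_congr_ae (ae_of_all _ fun z => ?_)
  simp only
  by_cases hz : z ∈ polydisc m
  · have hd : Differentiable ℝ φ := φ.contDiff.differentiable (by simp)
    have hdb : ∀ a, wirtingerBar l φ (insertAt l a z) = dbar (fun b => φ (insertAt l b z)) a :=
      fun a => by
        rw [wirtingerBar_eq_dbar (hd _) l]
        simp only [update_insertAt, insertAt_same]
    simp only [hdb]
    have hcont : Continuous fun a => insertAt l a z := (contDiff_insertAt l z).continuous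
    have hsub : ∀ a ∈ tsupport (fun b => φ (insertAt l b z)), insertAt l a z ∈ tsupport φ :=
      tsupport_comp_subset_preimage φ hcont
    have hcomp : HasCompactSupport fun b => φ (insertAt l b z) := by
      refine ((φ.hasCompactSupport.image (continuous_apply l))).of_isClosed_subset
        (isClosed_tsupport _) fun a ha => ⟨insertAt l a z, hsub a ha, by simp⟩
    refine integral_henkin_mul_dbar hg hgc hM
      ((φ.contDiff.comp (contDiff_insertAt l z)).of_le (by simp)) hcomp (fun a ha => ?_) l hz
    have := φ.tsupport_subset (hsub a ha) l
    rw [insertAt_same] at this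
    exact mem_ball_zero_iff.2 this
  · have hn : ∀ a, insertAt l a z ∉ (polydisc (m + 1) : Set (Fin (m + 1) → ℂ)) := fun a h =>
      hz fun j => by simpa using h (l.succAbove j)
    simp only [hoff _ _ (hn _), zero_mul, integral_zero, neg_zero]

/-! ### Linearity and boundedness -/

theorem henkin_integrals {n : ℕ} {α : ℝ≥0} (hα0 : 0 < α) {g : Fin n → polydisc n → ℂ}
    (hg : ∀ k, MemHolder α (g k)) (z : polydisc n) :
    Integrable (density (fun k => zeroExt (g k)) z) (chainMeasure n) ∧
    (∀ J : Finset (Fin n), IntegrableOn (henkinIntegrand g J z) (henkinRegion J z)) ∧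
    henkin g z = -∫ p, density (fun k => zeroExt (g k)) z p ∂(chainMeasure n) :=
  have h := integrable_density (fun k => measurable_zeroExt (continuous_of_memHolder hα0 (hg k)))
    (fun k => norm_zeroExt_le (hg k)) z.2
  ⟨h, henkin_eq_integral g z h⟩

theorem henkin_add {n : ℕ} {α : ℝ≥0} (hα0 : 0 < α) {g h : Fin n → polydisc n → ℂ}
    (hg : ∀ k, MemHolder α (g k)) (hh : ∀ k, MemHolder α (h k)) :
    henkin (g + h) = henkin g + henkin h := by
  funext z
  have h1 := henkin_integrals hα0 hg z
  have h2 := henkin_integrals hα0 hh z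
  rw [Pi.add_apply, (henkin_integrals hα0 (g := g + h) (fun k => (hg k).add (hh k)) z).2.2, h1.2.2, h2.2.2,
    ← neg_add, ← integral_add h1.1 h2.1]
  congr 1
  refine integral_congr_ae (ae_of_all _ fun p => ?_)
  simp only [density, Pi.add_apply, zeroExt_add, mul_add, Finset.sum_add_distrib]

theorem henkin_smul {n : ℕ} {α : ℝ≥0} (hα0 : 0 < α) (c : ℂ) {g : Fin n → polydisc n → ℂ}
    (hg : ∀ k, MemHolder α (g k)) : henkin (c • g) = c • henkin g := by
  funext z
  rw [Pi.smul_apply, (henkin_integrals hα0 (g := c • g) (fun k => (hg k).smul (c := c)) z).2.2,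
    (henkin_integrals hα0 hg z).2.2, smul_eq_mul, mul_neg, ← integral_const_mul]
  congr 1
  refine integral_congr_ae (ae_of_all _ fun p => ?_)
  simp only [density, Pi.smul_apply, zeroExt_smul, Finset.mul_sum]
  exact Finset.sum_congr rfl fun k _ => by ring

theorem exists_holderNorm_henkin_le (n : ℕ) {α : ℝ≥0} (hα0 : 0 < α) (hα1 : α < 1) :
    ∃ C : ℝ, ∀ g : Fin n → polydisc n → ℂ, (∀ k, MemHolder α (g k)) →
      MemHolder α (henkin g) ∧ holderNorm α (henkin g) ≤ C * formHolderNorm α g := by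
  obtain ⟨C, hC0, hC⟩ := exists_henkin_bound n hα1
  -- One C for the supremum, one for the Hölder constant.
  refine ⟨2 * C, fun g hg => ?_⟩
  obtain ⟨h1, h2⟩ := hC g hg hα0
  have hB : 0 ≤ C * formHolderNorm α g := (norm_nonneg _).trans (h1 (Classical.arbitrary _))
  have hw : HolderWith (C * formHolderNorm α g).toNNReal α (henkin g) := by
    intro z w
    rw [edist_nndist, edist_nndist, ← ENNReal.coe_rpow_of_nonneg _ α.coe_nonneg, ← ENNReal.coe_mul,
      ENNReal.coe_le_coe, ← NNReal.coe_le_coe]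
    push_cast
    rw [dist_eq_norm, Real.coe_toNNReal _ hB]
    exact h2 z w
  refine ⟨hw.memHolder, ?_⟩
  have h3 : (nnHolderNorm α (henkin g) : ℝ) ≤ C * formHolderNorm α g := by
    simpa only [Real.coe_toNNReal _ hB] using NNReal.coe_le_coe.2 hw.nnholderNorm_le
  have h4 : ⨆ z, ‖henkin g z‖ ≤ C * formHolderNorm α g := ciSup_le h1
  unfold holderNorm
  linarith

end Henkin
end

/-! ### Henkin's operator as a bounded solution operator -/

theorem theorem3 (n : ℕ) (α : ℝ≥0) (hα₀ : 0 < α) (hα₁ : α < 1) :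
    (∀ g ∈ closedForms n α hα₀, ∀ (z : polydisc n) (J : Finset (Fin n)), J ≠ Finset.univ →
      IntegrableOn (henkinIntegrand g J z) (henkinRegion J (z : Fin n → ℂ))) ∧
    ∃ H : closedForms n α hα₀ →ₗ[ℂ] holderSpace n α,
      (∀ (g : closedForms n α hα₀) (z : polydisc n), (H g).1 z = henkin g.1 z) ∧
      (∀ g : closedForms n α hα₀, IsDbarSolution (H g).1 g.1) ∧
      ∃ C : ℝ, ∀ g : closedForms n α hα₀,
        holderNorm α (H g).1 ≤ C * formHolderNorm α g.1 := by
  obtain ⟨C, hC⟩ := Henkin.exists_holderNorm_henkin_le n hα₀ hα₁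
  refine ⟨fun g hg z J _ => (Henkin.henkin_integrals hα₀ hg.1 z).2.1 J, ?_⟩
  refine ⟨{ toFun := fun g => ⟨henkin g.1, (hC g.1 g.2.1).1⟩
            map_add' := fun g h => Subtype.ext (Henkin.henkin_add hα₀ g.2.1 h.2.1)
            map_smul' := fun c g => Subtype.ext (Henkin.henkin_smul hα₀ c g.2.1) },
    fun _ _ => rfl, fun g => ?_, C, fun g => (hC g.1 g.2.1).2⟩
  exact Henkin.isDbarSolution_henkin hα₀ g.2.2 g.2.1
    (Henkin.continuous_of_memHolder hα₀ (hC g.1 g.2.1).1)
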